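/- Let $k\ge 0$ and $s\ge 1$ be integers and let $V_1,V_2,\dots$ be distinct vertices. Multigraphs may have loops and multiple edges; a loop counts twice in the degree; $\#_{v,w}(G)$ is the number of edges $\{v,w\}$ of $G$, and two multigraphs with the same vertices and the same numbers $\#_{v,w}$ are identified. The surplus of $G=(V,E)$ is $|E|-|V|+1$. Put $\circ(G)=\prod_{v}2^{\#_{v,v}(G)}\prod_{\{v,w\}}\#_{v,w}(G)!$, the second product being over unordered pairs, $v=w$ included. A random multigraph $M$ *biased by $\circ(\cdot)$ and conditioned on an event $C$* has the law $B\mapsto \mathbb E[\circ(M)\mathbf 1_{M\in B\cap C}]/\mathbb E[\circ(M)\mathbf 1_{M\in C}]$. **(a)** Let $d_1\ge\dots\ge d_s\ge 0$ be integers with $\sum_i d_i=2s+2k-2$ and, if $s\ge2$, with $d_i\ge 1$ for all $i$. Let $\mathrm{CM}$ be the configuration model: take a uniform fixed-point-free involution $f$ of the half-edges $\{(i,a):1\le i\le s,\ 1\le a\le d_i\}$; the vertices are $V_1,\dots,V_s$ and there is one edge $\{V_i,V_j\}$ for each pair $\{(i,a),(j,b)\}$ exchanged by $f$. Then $0<\mathbb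 E[\circ(\mathrm{CM})\mathbf 1_{\mathrm{CM}\text{ connected}}]<\infty$, and $\mathrm{CM}$ biased by $\circ(\cdot)$ and conditioned on being connected is a $((d_1-1,\dots,d_s-1),k)$-graph, that is, it is uniform among the connected multigraphs with vertices $V_1,\dots,V_s$, surplus $k$ and $\deg V_i=(d_i-1)+1=d_i$ for all $i$. **(b)** Let $\lambda>0$ and $w_1\ge\dots\ge w_s>0$ be real. Let $\mathrm{MG}$ be the multiplicative Poisson multigraph with vertices $V_1,\dots,V_s$: the numbers $\#_{V_i,V_j}$, $1\le i\le j\le s$, are independent Poisson variables, with mean $\lambda w_iw_j$ if $i<j$ and $\lambda w_i^2/2$ if $i=j$. Let $C$ be the event that $\mathrm{MG}$ is connected with surplus $k$, and let $\mathbf p=(p_1,\dots,p_s,0,0,\dots)$ with $p_i=w_i/\sum_j w_j$. Then $0<\mathbb E[\circ(\mathrm{MG})\mathbf 1_C]<\infty$, and $\mathrm{MG}$ biased by $\circ(\cdot)$ and conditioned on $C$ is a $(\mathbf p,k)$-graph. Here the $(\mathbf p,k)$-graph is defined as follows. Let $A_1,A_2,\dots$ be i.i.d. with $\mathbb P(A_1=V_i)=p_i$,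 and let $\star_0,\star_1,\dots$ be further vertices. Build a tree $T=T(A)$ step by step: start with the edge $\{\star_0,A_1\}$; for $n\ge 2$ add the edge $\{A_{n-1},A_n\}$ if $A_n$ is not yet in the tree, and otherwise the edge $\{A_{n-1},\star_j\}$, with $j$ minimal such that $\star_j$ is not yet in the tree. Gluing two leaves $L_1,L_2$ with neighbours $F_1,F_2$ means deleting $L_1,L_2$ and their edges and adding one edge $\{F_1,F_2\}$. Let $T_i$ be $T$ with $\star_{2j-1}$ and $\star_{2j}$ glued for $j=1,\dots,i$, and let $\square(G)$ be the number of edges of $G$, counted with multiplicity, whose removal (one copy, keeping all vertices) leaves $G$ connected. Bias the law of the sequence $A$ by $\circ(T_k)/\prod_{i=1}^k\square(T_i)$, normalised by its expectation; the $(\mathbf p,k)$-graph is $T_k$, for this biased sequence, with all remaining vertices $\star_j$ removed. -/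

import Mathlib

open MeasureTheory ProbabilityTheory Set
open scoped ENNReal NNReal Nat

noncomputable section

namespace ConnMultigraph

/-! ## Multigraphs -/

/-- A multigraph (loops and multiple edges allowed): a vertex set together with the number
`mult s(v, w)` of edges between `v` and `w`. The edges have no names, so two multigraphs are equal
as soon as they have the same vertices and the same edge numbers. -/
@[ext]
structure Multigraph (α : Type) where
  verts : Set α
  mult : Sym2 α → ℕ
  mem_verts : ∀ e, mult e ≠ 0 → ∀ v ∈ e, v ∈ verts

namespace Multigraph

variable {α : Type}

/-- The product σ-algebra: generated by the events `v ∈ verts` and by the edge numbers. -/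
instance : MeasurableSpace (Multigraph α) :=
  MeasurableSpace.comap (fun G => (G.verts, G.mult)) inferInstance

/-- Non-empty, and any two vertices are joined by a path. -/
def Connected (G : Multigraph α) : Prop :=
  G.verts.Nonempty ∧
    ∀ u ∈ G.verts, ∀ v ∈ G.verts, Relation.ReflTransGen (fun a b => 0 < G.mult s(a, b)) u v

/-- The number of edges, with multiplicity. -/
def edgeCount (G : Multigraph α) : ℕ := ∑ᶠ e, G.mult e

/-- The degree of `v`; a loop counts twice. -/
def degree (G : Multigraph α) (v : α) : ℕ := (∑ᶠ w, G.mult s(v, w)) + G.mult s(v, v)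

/-- The surplus `|E| - |V| + 1` of a finite multigraph. -/
def surplus (G : Multigraph α) : ℤ := (G.edgeCount : ℤ) - (G.verts.ncard : ℤ) + 1

/-- `∘(G) = ∏_v 2 ^ #_{v,v}(G) * ∏_{{v,w}} #_{v,w}(G)!`, the second product being over
unordered pairs, `v = w` included. -/
def circ (G : Multigraph α) : ℕ := (∏ᶠ v, 2 ^ G.mult s(v, v)) * ∏ᶠ e, (G.mult e)!

open Classical in
/-- `G \ {e}`: one copy of the edge `e` is removed, the vertices stay. -/
def deleteEdge (G : Multigraph α) (e : Sym2 α) : Multigraph α where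
  verts := G.verts
  mult e' := G.mult e' - if e' = e then 1 else 0
  mem_verts e' h := G.mem_verts e' (by omega)

open Classical in
/-- `□(G)`: the number of edges, counted with multiplicity, whose removal leaves `G` connected. -/
def square (G : Multigraph α) : ℕ :=
  ∑ᶠ e, if (G.deleteEdge e).Connected then G.mult e else 0

open Classical in
/-- `G \ S`: the vertices in `S` are removed, with all edges at them. -/
def removeVerts (G : Multigraph α) (S : Set α) : Multigraph α where
  verts := G.verts \ S
  mult e := if ∃ v ∈ e, v ∈ S then 0 else G.mult e
  mem_verts e h v hv := by
    by_cases hS : ∃ v ∈ e, v ∈ S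
    · simp [hS] at h
    · rw [if_neg hS] at h
      exact ⟨G.mem_verts e h v hv, fun hvS => hS ⟨v, hv, hvS⟩⟩

open Classical in
/-- The father of a leaf `L`: the only neighbour of `L` (and `L` itself if there is no unique
neighbour, which does not happen for a leaf). -/
def father (G : Multigraph α) (L : α) : α :=
  if h : ∃! F, 0 < G.mult s(F, L) then h.choose else L

theorem father_spec (G : Multigraph α) (L : α) (h : G.father L ≠ L) :
    0 < G.mult s(G.father L, L) := by
  unfold father at h ⊢
  split_ifs at h ⊢ with h'
  · exact h'.choose_spec.1
  · exact absurd rfl h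

open Classical in
/-- Gluing the leaves `L₁` and `L₂`, with fathers `F₁` and `F₂`: the vertices `L₁`, `L₂` and
their edges `{F₁, L₁}`, `{F₂, L₂}` are removed, and one edge `{F₁, F₂}` is added. -/
def glue (L₁ L₂ : α) (G : Multigraph α) : Multigraph α where
  verts := G.verts \ {L₁, L₂}
  mult e :=
    if L₁ ∈ e ∨ L₂ ∈ e then 0
    else G.mult e + if e = s(G.father L₁, G.father L₂) then 1 else 0
  mem_verts e h v hv := by
    by_cases hL : L₁ ∈ e ∨ L₂ ∈ e
    · simp [hL] at h
    rw [if_neg hL] at h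
    push Not at hL
    refine ⟨?_, ?_⟩
    · by_cases he : e = s(G.father L₁, G.father L₂)
      · subst he
        have h1 : G.father L₁ ≠ L₁ := fun hh => hL.1 (by simp [hh])
        have h2 : G.father L₂ ≠ L₂ := fun hh => hL.2 (by simp [hh])
        rcases Sym2.mem_iff.1 hv with rfl | rfl
        · exact G.mem_verts _ (G.father_spec L₁ h1).ne' _ (by simp)
        · exact G.mem_verts _ (G.father_spec L₂ h2).ne' _ (by simp)
      · rw [if_neg he] at h
        exact G.mem_verts e (by simpa using h) v hv
    · rintro (rfl | rfl)
      · exact hL.1 hv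
      · exact hL.2 hv

open Classical in
/-- The (multi)graph whose edges are the elements of `E` and whose vertices are their ends. -/
def ofEdgeSet (E : Set (Sym2 α)) : Multigraph α where
  verts := {v | ∃ e ∈ E, v ∈ e}
  mult e := if e ∈ E then 1 else 0
  mem_verts e h v hv := by
    by_cases he : e ∈ E
    · exact ⟨e, he, hv⟩
    · simp [he] at h

end Multigraph

/-- The vertices `V_i`, `V_{∞,i}` and `⋆_i`. The `V`'s are numbered from `0` here: `V i` stands
for the vertex usually called `V_{i+1}`. The stars are numbered from `0`. -/
inductive Vertex where
  | V (i : ℕ)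
  | Vinf (i : ℕ)
  | star (i : ℕ)

open Classical in
/-- The multigraph with vertices `V_1, …, V_s` and with `m s(i, j)` edges `{V_i, V_j}`. -/
def ofMatrix {s : ℕ} (m : Sym2 (Fin s) → ℕ) : Multigraph Vertex where
  verts := Set.range fun i : Fin s => Vertex.V i
  mult e := ∑ e' : Sym2 (Fin s), if e'.map (fun i : Fin s => Vertex.V i) = e then m e' else 0
  mem_verts e h v hv := by
    obtain ⟨e', -, he'⟩ := Finset.exists_ne_zero_of_sum_ne_zero h
    by_cases hh : e'.map (fun i : Fin s => Vertex.V i) = e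
    · subst hh
      obtain ⟨i, -, rfl⟩ := Sym2.mem_map.1 hv
      exact ⟨i, rfl⟩
    · simp [hh] at he'

/-! ## Biasing and conditioning -/

/-- The measure `μ` biased by `∘(·)`. It need not be finite or normalised. -/
def biased (μ : Measure (Multigraph Vertex)) : Measure (Multigraph Vertex) :=
  μ.withDensity fun G => (G.circ : ℝ≥0∞)

/-- A random multigraph with law `μ`, biased by `∘(·)` and conditioned on the event `C`, is well
defined and has law `ν`: the mass `E[∘ 1_C]` is positive and finite, and the measure
`B ↦ E[∘ 1_{B ∩ C}] / E[∘ 1_C]` is `ν`. -/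
def HasBiasedConditionedLaw (μ : Measure (Multigraph Vertex)) (C : Set (Multigraph Vertex))
    (ν : Measure (Multigraph Vertex)) : Prop :=
  0 < biased μ C ∧ biased μ C < ∞ ∧ cond (biased μ) C = ν

/-! ## The configuration model -/

/-- Non-increasing sequences `d_1 ≥ … ≥ d_s` of natural numbers with an even sum. -/
def OmegaCM {s : ℕ} (d : Fin s → ℕ) : Prop := Antitone d ∧ Even (∑ i, d i)

/-- The half-edges `(i, a)`, `1 ≤ i ≤ s`, `1 ≤ a ≤ d_i`. -/
abbrev HalfEdge {s : ℕ} (d : Fin s → ℕ) : Type := Σ i : Fin s, Fin (d i)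

/-- The matchings of the half-edges: involutions without fixed points. -/
def Matching {s : ℕ} (d : Fin s → ℕ) : Type :=
  {f : HalfEdge d → HalfEdge d // (∀ x, f (f x) = x) ∧ ∀ x, f x ≠ x}

instance {s : ℕ} (d : Fin s → ℕ) : MeasurableSpace (Matching d) := ⊤

open Classical in
/-- The number of half-edges of `i` that are matched to a half-edge of `j`. -/
def matchCount {s : ℕ} {d : Fin s → ℕ} (f : Matching d) (i j : Fin s) : ℕ :=
  ∑ a : Fin (d i), if (f.1 ⟨i, a⟩).1 = j then 1 else 0

theorem matchCount_eq {s : ℕ} {d : Fin s → ℕ} (f : Matching d) (i j : Fin s) :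
    matchCount f i j = Nat.card {x : HalfEdge d // x.1 = i ∧ (f.1 x).1 = j} := by
  classical
  rw [matchCount, Finset.sum_boole, Nat.cast_id, Nat.card_eq_fintype_card, Fintype.card_subtype]
  refine Finset.card_bij (fun a _ => ⟨i, a⟩) ?_ ?_ ?_
  · intro a ha
    simpa using ha
  · intro a _ b _ h
    simpa using h
  · rintro ⟨i', a⟩ h
    simp only [Finset.mem_filter, Finset.mem_univ, true_and] at h
    obtain ⟨rfl, h⟩ := h
    exact ⟨a, by simpa using h, rfl⟩

theorem matchCount_comm {s : ℕ} {d : Fin s → ℕ} (f : Matching d) (i j : Fin s) :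
    matchCount f i j = matchCount f j i := by
  rw [matchCount_eq, matchCount_eq]
  refine Nat.card_congr ⟨fun x => ⟨f.1 x.1, x.2.2, ?_⟩, fun x => ⟨f.1 x.1, x.2.2, ?_⟩, ?_, ?_⟩
  · rw [f.2.1]; exact x.2.1
  · rw [f.2.1]; exact x.2.1
  · intro x; exact Subtype.ext (f.2.1 _)
  · intro x; exact Subtype.ext (f.2.1 _)

/-- The edge numbers of the configuration model: the number of half-edges of `i` matched to `j`
for `i ≠ j`, and half of this number for `i = j`. -/
def cmMatrix {s : ℕ} {d : Fin s → ℕ} (f : Matching d) : Sym2 (Fin s) → ℕ :=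
  Sym2.lift ⟨fun i j => if i = j then matchCount f i i / 2 else matchCount f i j, fun i j => by
    by_cases h : i = j
    · subst h; rfl
    · simp only [h, Ne.symm h, if_false]
      exact matchCount_comm f i j⟩

/-- The law of the configuration model with degrees `d_1, …, d_s`, built from a uniform
matching. -/
def cmLaw {s : ℕ} (d : Fin s → ℕ) : Measure (Multigraph Vertex) :=
  (uniformOn (Set.univ : Set (Matching d))).map fun f => ofMatrix (cmMatrix f)

/-! ## `(𝒟,k)`-graphs -/

/-- The connected multigraphs with vertices `V_1, …, V_s`, surplus `k` and degrees
`deg V_i = d_i + 1`. -/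
def dkGraphs {s : ℕ} (d : Fin s → ℤ) (k : ℕ) : Set (Multigraph Vertex) :=
  {G | G.verts = (Set.range fun i : Fin s => Vertex.V i) ∧ G.Connected ∧
    (∀ i : Fin s, (G.degree (Vertex.V i) : ℤ) = d i + 1) ∧ G.surplus = k}

/-- The law of a `(𝒟,k)`-graph. -/
def dkLaw {s : ℕ} (d : Fin s → ℤ) (k : ℕ) : Measure (Multigraph Vertex) :=
  uniformOn (dkGraphs d k)

/-! ## Multiplicative multigraphs -/

/-- Sequences `(λ, w_1, …, w_s)` of positive reals with `w_1 ≥ … ≥ w_s`. -/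
def OmegaMG {s : ℕ} (lam : ℝ) (w : Fin s → ℝ) : Prop := 0 < lam ∧ (∀ i, 0 < w i) ∧ Antitone w

/-- The mean of the number of edges `{V_i, V_j}`: `λ w_i w_j` for `i ≠ j`, `λ w_i² / 2` for
`i = j`. -/
def mgRate {s : ℕ} (lam : ℝ) (w : Fin s → ℝ) : Sym2 (Fin s) → ℝ≥0 :=
  Sym2.lift ⟨fun i j =>
    if i = j then (lam * w i ^ 2 / 2).toNNReal else (lam * (w i * w j)).toNNReal, fun i j => by
    by_cases h : i = j
    · subst h; rfl
    · simp only [h, Ne.symm h, if_false, mul_comm (w i)]⟩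

/-- The law of the multiplicative multigraph: independent Poisson edge numbers. -/
def mgLaw {s : ℕ} (lam : ℝ) (w : Fin s → ℝ) : Measure (Multigraph Vertex) :=
  (Measure.pi fun e : Sym2 (Fin s) => poissonMeasure (mgRate lam w e)).map fun m => ofMatrix m

/-! ## `𝐩`-trees and `(𝐩,k)`-graphs -/

/-- Sequences `p = (p_i)_{i ∈ ℕ ∪ {∞}}` of non-negative reals with `∑_i p_i + p_∞ = 1`,
`p_1 > 0` and `p_1 ≥ p_2 ≥ …`. (Numbered from `0`: `p i` belongs to the vertex `V i`.) -/
structure OmegaP where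
  p : ℕ → ℝ
  pInf : ℝ
  nonneg : ∀ i, 0 ≤ p i
  pInf_nonneg : 0 ≤ pInf
  hasSum : HasSum p (1 - pInf)
  pos : 0 < p 0
  antitone : Antitone p

/-- The law of one letter `A_n`: the letter is `i ∈ ℕ ∪ {∞}` with probability `p_i`. -/
def letterLaw (P : OmegaP) : Measure ℕ∞ :=
  Measure.sum (fun i : ℕ => ENNReal.ofReal (P.p i) • Measure.dirac (i : ℕ∞)) +
    ENNReal.ofReal P.pInf • Measure.dirac ⊤

instance (P : OmegaP) : IsProbabilityMeasure (letterLaw P) := by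
  constructor
  have h0 : (0 : ℝ) ≤ 1 - P.pInf := by
    rw [← P.hasSum.tsum_eq]
    exact tsum_nonneg fun i => P.nonneg i
  have h : ∑' i : ℕ, ENNReal.ofReal (P.p i) = ENNReal.ofReal (1 - P.pInf) := by
    rw [← P.hasSum.tsum_eq, ENNReal.ofReal_tsum_of_nonneg P.nonneg P.hasSum.summable]
  rw [letterLaw, Measure.add_apply, Measure.sum_apply _ MeasurableSet.univ]
  simp only [Measure.smul_apply, measure_univ, smul_eq_mul, mul_one]
  rw [h, ← ENNReal.ofReal_add h0 P.pInf_nonneg]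
  simp

/-- The law of the i.i.d. sequence of letters `A_1, A_2, …` (numbered from `0`). -/
def lettersLaw (P : OmegaP) : Measure (ℕ → ℕ∞) := Measure.infinitePi fun _ => letterLaw P

open Classical in
/-- `B_n`: the vertex `V_i` if the letter `A_n` is `i ∈ ℕ`, and the new vertex `V_{∞,n}` if it
is `∞`. -/
def abVertex (A : ℕ → ℕ∞) (n : ℕ) : Vertex :=
  if A n = ⊤ then Vertex.Vinf n else Vertex.V (A n).toNat

open Classical in
/-- The edges after each step of the Aldous–Broder construction. At first there is the edge
`{⋆_0, B_1}`; then, for every next letter `B`, with previous letter `B'`, the edge `{B', B}` is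
added if `B` is not in the tree yet, and otherwise `{B', ⋆_j}` is added, where `⋆_j` is the first
star that is not in the tree yet. -/
def abEdges (A : ℕ → ℕ∞) : ℕ → Set (Sym2 Vertex)
  | 0 => {s(Vertex.star 0, abVertex A 0)}
  | n + 1 => insert
      (if abVertex A (n + 1) ∉ (Multigraph.ofEdgeSet (abEdges A n)).verts then
        s(abVertex A n, abVertex A (n + 1))
      else
        s(abVertex A n,
          Vertex.star (sInf {j | Vertex.star j ∉ (Multigraph.ofEdgeSet (abEdges A n)).verts})))
      (abEdges A n)

/-- The tree built from the letters `A`; its law is that of the `𝐩`-tree if `A` has law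
`lettersLaw`. -/
def abTree (A : ℕ → ℕ∞) : Multigraph Vertex := Multigraph.ofEdgeSet (⋃ n, abEdges A n)

/-- The multigraph obtained from `T` by gluing `⋆_1` with `⋆_2`, …, `⋆_{2i-1}` with `⋆_{2i}`. -/
def glueStars (T : Multigraph Vertex) : ℕ → Multigraph Vertex
  | 0 => T
  | i + 1 => (glueStars T i).glue (Vertex.star (2 * i + 1)) (Vertex.star (2 * i + 2))

/-- The bias of a tree: `∘(G_k) / ∏_{i=1}^k □(G_i)`, where `G_i` is the tree with its first `i`
pairs of stars glued. -/
def treeBias (k : ℕ) (T : Multigraph Vertex) : ℝ≥0∞ :=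
  ((glueStars T k).circ : ℝ≥0∞) / ∏ i ∈ Finset.Icc 1 k, ((glueStars T i).square : ℝ≥0∞)

/-- The law of the letters biased by `treeBias`, before normalisation. -/
def biasedLetters (P : OmegaP) (k : ℕ) : Measure (ℕ → ℕ∞) :=
  (lettersLaw P).withDensity fun A => treeBias k (abTree A)

/-- The law of a `(𝐩,k)`-graph: the law of the multigraph obtained from the biased tree by gluing
the first `k` pairs of stars and then removing all the other stars. -/
def pkLaw (P : OmegaP) (k : ℕ) : Measure (Multigraph Vertex) :=
  ((biasedLetters P k Set.univ)⁻¹ • biasedLetters P k).map fun A =>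
    (glueStars (abTree A) k).removeVerts (Set.range Vertex.star)

/-- The sequence `(p_1, …, p_s, 0, 0, …)`, `p_∞ = 0`, with `p_i = w_i / ∑_j w_j`. -/
def normalizedWeights {s : ℕ} (hs : 0 < s) (w : Fin s → ℝ) (hw : ∀ i, 0 < w i)
    (hanti : Antitone w) : OmegaP where
  p i := if h : i < s then w ⟨i, h⟩ / ∑ j, w j else 0
  pInf := 0
  nonneg i := by
    split_ifs with h
    · exact div_nonneg (hw _).le (Finset.sum_nonneg fun j _ => (hw j).le)
    · exact le_rfl
  pInf_nonneg := le_rfl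
  hasSum := by
    have hpos : 0 < ∑ j, w j := Finset.sum_pos (fun j _ => hw j) ⟨⟨0, hs⟩, Finset.mem_univ _⟩
    have h1 : ∑ i ∈ Finset.range s, (if h : i < s then w ⟨i, h⟩ / ∑ j, w j else 0) = 1 - 0 := by
      rw [Finset.sum_range]
      simp only [Fin.is_lt, dite_true, Fin.eta]
      rw [← Finset.sum_div, div_self hpos.ne', sub_zero]
    rw [← h1]
    exact hasSum_sum_of_ne_finset_zero fun b hb => dif_neg (by simpa using hb)
  pos := by
    have hpos : 0 < ∑ j, w j := Finset.sum_pos (fun j _ => hw j) ⟨⟨0, hs⟩, Finset.mem_univ _⟩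
    rw [dif_pos hs]
    exact div_pos (hw _) hpos
  antitone := by
    have hpos : 0 < ∑ j, w j := Finset.sum_pos (fun j _ => hw j) ⟨⟨0, hs⟩, Finset.mem_univ _⟩
    intro i j hij
    change (if h : j < s then w ⟨j, h⟩ / ∑ j, w j else 0) ≤
      (if h : i < s then w ⟨i, h⟩ / ∑ j, w j else 0)
    by_cases hj : j < s
    · have hi : i < s := lt_of_le_of_lt hij hj
      rw [dif_pos hj, dif_pos hi]
      exact div_le_div_of_nonneg_right (hanti (by simpa using hij)) hpos.le
    · rw [dif_neg hj]
      split_ifs with hi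
      · exact div_nonneg (hw _).le hpos.le
      · exact le_rfl

end ConnMultigraph

end

/-! A multigraph on `V_1, …, V_s` is a matrix `m` of edge numbers. In both models `∘(m)` is the
symmetry factor whose removal leaves a weight that depends on `m` only through its degrees and its
number of edges.

(a) A matrix `m` with degrees `d` arises from exactly `∏ d_i! / ∘(m)` matchings
(`card_matchings_mul_circM`, a special case of `card_involutions_mul_circM`, proved by removing one
matched pair at a time). After the bias all these matrices have equal weight, so conditioning on
connectedness gives the uniform law. At least one connected matrix exists by
`exists_connM_of_degrees`.

(b) The factorials in `∘` cancel those of the Poisson weights, and its powers of two cancel the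
halves in the loop rates. What remains is a constant times `λ^|E| ∏ w_v^(deg v)`. The surplus fixes
`|E|`, so the conditioned law is proportional to `∏ p_v^(deg v)`. The `(𝐩,k)`-graph has this law
too, by two facts.

Law of the tree (`measure_builds`): the letters build the tree with root `r` and parent function
`π`, with fathers `q` of the stars `1, …, 2k`, with probability `∏_{v ≠ r} p_{π v} · ∏ p_{q i}`. By
`degWeight_glued` this is `(∏ p_v)⁻¹ p_r ∏ p_v^(deg v)`, with the degrees of the glued multigraph.
The probability comes from a recursion on the first letter, solved in `sum_followProb`.

Cutting (`circM_mul_cutWeight`): for fixed `m` and `r`, the sum of `∏ 1/□` over all ways to reach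
`m` from a rooted tree by adding `k` ordered edges is `2^k / ∘(m)`. Undoing the last edge changes
`∘` by the multiplicity of that edge, doubled for a loop. Over ordered pairs of ends these factors
add up to `2 □(m)`, which the bias divides out.

Hence root `r` contributes `p_r` times an expression that does not depend on `r`, and `∑ p_r = 1`
finishes the computation. -/

noncomputable section

namespace ConnMultigraph

/-! ## Edge-number matrices -/

section Matrices

variable {s : ℕ}

/-- `∘` of a matrix of edge numbers. -/
def circM (m : Sym2 (Fin s) → ℕ) : ℕ := (∏ v, 2 ^ m s(v, v)) * ∏ e, (m e)!

/-- The degrees of a matrix of edge numbers. -/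
def degM (m : Sym2 (Fin s) → ℕ) (v : Fin s) : ℕ := (∑ w, m s(v, w)) + m s(v, v)

/-- Connectedness of a matrix of edge numbers. -/
def ConnM (m : Sym2 (Fin s) → ℕ) : Prop :=
  ∀ u v, Relation.ReflTransGen (fun a b => 0 < m s(a, b)) u v

open Classical in
/-- `□` of a matrix of edge numbers. -/
def squareM (m : Sym2 (Fin s) → ℕ) : ℕ :=
  ∑ e, if ConnM (m - Pi.single e 1) then m e else 0

theorem ConnM.mono {m m' : Sym2 (Fin s) → ℕ} (h : ConnM m) (hle : ∀ e, m e ≤ m' e) :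
    ConnM m' := fun u v =>
  Relation.ReflTransGen.mono (r := fun a b => 0 < m s(a, b))
    (fun _ _ hab => lt_of_lt_of_le hab (hle _)) _ _ (h u v)

end Matrices

/-! ### Vertices, and multigraphs on `V_1, …, V_s` as matrices -/

namespace Vertex

theorem V_injective : Function.Injective Vertex.V := fun _ _ h => by injection h

theorem V_fin_injective {s : ℕ} : Function.Injective fun i : Fin s => Vertex.V i :=
  fun _ _ h => Fin.ext (V_injective h)

instance : Countable Vertex := by
  let f : Vertex → ℕ × ℕ := fun v => match v with
    | V i => (0, i)
    | Vinf i => (1, i)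
    | star i => (2, i)
  refine Function.Injective.countable (f := f) ?_
  rintro (a | a | a) (b | b | b) h <;> simp_all [f]

end Vertex

instance : Countable (Sym2 Vertex) := by unfold Sym2; infer_instance

/-- `Vertex` is countable, so a multigraph is given by countably many discrete coordinates. -/
instance : MeasurableSingletonClass (Multigraph Vertex) where
  measurableSet_singleton G := by
    refine ⟨{(G.verts, G.mult)}, measurableSet_singleton _, ?_⟩
    ext H
    simp only [mem_preimage, mem_singleton_iff, Prod.mk.injEq]
    exact ⟨fun h => Multigraph.ext h.1 h.2, fun h => by simp [h]⟩

/-- The edge of vertices `V_i` given by an unordered pair of indices. -/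
def vEdge {s : ℕ} (e : Sym2 (Fin s)) : Sym2 Vertex := e.map fun i : Fin s => Vertex.V i

@[simp] theorem vEdge_mk {s : ℕ} (i j : Fin s) :
    vEdge s(i, j) = s(Vertex.V i, Vertex.V j) := rfl

theorem vEdge_injective {s : ℕ} : Function.Injective (vEdge (s := s)) :=
  Sym2.map.injective Vertex.V_fin_injective

@[simp] theorem vEdge_inj {s : ℕ} {e e' : Sym2 (Fin s)} : vEdge e = vEdge e' ↔ e = e' :=
  vEdge_injective.eq_iff

@[simp] theorem star_notMem_vEdge {s : ℕ} (e : Sym2 (Fin s)) (j : ℕ) :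
    Vertex.star j ∉ vEdge e := by
  induction e with | _ a b => simp

theorem mem_range_V_of_mem_vEdge {s : ℕ} {e : Sym2 (Fin s)} {v : Vertex} (h : v ∈ vEdge e) :
    v ∈ Set.range fun i : Fin s => Vertex.V i := by
  induction e with
  | _ a b =>
    rcases Sym2.mem_iff.1 h with rfl | rfl
    exacts [⟨a, rfl⟩, ⟨b, rfl⟩]

@[simp] theorem ofMatrix_mult_vEdge {s : ℕ} (m : Sym2 (Fin s) → ℕ) (e : Sym2 (Fin s)) :
    (ofMatrix m).mult (vEdge e) = m e := by
  classical
  change (∑ e' : Sym2 (Fin s), if vEdge e' = vEdge e then m e' else 0) = m e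
  simp

theorem ofMatrix_mult_of_notMem {s : ℕ} (m : Sym2 (Fin s) → ℕ) (e : Sym2 Vertex)
    (h : ∀ e' : Sym2 (Fin s), vEdge e' ≠ e) : (ofMatrix m).mult e = 0 := by
  classical
  change (∑ e' : Sym2 (Fin s), if vEdge e' = e then m e' else 0) = 0
  simp [h]

theorem ofMatrix_injective {s : ℕ} : Function.Injective (ofMatrix (s := s)) := by
  intro m m' h
  ext e
  rw [← ofMatrix_mult_vEdge m, h, ofMatrix_mult_vEdge]

theorem exists_ofMatrix_eq {s : ℕ} (G : Multigraph Vertex)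
    (h : G.verts = Set.range fun i : Fin s => Vertex.V i) :
    ∃ m : Sym2 (Fin s) → ℕ, ofMatrix m = G := by
  refine ⟨fun e => G.mult (vEdge e), Multigraph.ext h.symm ?_⟩
  ext e
  by_cases he : ∃ e' : Sym2 (Fin s), vEdge e' = e
  · obtain ⟨e', rfl⟩ := he
    simp
  · push Not at he
    rw [ofMatrix_mult_of_notMem _ _ he]
    by_contra hne
    have hv := G.mem_verts e (Ne.symm hne)
    induction e with
    | _ a b =>
      obtain ⟨i, hi⟩ := h ▸ hv a (by simp)
      obtain ⟨j, hj⟩ := h ▸ hv b (by simp)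
      exact he s(i, j) (by simp [← hi, ← hj])

/-! ## Multigraphs with star leaves -/

section Starred

variable {s : ℕ}

open Classical in
/-- The multigraph with edge numbers `m` on `V_1, …, V_s`, with, for each `j ∈ J`, an additional
leaf `⋆_j` whose neighbour is `V_{F j}`. -/
def starred (m : Sym2 (Fin s) → ℕ) (F : ℕ → Fin s) (J : Set ℕ) : Multigraph Vertex where
  verts := (Set.range fun i : Fin s => Vertex.V i) ∪ Vertex.star '' J
  mult e := (ofMatrix m).mult e + if ∃ j ∈ J, e = s(Vertex.V (F j), Vertex.star j) then 1 else 0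
  mem_verts e h v hv := by
    by_cases h1 : ∃ j ∈ J, e = s(Vertex.V (F j), Vertex.star j)
    · obtain ⟨j, hj, rfl⟩ := h1
      rcases Sym2.mem_iff.1 hv with rfl | rfl
      · exact Or.inl ⟨F j, rfl⟩
      · exact Or.inr ⟨j, hj, rfl⟩
    · rw [if_neg h1] at h
      exact Or.inl ((ofMatrix m).mem_verts e h v hv)

variable (m : Sym2 (Fin s) → ℕ) (F : ℕ → Fin s) (J : Set ℕ)

theorem starred_empty : starred m F ∅ = ofMatrix m := by
  ext <;> simp [starred, ofMatrix]

@[simp] theorem starred_mult_vEdge (e : Sym2 (Fin s)) : (starred m F J).mult (vEdge e) = m e := by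
  have : ¬ ∃ j ∈ J, vEdge e = s(Vertex.V (F j), Vertex.star j) := by
    rintro ⟨j, -, hj⟩
    exact star_notMem_vEdge e j (hj ▸ by simp)
  simp [starred, this]

@[simp] theorem starred_mult_V_V (i j : Fin s) :
    (starred m F J).mult s(Vertex.V i, Vertex.V j) = m s(i, j) := by
  rw [← vEdge_mk, starred_mult_vEdge]

theorem starred_mult_star {j : ℕ} (hj : j ∈ J) :
    (starred m F J).mult s(Vertex.V (F j), Vertex.star j) = 1 := by
  have : (ofMatrix m).mult s(Vertex.V (F j), Vertex.star j) = 0 :=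
    ofMatrix_mult_of_notMem _ _ fun e' h => star_notMem_vEdge e' j (h ▸ by simp)
  have h2 : ∃ j' ∈ J, s(Vertex.V (F j), Vertex.star j) = s(Vertex.V (F j'), Vertex.star j') :=
    ⟨j, hj, rfl⟩
  simp only [starred, this, if_pos h2, zero_add]

theorem starred_mult_cases (e : Sym2 Vertex) :
    (∃ e' : Sym2 (Fin s), e = vEdge e') ∨ (∃ j ∈ J, e = s(Vertex.V (F j), Vertex.star j)) ∨
      (starred m F J).mult e = 0 := by
  by_cases h1 : ∃ e' : Sym2 (Fin s), e = vEdge e'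
  · exact Or.inl h1
  by_cases h2 : ∃ j ∈ J, e = s(Vertex.V (F j), Vertex.star j)
  · exact Or.inr (Or.inl h2)
  refine Or.inr (Or.inr ?_)
  simp only [starred, if_neg h2, add_zero]
  exact ofMatrix_mult_of_notMem _ _ fun e' h => h1 ⟨e', h.symm⟩

theorem starred_mult_pos_star_iff {x : Vertex} {j : ℕ} :
    0 < (starred m F J).mult s(x, Vertex.star j) ↔ j ∈ J ∧ x = Vertex.V (F j) := by
  constructor
  · intro h
    rcases starred_mult_cases m F J s(x, Vertex.star j) with ⟨e', he'⟩ | ⟨j', hj', he'⟩ | h0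
    · exact absurd (he' ▸ (by simp : Vertex.star j ∈ s(x, Vertex.star j)))
        (star_notMem_vEdge e' j)
    · rw [Sym2.eq_iff] at he'
      rcases he' with ⟨rfl, h2⟩ | ⟨-, h2⟩
      · injection h2 with h2
        subst h2
        exact ⟨hj', rfl⟩
      · cases h2
    · omega
  · rintro ⟨hj, rfl⟩
    rw [starred_mult_star m F J hj]
    exact one_pos

theorem starred_circ : (starred m F J).circ = circM m := by
  classical
  unfold Multigraph.circ circM
  congr 1
  · rw [finprod_eq_prod_of_mulSupport_subset (s := Finset.univ.image fun i : Fin s => Vertex.V i),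
      Finset.prod_image (fun i _ j _ h => Vertex.V_fin_injective h)]
    · simp
    · intro v hv
      rw [Function.mem_mulSupport] at hv
      have h0 : (starred m F J).mult s(v, v) ≠ 0 := fun h => hv (by simp [h])
      rcases starred_mult_cases m F J s(v, v) with ⟨e', he'⟩ | ⟨j, hj, he'⟩ | h
      · have : v ∈ vEdge e' := he' ▸ (by simp : v ∈ s(v, v))
        simpa using mem_range_V_of_mem_vEdge this
      · rw [Sym2.eq_iff] at he'
        rcases he' with ⟨rfl, h⟩ | ⟨rfl, h⟩ <;> cases h
      · exact absurd h h0
  · rw [finprod_eq_prod_of_mulSupport_subset (s := Finset.univ.image (vEdge (s := s))),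
      Finset.prod_image (fun i _ j _ h => vEdge_injective h)]
    · simp
    · intro e he
      rw [Function.mem_mulSupport] at he
      rcases starred_mult_cases m F J e with ⟨e', rfl⟩ | ⟨j, hj, rfl⟩ | h
      · simp
      · exact absurd (by rw [starred_mult_star m F J hj]; rfl) he
      · exact absurd (by rw [h]; rfl) he

theorem starred_deleteEdge_vEdge (e : Sym2 (Fin s)) :
    (starred m F J).deleteEdge (vEdge e) = starred (m - Pi.single e 1) F J := by
  classical
  refine Multigraph.ext rfl ?_
  ext x
  simp only [Multigraph.deleteEdge]
  rcases starred_mult_cases m F J x with ⟨e', rfl⟩ | ⟨j, hj, rfl⟩ | h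
  · simp [Pi.single_apply]
  · rw [starred_mult_star m F J hj, starred_mult_star _ F J hj, if_neg]
    intro h
    exact star_notMem_vEdge e j (h ▸ by simp)
  · rw [h, zero_tsub]
    symm
    simp only [starred, Nat.add_eq_zero_iff] at h ⊢
    refine ⟨?_, h.2⟩
    by_cases hx : ∃ e' : Sym2 (Fin s), vEdge e' = x
    · obtain ⟨e', rfl⟩ := hx
      simp [(by simpa using h.1 : m e' = 0)]
    · push Not at hx
      exact ofMatrix_mult_of_notMem _ _ hx

/-- Stars are leaves: collapsing each onto its father keeps walks walks, and conversely every star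
is one edge away from some `V i`. -/
theorem starred_connected_iff (hs : 0 < s) : (starred m F J).Connected ↔ ConnM m := by
  set R : Vertex → Vertex → Prop := fun a b => 0 < (starred m F J).mult s(a, b)
  have hR : ∀ a b, R a b → R b a := fun a b h => by simpa only [R, Sym2.eq_swap] using h
  have hRs : ∀ a b, Relation.ReflTransGen R a b → Relation.ReflTransGen R b a :=
    (@Relation.ReflTransGen.stdSymm _ _ ⟨hR⟩).symm
  constructor
  · rintro ⟨-, h⟩ u v
    -- The values of `g` at `Vinf` and at `V i` with `i ≥ s` are arbitrary, since no edge meets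
    -- these vertices.
    let g : Vertex → Fin s := fun x => match x with
      | .V i => if h : i < s then ⟨i, h⟩ else u
      | .Vinf i => u
      | .star j => F j
    have key : ∀ a b, Relation.ReflTransGen R a b →
        Relation.ReflTransGen (fun a b => 0 < m s(a, b)) (g a) (g b) := by
      intro a b hab
      refine hab.lift' g ?_
      intro a b hab
      change 0 < (starred m F J).mult s(a, b) at hab
      rcases starred_mult_cases m F J s(a, b) with ⟨e', he'⟩ | ⟨j, hj, he'⟩ | h
      · rw [he', starred_mult_vEdge] at hab
        induction e' with
        | _ x y =>
          rw [vEdge_mk, Sym2.eq_iff] at he'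
          rcases he' with ⟨rfl, rfl⟩ | ⟨rfl, rfl⟩
          · exact .single (by simpa [g, Function.onFun] using hab)
          · exact .single (by simpa [g, Function.onFun, Sym2.eq_swap] using hab)
      · rw [Sym2.eq_iff] at he'
        have hg : g (.V (F j)) = F j := by simp [g]
        rcases he' with ⟨rfl, rfl⟩ | ⟨rfl, rfl⟩
        · change Relation.ReflTransGen _ (g (.V (F j))) (F j)
          rw [hg]
        · change Relation.ReflTransGen _ (F j) (g (.V (F j)))
          rw [hg]
      · omega
    simpa [g] using key _ _ (h (.V u) (Or.inl ⟨u, rfl⟩) (.V v) (Or.inl ⟨v, rfl⟩))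
  · intro h
    refine ⟨⟨.V 0, Or.inl ⟨⟨0, hs⟩, rfl⟩⟩, ?_⟩
    have hV : ∀ i j : Fin s, Relation.ReflTransGen R (.V i) (.V j) := fun i j =>
      (h i j).lift (fun i : Fin s => Vertex.V i) fun a b hab => by simpa [R, Function.onFun] using hab
    have hto : ∀ u ∈ (starred m F J).verts, ∃ i : Fin s, Relation.ReflTransGen R u (.V i) := by
      rintro u (⟨i, rfl⟩ | ⟨j, hj, rfl⟩)
      · exact ⟨i, .refl⟩
      · exact ⟨F j, (.single (hR _ _ ((starred_mult_pos_star_iff m F J).2 ⟨hj, rfl⟩)))⟩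
    intro u hu v hv
    obtain ⟨i, hi⟩ := hto u hu
    obtain ⟨j, hj⟩ := hto v hv
    exact (hi.trans (hV i j)).trans (hRs _ _ hj)

/-- The edge of a star is a bridge, since its deletion isolates the star. So only the edges of `m`
can count, and for these the stars do not affect connectedness. -/
theorem starred_square (hs : 0 < s) : (starred m F J).square = squareM m := by
  classical
  unfold Multigraph.square squareM
  rw [finsum_eq_sum_of_support_subset (s := Finset.univ.image (vEdge (s := s))),
    Finset.sum_image (fun i _ j _ h => vEdge_injective h)]
  · simp only [starred_deleteEdge_vEdge, starred_connected_iff _ F J hs, starred_mult_vEdge]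
  · intro e he
    rw [Function.mem_support] at he
    rcases starred_mult_cases m F J e with ⟨e', rfl⟩ | ⟨j, hj, rfl⟩ | h
    · simp
    · refine absurd (if_neg ?_) he
      rintro ⟨-, hc⟩
      have hc := hc (.star j) (Or.inr ⟨j, hj, rfl⟩) (.V 0) (Or.inl ⟨⟨0, hs⟩, rfl⟩)
      rcases Relation.ReflTransGen.cases_head hc with h | ⟨b, hb, -⟩
      · cases h
      · simp only [Multigraph.deleteEdge] at hb
        rw [Sym2.eq_swap] at hb
        have hb' : 0 < (starred m F J).mult s(b, Vertex.star j) := by omega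
        obtain ⟨-, rfl⟩ := (starred_mult_pos_star_iff m F J).1 hb'
        rw [starred_mult_star m F J hj] at hb
        simp at hb
    · exact absurd (by simp [h]) he

theorem starred_father {j : ℕ} (hj : j ∈ J) :
    (starred m F J).father (.star j) = .V (F j) := by
  have h : ∃! x, 0 < (starred m F J).mult s(x, Vertex.star j) :=
    ⟨.V (F j), (starred_mult_pos_star_iff m F J).2 ⟨hj, rfl⟩,
      fun y hy => ((starred_mult_pos_star_iff m F J).1 hy).2⟩
  rw [Multigraph.father, dif_pos h]
  exact ((starred_mult_pos_star_iff m F J).1 h.choose_spec.1).2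

theorem starred_glue {i j : ℕ} (hi : i ∈ J) (hj : j ∈ J) :
    (starred m F J).glue (.star i) (.star j) =
      starred (m + Pi.single s(F i, F j) 1) F (J \ {i, j}) := by
  classical
  refine Multigraph.ext ?_ ?_
  · ext v
    simp only [Multigraph.glue, starred]
    cases v <;> simp
  · ext e
    simp only [Multigraph.glue, starred_father m F J hi, starred_father m F J hj]
    rw [← vEdge_mk]
    rcases starred_mult_cases m F J e with ⟨e', rfl⟩ | ⟨l, hl, rfl⟩ | h
    · simp [Pi.single_apply, -vEdge_mk]
    · by_cases hl2 : l = i ∨ l = j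
      · rw [if_pos (by rcases hl2 with rfl | rfl <;> simp)]
        by_contra hne
        have := (starred_mult_pos_star_iff _ _ _).1 (Nat.pos_of_ne_zero (Ne.symm hne))
        simp only [mem_sdiff, mem_insert_iff, mem_singleton_iff] at this
        tauto
      · have hm : l ∈ J \ {i, j} := ⟨hl, by simpa using hl2⟩
        push Not at hl2
        rw [starred_mult_star m F J hl, starred_mult_star _ F _ hm, if_neg, if_neg]
        · intro h
          exact star_notMem_vEdge s(F i, F j) l (h ▸ by simp)
        · simpa [eq_comm] using hl2
    · rw [h]
      rcases starred_mult_cases (m + Pi.single s(F i, F j) 1) F (J \ {i, j}) e with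
        ⟨e', rfl⟩ | ⟨l, hl, rfl⟩ | h'
      · rw [starred_mult_vEdge] at h
        simp [h, Pi.single_apply, -vEdge_mk]
      · rw [starred_mult_star m F J hl.1] at h
        omega
      · rw [h', zero_add]
        split_ifs with h1 h2 <;> try rfl
        subst h2
        rw [starred_mult_vEdge] at h'
        simp at h'

theorem starred_removeVerts :
    (starred m F J).removeVerts (Set.range Vertex.star) = ofMatrix m := by
  classical
  refine Multigraph.ext ?_ ?_
  · ext v
    simp only [Multigraph.removeVerts, starred, ofMatrix]
    cases v <;> simp
  · ext e
    simp only [Multigraph.removeVerts]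
    rcases starred_mult_cases m F J e with ⟨e', rfl⟩ | ⟨l, hl, rfl⟩ | h
    · simp
    · rw [if_pos ⟨.star l, by simp⟩, ofMatrix_mult_of_notMem]
      exact fun e' h => star_notMem_vEdge e' l (h ▸ by simp)
    · simp only [h, ite_self]
      symm
      simp only [starred, Nat.add_eq_zero_iff] at h
      exact h.1

/-- The edge numbers `m` with the edges `s(F 1, F 2), …, s(F (2 i - 1), F (2 i))` added. -/
def glued (m : Sym2 (Fin s) → ℕ) (F : ℕ → Fin s) (i : ℕ) : Sym2 (Fin s) → ℕ :=
  m + ∑ j ∈ Finset.range i, Pi.single s(F (2 * j + 1), F (2 * j + 2)) 1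

/-- Gluing starts with stars 1 and 2, so star 0 is never used and stays next to the stars of index
above `2 * i`. -/
theorem glueStars_starred (i : ℕ) :
    glueStars (starred m F Set.univ) i = starred (glued m F i) F {j | j = 0 ∨ 2 * i < j} := by
  induction i with
  | zero =>
    simp only [glueStars, glued, Finset.range_zero, Finset.sum_empty, add_zero]
    congr 1
    ext j
    simp
    omega
  | succ i ih =>
    rw [glueStars, ih, starred_glue _ _ _ (by simp) (by simp)]
    congr 1
    · rw [glued, glued, Finset.sum_range_succ, add_assoc]
    · ext j
      simp
      omega

theorem treeBias_starred (hs : 0 < s) (k : ℕ) :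
    treeBias k (starred m F Set.univ) =
      (circM (glued m F k) : ℝ≥0∞) / ∏ i ∈ Finset.Icc 1 k, (squareM (glued m F i) : ℝ≥0∞) := by
  simp only [treeBias, glueStars_starred, starred_circ, starred_square _ _ _ hs]

theorem removeVerts_glueStars_starred (k : ℕ) :
    (glueStars (starred m F Set.univ) k).removeVerts (Set.range Vertex.star) =
      ofMatrix (glued m F k) := by
  rw [glueStars_starred, starred_removeVerts]

end Starred

/-! ### Invariants of multigraphs without stars -/

section OfMatrix

variable {s : ℕ} (m : Sym2 (Fin s) → ℕ)

theorem ofMatrix_circ (hs : 0 < s) : (ofMatrix m).circ = circM m := by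
  rw [← starred_empty m fun _ => ⟨0, hs⟩, starred_circ]

theorem ofMatrix_connected_iff (hs : 0 < s) : (ofMatrix m).Connected ↔ ConnM m := by
  rw [← starred_empty m fun _ => ⟨0, hs⟩, starred_connected_iff _ _ _ hs]

theorem ofMatrix_edgeCount : (ofMatrix m).edgeCount = ∑ e, m e := by
  classical
  unfold Multigraph.edgeCount
  rw [finsum_eq_sum_of_support_subset (s := Finset.univ.image (vEdge (s := s))),
    Finset.sum_image (fun i _ j _ h => vEdge_injective h)]
  · simp
  · intro e he
    by_contra h
    exact he (ofMatrix_mult_of_notMem _ _ fun e' h' => h (by simpa using ⟨e', h'⟩))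

theorem ofMatrix_degree (i : Fin s) : (ofMatrix m).degree (.V i) = degM m i := by
  classical
  unfold Multigraph.degree degM
  congr 1
  · rw [finsum_eq_sum_of_support_subset (s := Finset.univ.image fun i : Fin s => Vertex.V i),
      Finset.sum_image (fun i _ j _ h => Vertex.V_fin_injective h)]
    · simp only [← vEdge_mk, ofMatrix_mult_vEdge]
    · intro v hv
      have := (ofMatrix m).mem_verts _ hv v (by simp)
      simpa [ofMatrix] using this
  · rw [← vEdge_mk, ofMatrix_mult_vEdge]

theorem ofMatrix_surplus : (ofMatrix m).surplus = ((∑ e, m e : ℕ) : ℤ) - s + 1 := by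
  have : (ofMatrix m).verts.ncard = s := by
    change (Set.range fun i : Fin s => Vertex.V i).ncard = s
    rw [← Set.image_univ, Set.ncard_image_of_injective _ Vertex.V_fin_injective]
    simp
  rw [Multigraph.surplus, ofMatrix_edgeCount, this]

end OfMatrix

/-! ## Rooted trees as parent functions -/

section Rooted

variable {s : ℕ}

/-- `π` is the parent function of a tree with root `r`. -/
def IsRooted (r : Fin s) (π : Fin s → Fin s) : Prop :=
  π r = r ∧ ∃ depth : Fin s → ℕ, ∀ v, v ≠ r → depth (π v) < depth v

/-- The edge numbers of the tree with root `r` and parent function `π`. -/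
def treeM (r : Fin s) (π : Fin s → Fin s) : Sym2 (Fin s) → ℕ :=
  ∑ v ∈ Finset.univ.erase r, Pi.single s(v, π v) 1

variable {r : Fin s} {π : Fin s → Fin s}

theorem treeM_apply (e : Sym2 (Fin s)) :
    treeM r π e = {v ∈ Finset.univ.erase r | e = s(v, π v)}.card := by
  simp [treeM, Finset.sum_apply, Pi.single_apply]

theorem treeM_pos_iff {e : Sym2 (Fin s)} : 0 < treeM r π e ↔ ∃ v, v ≠ r ∧ e = s(v, π v) := by
  rw [treeM_apply, Finset.card_pos]
  simp [Finset.Nonempty]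

/-- Otherwise `u` and `v` would be parents of each other, and each would be less deep than the
other. -/
theorem IsRooted.edge_inj (h : IsRooted r π) {u v : Fin s} (hu : u ≠ r) (hv : v ≠ r)
    (huv : s(u, π u) = s(v, π v)) : u = v := by
  obtain ⟨-, d, hd⟩ := h
  rw [Sym2.eq_iff] at huv
  rcases huv with ⟨h, -⟩ | ⟨h1, h2⟩
  · exact h
  · have hu := hd u hu
    have hv := hd v hv
    rw [h2] at hu
    rw [← h1] at hv
    omega

theorem IsRooted.treeM_le_one (h : IsRooted r π) (e : Sym2 (Fin s)) : treeM r π e ≤ 1 := by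
  rw [treeM_apply, Finset.card_le_one]
  intro u hu v hv
  simp only [Finset.mem_filter, Finset.mem_erase, Finset.mem_univ, and_true] at hu hv
  exact h.edge_inj hu.1 hv.1 (hu.2.symm.trans hv.2)

theorem sum_treeM (r : Fin s) (π : Fin s → Fin s) : ∑ e, treeM r π e + 1 = s := by
  simp only [treeM, Finset.sum_apply]
  rw [Finset.sum_comm]
  have hs : 0 < s := r.pos
  simp
  omega

theorem ConnM.of_forall_root {m : Sym2 (Fin s) → ℕ} (r : Fin s)
    (h : ∀ v, Relation.ReflTransGen (fun a b => 0 < m s(a, b)) v r) : ConnM m := fun u v =>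
  (h u).trans ((@Relation.ReflTransGen.stdSymm _ (fun a b => 0 < m s(a, b))
    ⟨fun a b hab => by simpa only [Sym2.eq_swap] using hab⟩).symm _ _ (h v))

theorem IsRooted.connM (h : IsRooted r π) : ConnM (treeM r π) := by
  obtain ⟨-, d, hd⟩ := h
  refine ConnM.of_forall_root r fun v => ?_
  induction hn : d v using Nat.strong_induction_on generalizing v with
  | _ n ih =>
    by_cases hv : v = r
    · rw [hv]
    · exact .head (treeM_pos_iff.2 ⟨v, hv, rfl⟩) (ih _ (hn ▸ hd v hv) _ rfl)

/-- Breadth-first search: a vertex other than `r` is adjacent to one strictly closer to `r`, which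
is taken as its parent. -/
theorem ConnM.exists_rooted_le {m : Sym2 (Fin s) → ℕ} (h : ConnM m) (r : Fin s) :
    ∃ π, IsRooted r π ∧ ∀ e, treeM r π e ≤ m e := by
  classical
  -- `R n v` says that a walk of length `n` leads from `r` to `v`; the depth `d v` is the least such
  -- `n`.
  let R : ℕ → Fin s → Prop := fun n =>
    Nat.rec (fun v => v = r) (fun _ P v => ∃ u, P u ∧ 0 < m s(u, v)) n
  have hR : ∀ v, ∃ n, R n v := by
    intro v
    induction h r v with
    | refl => exact ⟨0, rfl⟩
    | tail _ hbc ih =>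
      obtain ⟨n, hn⟩ := ih
      exact ⟨n + 1, _, hn, hbc⟩
  let d : Fin s → ℕ := fun v => @Nat.find (fun n => R n v) (Classical.decPred _) (hR v)
  have hpar : ∀ v, v ≠ r → ∃ u, d u < d v ∧ 0 < m s(v, u) := by
    intro v hv
    have hv' : R (d v) v := @Nat.find_spec (fun n => R n v) (Classical.decPred _) (hR v)
    rcases hn : d v with _ | n
    · rw [hn] at hv'
      exact absurd hv' hv
    · rw [hn] at hv'
      obtain ⟨u, hu, hm⟩ := hv'
      exact ⟨u, Nat.lt_succ_of_le
        (@Nat.find_min' (fun n => R n u) (Classical.decPred _) (hR u) n hu), by rwa [Sym2.eq_swap]⟩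
  choose! f hf using hpar
  let π : Fin s → Fin s := fun v => if v = r then r else f v
  have hπ : IsRooted r π := ⟨by simp [π], d, fun v hv => by simpa [π, hv] using (hf v hv).1⟩
  refine ⟨π, hπ, fun e => ?_⟩
  rcases Nat.eq_zero_or_pos (treeM r π e) with h0 | hpos
  · omega
  · obtain ⟨v, hv, rfl⟩ := treeM_pos_iff.1 hpos
    have h1 := hπ.treeM_le_one s(v, π v)
    have h2 : 0 < m s(v, π v) := by simpa [π, hv] using (hf v hv).2
    omega

/-- Induction on the depth. The edge from `v` to `π v` is a parent edge for `π'` as well. If it were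
that of `π v`, then `π' (π v) = v`, while the induction hypothesis gives `π' (π v) = π (π v)`, which
is less deep than `v`. -/
theorem IsRooted.eq_of_treeM_eq {π' : Fin s → Fin s} (h : IsRooted r π) (h' : IsRooted r π')
    (heq : treeM r π = treeM r π') : π = π' := by
  have h1 := h.1
  have h1' := h'.1
  obtain ⟨-, d, hd⟩ := h
  funext v
  induction hn : d v using Nat.strong_induction_on generalizing v with
  | _ n ih =>
    by_cases hv : v = r
    · rw [hv, h1, h1']
    · obtain ⟨u, hu, huv⟩ := treeM_pos_iff.1 (heq ▸ treeM_pos_iff.2 ⟨v, hv, rfl⟩)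
      rw [Sym2.eq_iff] at huv
      rcases huv with ⟨rfl, h⟩ | ⟨h2, h3⟩
      · exact h
      · have hlt := hd v hv
        have hu' := ih _ (hn ▸ hlt) (π v) rfl
        have := hd (π v) (by rwa [h3])
        rw [hu', h3, ← h2] at this
        rw [h3] at hlt
        omega

/-- A connected multigraph with `s` vertices and `s - 1` edges is a tree, and it has exactly one
parent function for each choice of the root. -/
theorem existsUnique_rooted {m : Sym2 (Fin s) → ℕ} (h : ConnM m) (hm : ∑ e, m e + 1 = s)
    (r : Fin s) : ∃! π, IsRooted r π ∧ treeM r π = m := by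
  obtain ⟨π, hπ, hle⟩ := h.exists_rooted_le r
  have heq : treeM r π = m := by
    have hsum := sum_treeM r π
    have := (Finset.sum_eq_sum_iff_of_le (s := Finset.univ) fun e _ => hle e).1 (by omega)
    exact funext fun e => this e (Finset.mem_univ e)
  exact ⟨π, ⟨hπ, heq⟩, fun π' h' => h'.1.eq_of_treeM_eq hπ (h'.2.trans heq.symm)⟩

/-- A spanning tree uses only `s - 1` edges, so some edge has a spare copy that can be removed. This
is what allows division by `□`. -/
theorem squareM_pos {m : Sym2 (Fin s) → ℕ} (hs : 0 < s) (h : ConnM m) (hm : s ≤ ∑ e, m e) :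
    0 < squareM m := by
  obtain ⟨π, hπ, hle⟩ := h.exists_rooted_le ⟨0, hs⟩
  have hsum := sum_treeM ⟨0, hs⟩ π
  obtain ⟨e, -, he⟩ := Finset.exists_lt_of_sum_lt (s := Finset.univ)
    (show ∑ e, treeM ⟨0, hs⟩ π e < ∑ e, m e by omega)
  refine Finset.sum_pos' (fun _ _ => Nat.zero_le _) ⟨e, Finset.mem_univ e, ?_⟩
  rw [if_pos]
  · omega
  · refine hπ.connM.mono fun e' => ?_
    by_cases h : e' = e
    · subst h
      simp
      omega
    · simpa [h] using hle e'

end Rooted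

/-! ## Removing edges one by one -/

section Cycles

variable {s : ℕ}

/-- An edge with distinct ends comes from two ordered pairs, a loop from one; the diagonal sum
supplies the missing copy. -/
theorem sum_mk_add_sum_diag {M : Type*} [AddCommMonoid M] (f : Sym2 (Fin s) → M) :
    ∑ x : Fin s × Fin s, f s(x.1, x.2) + ∑ a, f s(a, a) = 2 • ∑ e, f e := by
  rw [← Finset.sum_fiberwise (s := (Finset.univ : Finset (Fin s × Fin s)))
      (g := fun x => s(x.1, x.2)),
    ← Finset.sum_fiberwise (s := (Finset.univ : Finset (Fin s))) (g := fun a => s(a, a)),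
    ← Finset.sum_add_distrib, Finset.smul_sum]
  refine Finset.sum_congr rfl fun e _ => ?_
  rw [Finset.sum_congr rfl (g := fun _ => f e) (fun x hx => by rw [(Finset.mem_filter.1 hx).2]),
    Finset.sum_congr (s₁ := {a | s(a, a) = e}) rfl (g := fun _ => f e)
      (fun x hx => by rw [(Finset.mem_filter.1 hx).2]),
    Finset.sum_const, Finset.sum_const, ← add_smul]
  congr 1
  induction e with
  | _ a b =>
    have h1 : ({x | s(x.1, x.2) = s(a, b)} : Finset (Fin s × Fin s)) = {(a, b), (b, a)} := by
      ext x
      simp [Prod.ext_iff]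
    rw [h1]
    by_cases hab : a = b
    · subst hab
      have h2 : ({x | s(x, x) = s(a, a)} : Finset (Fin s)) = {a} := by ext; simp
      rw [h2]
      simp
    · have h2 : ({x | s(x, x) = s(a, b)} : Finset (Fin s)) = ∅ := by
        ext x
        simp
        grind
      rw [h2, Finset.card_pair (by simp [hab])]
      simp

theorem sum_degM (m : Sym2 (Fin s) → ℕ) : ∑ v, degM m v = 2 * ∑ e, m e := by
  simp only [degM, Finset.sum_add_distrib]
  have := sum_mk_add_sum_diag m
  rw [Fintype.sum_prod_type] at this
  simpa using this

theorem degM_add (m m' : Sym2 (Fin s) → ℕ) (v : Fin s) :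
    degM (m + m') v = degM m v + degM m' v := by
  simp only [degM, Pi.add_apply, Finset.sum_add_distrib]
  omega

theorem degM_single (a b v : Fin s) :
    degM (Pi.single s(a, b) 1) v = (if v = a then 1 else 0) + if v = b then 1 else 0 := by
  simp only [degM, Pi.single_apply, Sym2.eq_iff]
  have h : ∀ w, ((v = a ∧ w = b ∨ v = b ∧ w = a) ↔ (v = a ∧ w = b) ∨ (v = b ∧ w = a)) :=
    fun _ => Iff.rfl
  by_cases h1 : v = a <;> by_cases h2 : v = b
  · subst h1; subst h2; simp
  · subst h1; simp [h2]
  · subst h2; simp [h1]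
  · simp [h1, h2]

/-- The ratio is the new multiplicity, doubled for a loop. The inductive steps over cuts and over
matchings use `circM` only through it. -/
theorem circM_add_single (m : Sym2 (Fin s) → ℕ) (a b : Fin s) :
    circM (m + Pi.single s(a, b) 1) =
      circM m * ((m s(a, b) + 1) * if a = b then 2 else 1) := by
  have h1 : ∏ e, ((m + Pi.single s(a, b) 1 : Sym2 (Fin s) → ℕ) e)! =
      (∏ e, (m e)!) * (m s(a, b) + 1) := by
    rw [← Finset.mul_prod_erase _ _ (Finset.mem_univ s(a, b)),
      ← Finset.mul_prod_erase (a := s(a, b)) _ (fun e => (m e)!) (Finset.mem_univ _)]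
    rw [Finset.prod_congr (s₁ := Finset.univ.erase s(a, b)) rfl (g := fun e => (m e)!)]
    · simp [Nat.factorial_succ]
      ring
    · intro e he
      simp [Finset.ne_of_mem_erase he]
  have h2 : ∏ v, 2 ^ (m + Pi.single s(a, b) 1 : Sym2 (Fin s) → ℕ) s(v, v) =
      (∏ v, 2 ^ m s(v, v)) * if a = b then 2 else 1 := by
    simp only [Pi.add_apply, pow_add, Finset.prod_mul_distrib]
    congr 1
    split_ifs with hab
    · subst hab
      rw [Finset.prod_eq_single a] <;> simp +contextual
    · refine Finset.prod_eq_one fun v _ => ?_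
      rw [Pi.single_eq_of_ne, pow_zero]
      simp
      grind
  rw [circM, h1, h2, circM]
  ring

/-- The sequence of star fathers given by its first terms `F 1 = q 0, F 2 = q 1, …`. -/
def starF {n : ℕ} (r : Fin s) (q : Fin n → Fin s) (j : ℕ) : Fin s :=
  if h : j - 1 < n then q ⟨j - 1, h⟩ else r

theorem glued_connM {r : Fin s} {π : Fin s → Fin s} (h : IsRooted r π) (F : ℕ → Fin s) (i : ℕ) :
    ConnM (glued (treeM r π) F i) :=
  h.connM.mono fun e => by simp [glued]

theorem sum_glued (m : Sym2 (Fin s) → ℕ) (F : ℕ → Fin s) (i : ℕ) :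
    ∑ e, glued m F i e = ∑ e, m e + i := by
  simp only [glued, Pi.add_apply, Finset.sum_add_distrib, Finset.sum_apply]
  rw [Finset.sum_comm]
  simp

theorem glued_succ (m : Sym2 (Fin s) → ℕ) (F : ℕ → Fin s) (i : ℕ) :
    glued m F (i + 1) = glued m F i + Pi.single s(F (2 * i + 1), F (2 * i + 2)) 1 := by
  rw [glued, glued, Finset.sum_range_succ, add_assoc]

theorem glued_congr (m : Sym2 (Fin s) → ℕ) {F F' : ℕ → Fin s} {i : ℕ}
    (h : ∀ j, 1 ≤ j → j ≤ 2 * i → F j = F' j) : glued m F i = glued m F' i := by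
  rw [glued, glued]
  congr 1
  refine Finset.sum_congr rfl fun j hj => ?_
  rw [Finset.mem_range] at hj
  rw [h _ (by omega) (by omega), h _ (by omega) (by omega)]

open Classical in
/-- The sum of `∏ 1 / □` over all ways to obtain `m` from a tree with root `r` by adding `k`
edges one by one. -/
def cutWeight (r : Fin s) (k : ℕ) (m : Sym2 (Fin s) → ℕ) : ℝ≥0∞ :=
  ∑ q : Fin (2 * k) → Fin s, ∑ π : Fin s → Fin s,
    if IsRooted r π ∧ glued (treeM r π) (starF r q) k = m then
      ∏ i ∈ Finset.Icc 1 k, (squareM (glued (treeM r π) (starF r q) i) : ℝ≥0∞)⁻¹ else 0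

theorem cutWeight_eq_zero {r : Fin s} {k : ℕ} {m : Sym2 (Fin s) → ℕ} (h : ¬ ConnM m) :
    cutWeight r k m = 0 := by
  refine Finset.sum_eq_zero fun q _ => Finset.sum_eq_zero fun π _ => if_neg ?_
  rintro ⟨hπ, rfl⟩
  exact h (glued_connM hπ _ _)

theorem starF_snoc {n : ℕ} (r : Fin s) (q : Fin n → Fin s) (a : Fin s) {j : ℕ} (hj : j ≤ n)
    (h1 : 1 ≤ j) : starF r (Fin.snoc (α := fun _ => Fin s) q a) j = starF r q j := by
  have h : j - 1 < n := by omega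
  have h' : j - 1 < n + 1 := by omega
  rw [starF, starF, dif_pos h, dif_pos h']
  exact Fin.snoc_castSucc (α := fun _ => Fin s) a q ⟨j - 1, h⟩

theorem starF_snoc_last {n : ℕ} (r : Fin s) (q : Fin n → Fin s) (a : Fin s) :
    starF r (Fin.snoc (α := fun _ => Fin s) q a) (n + 1) = a := by
  rw [starF, dif_pos (by omega)]
  exact Fin.snoc_last (α := fun _ => Fin s) a q

theorem sum_snoc {n : ℕ} {M : Type*} [AddCommMonoid M] (f : (Fin (n + 1) → Fin s) → M) :
    ∑ q, f q = ∑ a, ∑ q, f (Fin.snoc (α := fun _ => Fin s) q a) := by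
  rw [← Fintype.sum_prod_type', ← (Fin.snocEquiv fun _ => Fin s).sum_comp]
  rfl

/-- The last edge joins the last two entries of `q`, in this order, hence the sum over ordered
pairs. The last factor of the product is `1/□(m)` whatever that edge is, so it comes out of the sum.
-/
theorem cutWeight_succ (r : Fin s) (k : ℕ) (m : Sym2 (Fin s) → ℕ) :
    cutWeight r (k + 1) m = (squareM m : ℝ≥0∞)⁻¹ * ∑ x : Fin s × Fin s,
      if 0 < m s(x.1, x.2) then cutWeight r k (m - Pi.single s(x.1, x.2) 1) else 0 := by
  classical
  have hsplit : cutWeight r (k + 1) m = ∑ b, ∑ a, ∑ q : Fin (2 * k) → Fin s,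
      ∑ π : Fin s → Fin s,
      if IsRooted r π ∧ glued (treeM r π) (starF r q) k + Pi.single s(a, b) 1 = m then
        (squareM m : ℝ≥0∞)⁻¹ *
          ∏ i ∈ Finset.Icc 1 k, (squareM (glued (treeM r π) (starF r q) i) : ℝ≥0∞)⁻¹ else 0 := by
    rw [cutWeight]
    -- `2 * (k + 1)` is `2 * k + 1 + 1` by definition, so `sum_snoc` can split off two entries:
    -- first `b`, then `a`.
    change ∑ q : Fin (2 * k + 1 + 1) → Fin s, _ = _
    rw [sum_snoc]
    refine Finset.sum_congr rfl fun b _ => ?_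
    rw [sum_snoc]
    refine Finset.sum_congr rfl fun a _ => ?_
    refine Finset.sum_congr rfl fun q _ => Finset.sum_congr rfl fun π _ => ?_
    set Q : Fin (2 * k + 1 + 1) → Fin s := Fin.snoc (α := fun _ => Fin s)
      (Fin.snoc (α := fun _ => Fin s) q a) b with hQ
    have hF : ∀ i ≤ k, glued (treeM r π) (starF r Q) i = glued (treeM r π) (starF r q) i := by
      intro i hi
      refine glued_congr _ fun j h1 hj => ?_
      rw [hQ, starF_snoc _ _ _ (by omega) h1, starF_snoc _ _ _ (by omega) h1]
    have hlast : glued (treeM r π) (starF r Q) (k + 1) =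
        glued (treeM r π) (starF r q) k + Pi.single s(a, b) 1 := by
      rw [glued_succ, hF k le_rfl]
      congr 3
      · rw [hQ, starF_snoc _ _ _ (by omega) (by omega), starF_snoc_last]
      · exact starF_snoc_last r _ b
    change (if IsRooted r π ∧ glued (treeM r π) (starF r Q) (k + 1) = m then
      ∏ i ∈ Finset.Icc 1 (k + 1), (squareM (glued (treeM r π) (starF r Q) i) : ℝ≥0∞)⁻¹ else 0) = _
    rw [← hlast]
    split_ifs with h
    · rw [Finset.prod_Icc_succ_top (by omega), mul_comm, h.2]
      congr 1
      refine Finset.prod_congr rfl fun i hi => ?_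
      rw [hF i (Finset.mem_Icc.1 hi).2]
    · rfl
  rw [hsplit, Finset.sum_comm, ← Fintype.sum_prod_type', Finset.mul_sum]
  refine Finset.sum_congr rfl fun x _ => ?_
  split_ifs with hx
  · simp only [cutWeight, Finset.mul_sum, mul_ite, mul_zero]
    refine Finset.sum_congr rfl fun q _ => Finset.sum_congr rfl fun π _ => ?_
    refine if_congr (and_congr_right fun _ => ?_) rfl rfl
    constructor
    · rintro h
      rw [← h, add_tsub_cancel_right]
    · intro h
      rw [h]
      funext e
      by_cases he : e = s(x.1, x.2)
      · subst he
        simp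
        omega
      · simp [he]
  · rw [mul_zero]
    refine Finset.sum_eq_zero fun q _ => Finset.sum_eq_zero fun π _ => if_neg ?_
    rintro ⟨-, rfl⟩
    simp at hx

/-- Induction on `k` by cutting the last edge. A cut at `e` divides `∘` by `m e`, or by `2 * m e`
for a loop, and a cut that disconnects has weight zero. The factors add up to `2 □(m)`, and `□(m)`
cancels, so each step leaves a factor 2. For `k = 0` the multigraph is a tree, with `∘ = 1` and one
parent function for the root `r`. -/
theorem circM_mul_cutWeight (hs : 0 < s) (r : Fin s) (k : ℕ) (m : Sym2 (Fin s) → ℕ)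
    (h : ConnM m) (hm : ∑ e, m e + 1 = s + k) : (circM m : ℝ≥0∞) * cutWeight r k m = 2 ^ k := by
  classical
  induction k generalizing m with
  | zero =>
    obtain ⟨π, hπ, huniq⟩ := existsUnique_rooted h hm r
    have hc : circM m = 1 := by
      have h1 : ∀ e, m e ≤ 1 := fun e => hπ.2 ▸ hπ.1.treeM_le_one e
      have h2 : ∀ v, m s(v, v) = 0 := by
        intro v
        by_contra hv
        obtain ⟨u, hu, huv⟩ := treeM_pos_iff.1 (hπ.2 ▸ Nat.pos_of_ne_zero hv)
        obtain ⟨d, hd⟩ := hπ.1.2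
        have := hd u hu
        rw [Sym2.eq_iff] at huv
        have : π u = u := by rcases huv with ⟨rfl, h⟩ | ⟨h, rfl⟩ <;> exact h.symm
        simp_all
      have h3 : ∀ e, (m e)! = 1 := fun e => Nat.factorial_eq_one.2 (h1 e)
      simp [circM, h2, h3]
    have hw : cutWeight r 0 m = ∑ q : Fin (2 * 0) → Fin s, 1 := by
      refine Finset.sum_congr rfl fun q _ => ?_
      rw [Finset.sum_eq_single π]
      · simp [glued, hπ]
      · intro π' _ hne
        rw [if_neg]
        intro h'
        exact hne (huniq π' (by simpa [glued] using h'))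
      · simp
    rw [hc, hw]
    simp
  | succ k ih =>
    obtain ⟨g, hg⟩ : ∃ g : Sym2 (Fin s) → ℕ,
        g = fun e => if ConnM (m - Pi.single e 1) then m e else 0 := ⟨_, rfl⟩
    have hgsum : squareM m = ∑ e, g e := by rw [squareM, hg]
    have hterm : ∀ x : Fin s × Fin s, (circM m : ℝ≥0∞) * (if 0 < m s(x.1, x.2) then
        cutWeight r k (m - Pi.single s(x.1, x.2) 1) else 0) =
        2 ^ k * ((g s(x.1, x.2) * (if x.1 = x.2 then 2 else 1) : ℕ) : ℝ≥0∞) := by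
      rintro ⟨a, b⟩
      simp only [hg]
      by_cases hx : 0 < m s(a, b)
      · by_cases hc : ConnM (m - Pi.single s(a, b) 1)
        · have hsub : m - Pi.single s(a, b) 1 + Pi.single s(a, b) 1 = m := by
            refine tsub_add_cancel_of_le fun e => ?_
            by_cases he : e = s(a, b)
            · subst he
              simp
              omega
            · simp [he]
          have hcirc := circM_add_single (m - Pi.single s(a, b) 1) a b
          rw [hsub] at hcirc
          have htot : ∑ e, (m - Pi.single s(a, b) 1 : Sym2 (Fin s) → ℕ) e + 1 = s + k := by
            have : ∑ e, m e = ∑ e, (m - Pi.single s(a, b) 1 : Sym2 (Fin s) → ℕ) e + 1 := by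
              conv_lhs => rw [← hsub]
              simp only [Pi.add_apply, Finset.sum_add_distrib, Finset.sum_pi_single',
                Finset.mem_univ, if_true]
            omega
          have hm1 : (m - Pi.single s(a, b) 1 : Sym2 (Fin s) → ℕ) s(a, b) + 1 = m s(a, b) := by
            simp
            omega
          rw [if_pos hx, if_pos hc, hcirc, Nat.cast_mul, mul_right_comm, ih _ hc htot, hm1]
        · rw [if_neg hc, cutWeight_eq_zero hc]
          simp
      · have h0 : m s(a, b) = 0 := by omega
        simp [h0]
    -- A loop is met once with weight two, any other edge twice with weight one.
    have hsum : ∑ x : Fin s × Fin s, g s(x.1, x.2) * (if x.1 = x.2 then 2 else 1) =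
        2 * squareM m := by
      have hd := sum_mk_add_sum_diag g
      rw [nsmul_eq_mul, Nat.cast_ofNat] at hd
      have hdiag : ∑ a, g s(a, a) =
          ∑ x : Fin s × Fin s, if x.1 = x.2 then g s(x.1, x.2) else 0 := by
        rw [Fintype.sum_prod_type]
        simp
      rw [hgsum, ← hd, hdiag, ← Finset.sum_add_distrib]
      refine Finset.sum_congr rfl fun x _ => ?_
      split_ifs <;> omega
    have hsq : (squareM m : ℝ≥0∞) ≠ 0 := by
      exact_mod_cast (squareM_pos hs h (by omega)).ne'
    rw [cutWeight_succ, mul_left_comm, Finset.mul_sum, Finset.sum_congr rfl fun x _ => hterm x,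
      ← Finset.mul_sum, ← Nat.cast_sum, hsum, Nat.cast_mul, pow_succ, mul_left_comm,
      mul_left_comm (_⁻¹), ENNReal.inv_mul_cancel hsq (ENNReal.natCast_ne_top _)]
    simp

end Cycles

/-! ## Sequences of letters -/

section Letters

variable {s : ℕ}

/-- The sequence `b, ω 0, ω 1, …`. -/
def consSeq {α : Type*} (b : α) (ω : ℕ → α) : ℕ → α
  | 0 => b
  | n + 1 => ω n

theorem consSeq_shift {α : Type*} (ω : ℕ → α) : consSeq (ω 0) (fun n => ω (n + 1)) = ω := by
  funext n
  cases n <;> rfl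

theorem measurable_consSeq {α : Type*} [MeasurableSpace α] :
    Measurable fun x : α × (ℕ → α) => consSeq x.1 x.2 := by
  refine measurable_pi_lambda _ fun n => ?_
  cases n with
  | zero => exact measurable_fst
  | succ n => exact (measurable_pi_apply n).comp measurable_snd

/-- The source of all recursions on the first letter. Finite boxes determine the product measure, so
it suffices to compare the two measures there. -/
theorem map_consSeq {α : Type*} [MeasurableSpace α] (ν : Measure α) [IsProbabilityMeasure ν] :
    (ν.prod (Measure.infinitePi fun _ : ℕ => ν)).map (fun x => consSeq x.1 x.2) =
      Measure.infinitePi fun _ : ℕ => ν := by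
  classical
  refine Measure.eq_infinitePi _ fun t T hT => ?_
  obtain ⟨N, hN⟩ : ∃ N, t ⊆ Finset.range (N + 1) :=
    ⟨t.sup id, fun i hi => Finset.mem_range.2 (Nat.lt_succ_of_le (Finset.le_sup (f := id) hi))⟩
  -- Padding with `univ` turns the constrained coordinates into an initial segment, which the shift
  -- maps to an initial segment.
  set T' : ℕ → Set α := fun n => if n ∈ t then T n else Set.univ with hT'
  have hT'm : ∀ n, MeasurableSet (T' n) := fun n => by
    simp only [hT']
    split_ifs
    exacts [hT n, MeasurableSet.univ]
  have h1 : Set.pi (t : Set ℕ) T = Set.pi (Finset.range (N + 1) : Set ℕ) T' := by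
    ext ω
    simp only [Set.mem_pi, Finset.mem_coe, hT']
    constructor
    · intro h n _
      split_ifs with hn
      exacts [h n hn, mem_univ _]
    · intro h n hn
      simpa [hn] using h n (hN hn)
  have h2 : ∏ n ∈ t, ν (T n) = ∏ n ∈ Finset.range (N + 1), ν (T' n) := by
    rw [← Finset.prod_subset hN fun n _ hn => by simp [hT', hn]]
    exact Finset.prod_congr rfl fun n hn => by simp [hT', hn]
  have h3 : (fun x : α × (ℕ → α) => consSeq x.1 x.2) ⁻¹'
      Set.pi (Finset.range (N + 1) : Set ℕ) T' =
      T' 0 ×ˢ Set.pi (Finset.range N : Set ℕ) fun n => T' (n + 1) := by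
    ext ⟨b, ω⟩
    simp only [mem_preimage, Set.mem_pi, Finset.coe_range, mem_Iio, mem_prod]
    constructor
    · exact fun h => ⟨h 0 (by omega), fun n hn => h (n + 1) (by omega)⟩
    · rintro ⟨h0, h⟩ (_ | n) hn
      exacts [h0, h n (by omega)]
  rw [h1, h2, Measure.map_apply measurable_consSeq (.pi (Finset.countable_toSet _) fun n _ => hT'm n),
    h3, Measure.prod_prod, Measure.infinitePi_pi _ fun n _ => hT'm (n + 1),
    Finset.prod_range_succ', mul_comm]

theorem infinitePi_eq_sum_cons (ν : Measure (Fin s)) [IsProbabilityMeasure ν]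
    {E : Set (ℕ → Fin s)} (hE : MeasurableSet E) :
    Measure.infinitePi (fun _ : ℕ => ν) E =
      ∑ b, ν {b} * Measure.infinitePi (fun _ : ℕ => ν) {ω | consSeq b ω ∈ E} := by
  conv_lhs => rw [← map_consSeq, Measure.map_apply measurable_consSeq hE,
    Measure.prod_apply (measurable_consSeq hE), lintegral_fintype]
  exact Finset.sum_congr rfl fun b _ => mul_comm _ _

/-- The event is the preimage of a set of words of length `N`, and there are finitely many such
words. -/
theorem measurableSet_of_finite_dependence {P : (ℕ → Fin s) → Prop} (N : ℕ)
    (h : ∀ ω ω' : ℕ → Fin s, (∀ i < N, ω i = ω' i) → P ω → P ω') : MeasurableSet {ω | P ω} := by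
  have hφ : Measurable fun (ω : ℕ → Fin s) (i : Fin N) => ω i :=
    measurable_pi_lambda _ fun i => measurable_pi_apply _
  have : {ω | P ω} = (fun (ω : ℕ → Fin s) (i : Fin N) => ω i) ⁻¹'
      ((fun (ω : ℕ → Fin s) (i : Fin N) => ω i) '' {ω | P ω}) := by
    refine Set.Subset.antisymm (subset_preimage_image _ _) ?_
    rintro ω ⟨ω', hω', heq⟩
    exact h ω' ω (fun i hi => congrFun heq ⟨i, hi⟩) hω'
  rw [this]
  exact hφ (Set.toFinite _).measurableSet

/-- The indices visited before time `n`, when the indices in `S` are visited at the start. -/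
def visited (S : Finset (Fin s)) (ω : ℕ → Fin s) (n : ℕ) : Finset (Fin s) :=
  S ∪ (Finset.range n).image ω

/-- The letter before the letter `ω n`, when `a` is the letter before the sequence `ω`. -/
def previous (a : Fin s) (ω : ℕ → Fin s) : ℕ → Fin s
  | 0 => a
  | n + 1 => ω n

/-- The number of repetitions before time `n`, when the indices in `S` are visited at the start. -/
def repeats (S : Finset (Fin s)) (ω : ℕ → Fin s) (n : ℕ) : ℕ :=
  {i ∈ Finset.range n | ω i ∈ visited S ω i}.card

/-- The letters `ω`, read from the state with visited indices `S` and last letter `a`, build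
a tree with parent function `π` in which the next stars have fathers `L`. -/
def Follows (π : Fin s → Fin s) (S : Finset (Fin s)) (a : Fin s) (L : List (Fin s))
    (ω : ℕ → Fin s) : Prop :=
  ∀ n, (ω n ∉ visited S ω n → π (ω n) = previous a ω n) ∧
    (ω n ∈ visited S ω n → ∀ x ∈ L[repeats S ω n]?, x = previous a ω n)

theorem visited_congr (S : Finset (Fin s)) {ω ω' : ℕ → Fin s} {n : ℕ}
    (h : ∀ i < n, ω i = ω' i) : visited S ω n = visited S ω' n := by
  rw [visited, visited, Finset.image_congr]
  exact fun i hi => h i (by simpa using hi)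

theorem previous_congr (a : Fin s) {ω ω' : ℕ → Fin s} {n : ℕ}
    (h : ∀ i < n, ω i = ω' i) : previous a ω n = previous a ω' n := by
  cases n with
  | zero => rfl
  | succ n => exact h n (by omega)

theorem repeats_congr (S : Finset (Fin s)) {ω ω' : ℕ → Fin s} {n : ℕ}
    (h : ∀ i < n, ω i = ω' i) : repeats S ω n = repeats S ω' n := by
  rw [repeats, repeats]
  congr 1
  refine Finset.filter_congr fun i hi => ?_
  rw [Finset.mem_range] at hi
  rw [h i hi, visited_congr S fun j hj => h j (hj.trans hi)]

theorem measurableSet_follows (π : Fin s → Fin s) (S : Finset (Fin s)) (a : Fin s)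
    (L : List (Fin s)) : MeasurableSet {ω | Follows π S a L ω} := by
  simp only [Follows, ofPred_forall]
  refine MeasurableSet.iInter fun n => measurableSet_of_finite_dependence (n + 1) ?_
  intro ω ω' h
  have h' : ∀ i < n, ω i = ω' i := fun i hi => h i (by omega)
  rw [h n (by omega), visited_congr S h', previous_congr a h', repeats_congr S h']
  exact id

theorem visited_consSeq (S : Finset (Fin s)) (b : Fin s) (ω : ℕ → Fin s) (n : ℕ) :
    visited S (consSeq b ω) (n + 1) = visited (insert b S) ω n := by
  ext x
  simp only [visited, Finset.mem_union, Finset.mem_image, Finset.mem_range, Finset.mem_insert]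
  constructor
  · rintro (h | ⟨_ | i, hi, rfl⟩)
    exacts [.inl (.inr h), .inl (.inl rfl), .inr ⟨i, by omega, rfl⟩]
  · rintro ((rfl | h) | ⟨i, hi, rfl⟩)
    exacts [.inr ⟨0, by omega, rfl⟩, .inl h, .inr ⟨i + 1, by omega, rfl⟩]

theorem repeats_consSeq (S : Finset (Fin s)) (b : Fin s) (ω : ℕ → Fin s) (n : ℕ) :
    repeats S (consSeq b ω) (n + 1) = repeats (insert b S) ω n + if b ∈ S then 1 else 0 := by
  simp only [repeats, Finset.card_filter]
  rw [Finset.sum_range_succ']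
  simp only [visited_consSeq]
  simp [consSeq, visited]

theorem previous_consSeq (a b : Fin s) (ω : ℕ → Fin s) (n : ℕ) :
    previous a (consSeq b ω) (n + 1) = previous b ω n := by
  cases n <;> rfl

theorem follows_consSeq_of_mem {π : Fin s → Fin s} {S : Finset (Fin s)} {a b : Fin s}
    {L : List (Fin s)} {ω : ℕ → Fin s} (hb : b ∈ S) :
    Follows π S a L (consSeq b ω) ↔ (∀ x ∈ L.head?, x = a) ∧ Follows π S b L.tail ω := by
  unfold Follows
  rw [← Nat.and_forall_add_one]
  simp only [visited_consSeq, repeats_consSeq, previous_consSeq, Finset.insert_eq_of_mem hb, hb,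
    if_true]
  simp [consSeq, visited, repeats, previous, hb, List.head?_eq_getElem?]

theorem follows_consSeq_of_notMem {π : Fin s → Fin s} {S : Finset (Fin s)} {a b : Fin s}
    {L : List (Fin s)} {ω : ℕ → Fin s} (hb : b ∉ S) :
    Follows π S a L (consSeq b ω) ↔ π b = a ∧ Follows π (insert b S) b L ω := by
  unfold Follows
  rw [← Nat.and_forall_add_one]
  simp only [visited_consSeq, repeats_consSeq, previous_consSeq, hb, if_false, add_zero]
  simp [consSeq, visited, previous, hb]

/-- The probability that i.i.d. letters with law `ν` follow `π` and `L`. -/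
def followProb (ν : Measure (Fin s)) [IsProbabilityMeasure ν] (π : Fin s → Fin s)
    (S : Finset (Fin s)) (a : Fin s) (L : List (Fin s)) : ℝ≥0∞ :=
  Measure.infinitePi (fun _ : ℕ => ν) {ω | Follows π S a L ω}

variable (ν : Measure (Fin s)) [IsProbabilityMeasure ν] (π : Fin s → Fin s)

open Classical in
-- A repeated letter creates a star whose father is the previous letter `a`; this must agree with
-- the head of `L`, which is then used up. A fresh letter must have parent `a` and becomes visited.
theorem followProb_eq (S : Finset (Fin s)) (a : Fin s) (L : List (Fin s)) :
    followProb ν π S a L = ∑ b, ν {b} *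
      if b ∈ S then (if ∀ x ∈ L.head?, x = a then followProb ν π S b L.tail else 0)
      else (if π b = a then followProb ν π (insert b S) b L else 0) := by
  rw [followProb, infinitePi_eq_sum_cons ν (measurableSet_follows π S a L)]
  refine Finset.sum_congr rfl fun b _ => ?_
  congr 1
  by_cases hb : b ∈ S
  · simp only [mem_ofPred_eq, follows_consSeq_of_mem hb, hb, if_true]
    split_ifs with h
    · rw [followProb]
      congr 1
      ext ω
      exact and_iff_right h
    · simp only [h, false_and, ofPred_false, measure_empty]
  · simp only [mem_ofPred_eq, follows_consSeq_of_notMem hb, hb, if_false]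
    split_ifs with h
    · simp [h, followProb]
    · simp [h]

variable {π}

/-- The next star can only be attached to descendants of the last letter. -/
theorem exists_iterate_of_followProb_ne_zero (S : Finset (Fin s)) (a x : Fin s)
    (L : List (Fin s)) (h : followProb ν π S a (x :: L) ≠ 0) :
    ∃ n, π^[n] x = a ∧ ∀ i < n, π^[i] x ∉ S := by
  classical
  induction hn : Sᶜ.card using Nat.strong_induction_on generalizing S a with
  | _ N ih =>
    rw [followProb_eq] at h
    obtain ⟨b, -, hb⟩ := Finset.exists_ne_zero_of_sum_ne_zero h
    have hb := right_ne_zero_of_mul hb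
    split_ifs at hb with h1 h2 h3
    · exact ⟨0, h2 x (by simp), by simp⟩
    · exact absurd rfl hb
    · have hlt : (insert b S)ᶜ.card < N := by
        rw [← hn]
        refine Finset.card_lt_card ?_
        rw [Finset.compl_ssubset_compl]
        exact Finset.ssubset_insert h1
      obtain ⟨n, hn, hi⟩ := ih _ hlt (insert b S) b hb rfl
      refine ⟨n + 1, by rw [Function.iterate_succ_apply', hn, h3], fun i hi' => ?_⟩
      rcases Nat.lt_succ_iff_lt_or_eq.1 hi' with h | rfl
      · exact fun hS => hi i h (Finset.mem_insert_of_mem hS)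
      · rwa [hn]
    · exact absurd rfl hb

/-- A visited `x` can be the father of the next star only if it is the last letter and the next
letter is a repetition: after a fresh letter, only vertices not visited before it can be that
father. So only `a = x` survives, and the next letter is any element of `S`. -/
theorem sum_followProb_of_mem {S : Finset (Fin s)} {x : Fin s} (hx : x ∈ S) (L : List (Fin s)) :
    ∑ a ∈ S, ν {a} * followProb ν π S a (x :: L) =
      ν {x} * ∑ a ∈ S, ν {a} * followProb ν π S a L := by
  classical
  rw [Finset.sum_eq_single_of_mem x hx]
  · congr 1
    rw [followProb_eq, ← Finset.sum_filter_add_sum_filter_not Finset.univ (· ∈ S),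
      Finset.sum_eq_zero (s := {b | b ∉ S}), add_zero]
    · simp only [Finset.filter_mem_eq_inter, Finset.univ_inter]
      exact Finset.sum_congr rfl fun b hb => by simp [hb]
    · intro b hb
      have hb : b ∉ S := by simpa using hb
      rw [if_neg hb]
      by_contra hne
      have hne := right_ne_zero_of_mul hne
      split_ifs at hne with h
      · obtain ⟨n, hn, hi⟩ := exists_iterate_of_followProb_ne_zero ν _ _ _ _ hne
        rcases Nat.eq_zero_or_pos n with rfl | hpos
        · exact hb (hn ▸ hx)
        · exact hi 0 hpos (Finset.mem_insert_of_mem hx)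
      · exact hne rfl
  · intro a _ hax
    by_contra hne
    obtain ⟨n, hn, hi⟩ := exists_iterate_of_followProb_ne_zero ν _ _ _ _ (right_ne_zero_of_mul hne)
    rcases Nat.eq_zero_or_pos n with rfl | hpos
    · exact hax hn.symm
    · exact hi 0 hpos hx

theorem IsRooted.exists_iterate_eq {r : Fin s} (h : IsRooted r π) (v : Fin s) :
    ∃ n, π^[n] v = r := by
  obtain ⟨-, d, hd⟩ := h
  induction hn : d v using Nat.strong_induction_on generalizing v with
  | _ N ih =>
    by_cases hv : v = r
    · exact ⟨0, hv⟩
    · obtain ⟨n, hn⟩ := ih _ (hn ▸ hd v hv) _ rfl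
      exact ⟨n + 1, hn⟩

/-- Before a star can be attached to an unvisited `x`, the letters must run along the branch from
`S` to `x`. Let `b` be the first vertex of this branch outside `S`. Then the last letter is `π b`
and the next one is `b`, without any choice. -/
theorem sum_followProb_of_notMem {r : Fin s} (hπ : IsRooted r π) {S : Finset (Fin s)}
    (hr : r ∈ S) {x : Fin s} (hx : x ∉ S) :
    ∃ b ∉ S, π b ∈ S ∧ ∀ L, ∑ a ∈ S, ν {a} * followProb ν π S a (x :: L) =
      ν {π b} * ∑ a ∈ insert b S, ν {a} * followProb ν π (insert b S) a (x :: L) := by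
  classical
  have hex : ∃ n, π^[n] x ∈ S := by
    obtain ⟨n, hn⟩ := hπ.exists_iterate_eq x
    exact ⟨n, hn ▸ hr⟩
  -- The first ancestor of `x` in `S`, counted from `x`; the vertex just below it on the branch is
  -- `b`.
  obtain ⟨n, hn, hmin⟩ : ∃ n, π^[n] x ∈ S ∧ ∀ i < n, π^[i] x ∉ S :=
    ⟨Nat.find hex, Nat.find_spec hex, fun i hi => Nat.find_min hex hi⟩
  obtain ⟨n, rfl⟩ : ∃ l, n = l + 1 :=
    Nat.exists_eq_succ_of_ne_zero fun h => hx (by simpa [h] using hn)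
  set b := π^[n] x with hb
  have hπb : π b ∈ S := by rwa [Function.iterate_succ_apply'] at hn
  have hbS : b ∉ S := hmin n (by omega)
  refine ⟨b, hbS, hπb, fun L => ?_⟩
  have h1 : ∑ a ∈ S, ν {a} * followProb ν π S a (x :: L) =
      ν {π b} * (ν {b} * followProb ν π (insert b S) b (x :: L)) := by
    rw [Finset.sum_eq_single_of_mem (π b) hπb]
    · congr 1
      rw [followProb_eq, Finset.sum_eq_single b]
      · simp [hbS]
      · intro b' _ hne
        by_contra h0
        have h0 := right_ne_zero_of_mul h0
        split_ifs at h0 with h2 h3 h4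
        · exact hx (h3 x (by simp) ▸ hπb)
        · exact h0 rfl
        · obtain ⟨n', hn', hi⟩ := exists_iterate_of_followProb_ne_zero ν _ _ _ _ h0
          have h5 : π^[n' + 1] x ∈ S := by rw [Function.iterate_succ_apply', hn', h4]; exact hπb
          -- Minimality of `n + 1` bounds `n'` from below; the ancestor number `n + 1` lies in `S`,
          -- which bounds `n'` from above. Only `n' = n` is left, and the fresh letter is `b`.
          have h6 : ¬ n' + 1 < n + 1 := fun h => hmin _ h h5
          have h7 : ¬ n + 1 < n' := fun h => hi _ h (Finset.mem_insert_of_mem hn)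
          have h8 : n' ≠ n + 1 := fun h => h2 (by rw [← hn', h]; exact hn)
          have h9 : n' = n := by omega
          exact hne (by rw [← hn', h9])
        · exact h0 rfl
      · simp
    · intro a ha hne
      by_contra h0
      obtain ⟨n', hn', hi⟩ :=
        exists_iterate_of_followProb_ne_zero ν _ _ _ _ (right_ne_zero_of_mul h0)
      have h6 : ¬ n' < n + 1 := fun h => hmin _ h (hn' ▸ ha)
      have h7 : ¬ n + 1 < n' := fun h => hi _ h hn
      have h8 : n' = n + 1 := by omega
      exact hne (by rw [← hn', h8, Function.iterate_succ_apply'])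
  have h2 : ∑ a ∈ insert b S, ν {a} * followProb ν π (insert b S) a (x :: L) =
      ν {b} * followProb ν π (insert b S) b (x :: L) := by
    refine Finset.sum_eq_single_of_mem b (Finset.mem_insert_self _ _) ?_
    intro a ha hne
    have ha : a ∈ S := (Finset.mem_insert.1 ha).resolve_left hne
    by_contra h0
    obtain ⟨n', hn', hi⟩ :=
      exists_iterate_of_followProb_ne_zero ν _ _ _ _ (right_ne_zero_of_mul h0)
    have h6 : ¬ n' < n + 1 := fun h => hmin _ h (hn' ▸ ha)
    exact hi n (by omega) (Finset.mem_insert_self _ _)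
  rw [h1, h2]

/-- The next star has exactly one father. The recursion is on the number of unvisited vertices,
since only fresh letters delay the next star. -/
theorem followProb_nil (S : Finset (Fin s)) (a : Fin s) :
    followProb ν π S a [] = ∑ x, followProb ν π S a [x] := by
  classical
  induction hn : Sᶜ.card using Nat.strong_induction_on generalizing S a with
  | _ N ih =>
    rw [followProb_eq, Finset.sum_congr rfl fun x _ => followProb_eq ν π S a [x],
      Finset.sum_comm]
    refine Finset.sum_congr rfl fun b _ => ?_
    rw [← Finset.mul_sum]
    congr 1
    by_cases hb : b ∈ S
    · simp [hb]
    · have hlt : (insert b S)ᶜ.card < N := by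
        rw [← hn]
        refine Finset.card_lt_card ?_
        rw [Finset.compl_ssubset_compl]
        exact Finset.ssubset_insert hb
      simp only [hb, if_false]
      split_ifs with h
      · exact ih _ hlt _ _ rfl
      · simp

theorem sum_singleton_eq_one : ∑ a, ν {a} = 1 := by
  simp

theorem sum_singleton_ne_top (S : Finset (Fin s)) : ∑ a ∈ S, ν {a} ≠ ∞ :=
  ENNReal.sum_ne_top.2 fun _ _ => measure_ne_top _ _

theorem followProb_univ_nil (a : Fin s) : followProb ν π Finset.univ a [] = 1 := by
  have : {ω : ℕ → Fin s | Follows π Finset.univ a [] ω} = Set.univ := by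
    ext ω
    simp [Follows, visited]
  rw [followProb, this, measure_univ]

/-- The factor `ν {a}` makes the last letter random within `S`, and this average, unlike a single
`followProb`, has a product form. Outer induction on the number of unvisited vertices, inner
induction on `L`. A head in `S` splits off by `sum_followProb_of_mem`; a head outside `S` enlarges
`S` by `sum_followProb_of_notMem`. For `L = []`, summing over the father of the next star gives a
linear equation for the unknown value. -/
theorem sum_followProb (hν : ∀ i, ν {i} ≠ 0) {r : Fin s} (hπ : IsRooted r π)
    (S : Finset (Fin s)) (hr : r ∈ S) (hS : ∀ v ∈ S, π v ∈ S) (L : List (Fin s)) :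
    ∑ a ∈ S, ν {a} * followProb ν π S a L =
      (∏ v ∈ Sᶜ, ν {π v}) * (L.map fun x => ν {x}).prod := by
  classical
  induction hn : Sᶜ.card using Nat.strong_induction_on generalizing S L with
  | _ N ih =>
    have hout : ∀ x ∉ S, ∀ L, ∑ a ∈ S, ν {a} * followProb ν π S a (x :: L) =
        (∏ v ∈ Sᶜ, ν {π v}) * ((x :: L).map fun x => ν {x}).prod := by
      intro x hx L
      obtain ⟨b, hb, hπb, h⟩ := sum_followProb_of_notMem ν hπ hr hx
      have hlt : (insert b S)ᶜ.card < N := by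
        rw [← hn]
        refine Finset.card_lt_card ?_
        rw [Finset.compl_ssubset_compl]
        exact Finset.ssubset_insert hb
      rw [h, ih _ hlt (insert b S) (Finset.mem_insert_of_mem hr) ?_ (x :: L) rfl, ← mul_assoc,
        Finset.compl_insert, Finset.mul_prod_erase _ (fun v => ν {π v}) (by simpa using hb)]
      intro v hv
      rcases Finset.mem_insert.1 hv with rfl | hv
      · exact Finset.mem_insert_of_mem hπb
      · exact Finset.mem_insert_of_mem (hS v hv)
    induction L with
    | nil =>
      by_cases hfull : S = Finset.univ
      · subst hfull
        simp [followProb_univ_nil]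
      · set g := ∑ a ∈ S, ν {a} * followProb ν π S a [] with hg
        have hle : g ≤ 1 := by
          calc g ≤ ∑ a ∈ S, ν {a} * 1 := by
                refine Finset.sum_le_sum fun a _ => ?_
                gcongr
                exact prob_le_one
            _ ≤ ∑ a, ν {a} := by
                simp only [mul_one]
                exact Finset.sum_le_sum_of_subset (Finset.subset_univ _)
            _ = 1 := sum_singleton_eq_one ν
        -- Fathers in `S` reproduce `g`, fathers outside give the product. As the total mass is 1,
        -- comparison with `h2` leaves `ν(Sᶜ) g = ν(Sᶜ) ∏`, where `ν(Sᶜ)` is nonzero.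
        have h1 : g = (∑ x ∈ S, ν {x}) * g + (∑ x ∈ Sᶜ, ν {x}) * ∏ v ∈ Sᶜ, ν {π v} := by
          conv_lhs => rw [hg, Finset.sum_congr rfl fun a _ => by rw [followProb_nil, Finset.mul_sum]]
          rw [Finset.sum_comm, ← Finset.sum_add_sum_compl S, Finset.sum_mul, Finset.sum_mul]
          congr 1
          · exact Finset.sum_congr rfl fun x hx => sum_followProb_of_mem ν hx []
          · refine Finset.sum_congr rfl fun x hx => ?_
            rw [hout x (by simpa using hx)]
            simp [mul_comm]
        have h2 : g = (∑ x ∈ S, ν {x}) * g + (∑ x ∈ Sᶜ, ν {x}) * g := by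
          rw [← add_mul, Finset.sum_add_sum_compl, sum_singleton_eq_one, one_mul]
        have hfin : (∑ x ∈ S, ν {x}) * g ≠ ∞ :=
          ENNReal.mul_ne_top (sum_singleton_ne_top ν S) (hle.trans_lt ENNReal.one_lt_top).ne
        have h3 := (ENNReal.add_right_inj hfin).1 (h2.symm.trans h1)
        have hne : ∑ x ∈ Sᶜ, ν {x} ≠ 0 := by
          obtain ⟨x, hx⟩ : ∃ x, x ∉ S := by
            by_contra h
            push Not at h
            exact hfull (Finset.eq_univ_iff_forall.2 h)
          intro h0
          exact hν x (Finset.sum_eq_zero_iff.1 h0 x (by simpa using hx))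
        simpa using (ENNReal.mul_right_inj hne (sum_singleton_ne_top ν _)).1 h3
    | cons x L ihL =>
      by_cases hx : x ∈ S
      · rw [sum_followProb_of_mem ν hx, ihL, List.map_cons, List.prod_cons]
        ring
      · exact hout x hx L

/-- The letters `ω` build a tree with root `r` and parent function `π`, and the first stars after
`⋆_0` have fathers `q`. -/
def Builds {n : ℕ} (r : Fin s) (π : Fin s → Fin s) (q : Fin n → Fin s) (ω : ℕ → Fin s) : Prop :=
  ω 0 = r ∧ Follows π {r} r (List.ofFn q) fun n => ω (n + 1)

theorem measurableSet_builds {n : ℕ} (r : Fin s) (π : Fin s → Fin s) (q : Fin n → Fin s) :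
    MeasurableSet {ω | Builds r π q ω} := by
  have h1 : MeasurableSet {ω : ℕ → Fin s | ω 0 = r} :=
    measurable_pi_apply (X := fun _ => Fin s) 0 (measurableSet_singleton r)
  have h2 : Measurable fun (ω : ℕ → Fin s) (n : ℕ) => ω (n + 1) :=
    measurable_pi_lambda _ fun n => measurable_pi_apply _
  exact h1.inter (h2 (measurableSet_follows π {r} r (List.ofFn q)))

/-- The first letter must be `r`, and its probability is the weight of the only term of
`sum_followProb` for `S = {r}`. -/
theorem measure_builds (hν : ∀ i, ν {i} ≠ 0) {n : ℕ} {r : Fin s} (hπ : IsRooted r π)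
    (q : Fin n → Fin s) :
    Measure.infinitePi (fun _ : ℕ => ν) {ω | Builds r π q ω} =
      (∏ v ∈ Finset.univ.erase r, ν {π v}) * ∏ i, ν {q i} := by
  have h := sum_followProb ν hν hπ {r} (by simp) (by simp [hπ.1]) (List.ofFn q)
  rw [Finset.sum_singleton, List.map_ofFn, List.prod_ofFn, Finset.compl_singleton] at h
  rw [infinitePi_eq_sum_cons ν (measurableSet_builds r π q), Finset.sum_eq_single r]
  · exact h ▸ by simp [Builds, consSeq, followProb]
  · intro b _ hb
    simp [Builds, consSeq, hb]
  · simp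

/-- By conditioning on the first letter, the probability `P` of never meeting `i` satisfies `P = (1
- ν {i}) P`. -/
theorem ae_exists_eq (hν : ∀ i, ν {i} ≠ 0) (i : Fin s) :
    ∀ᵐ ω ∂Measure.infinitePi (fun _ : ℕ => ν), ∃ n, ω n = i := by
  rw [ae_iff]
  push Not
  have hm : MeasurableSet {ω : ℕ → Fin s | ∀ n, ω n ≠ i} := by
    simp only [ofPred_forall]
    exact MeasurableSet.iInter fun n =>
      measurable_pi_apply (X := fun _ => Fin s) n (measurableSet_singleton i).compl
  set P := Measure.infinitePi (fun _ : ℕ => ν) {ω | ∀ n, ω n ≠ i} with hP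
  have h1 : P = (∑ b ∈ Finset.univ.erase i, ν {b}) * P := by
    conv_lhs => rw [hP, infinitePi_eq_sum_cons ν hm, ← Finset.add_sum_erase _ _ (Finset.mem_univ i)]
    rw [Finset.sum_mul]
    have h0 : {ω : ℕ → Fin s | consSeq i ω ∈ {ω : ℕ → Fin s | ∀ n, ω n ≠ i}} = ∅ := by
      ext ω
      simp only [mem_ofPred_eq, mem_empty_iff_false, iff_false, not_forall, not_not]
      exact ⟨0, rfl⟩
    rw [h0, measure_empty, mul_zero, zero_add]
    refine Finset.sum_congr rfl fun b hb => ?_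
    congr 2
    ext ω
    simp only [mem_ofPred_eq]
    rw [← Nat.and_forall_add_one]
    simp [consSeq, Finset.ne_of_mem_erase hb]
  have h2 : P = ν {i} * P + (∑ b ∈ Finset.univ.erase i, ν {b}) * P := by
    rw [← add_mul, Finset.add_sum_erase _ (fun b => ν {b}) (Finset.mem_univ i),
      sum_singleton_eq_one, one_mul]
  have hfin : (∑ b ∈ Finset.univ.erase i, ν {b}) * P ≠ ∞ :=
    ENNReal.mul_ne_top (sum_singleton_ne_top ν _) (measure_ne_top _ _)
  have h3 : 0 + (∑ b ∈ Finset.univ.erase i, ν {b}) * P =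
      ν {i} * P + (∑ b ∈ Finset.univ.erase i, ν {b}) * P := by
    rw [zero_add]
    exact h1.symm.trans h2
  have h4 := (ENNReal.add_left_inj hfin).1 h3
  exact (mul_eq_zero.1 h4.symm).resolve_left (hν i)

end Letters

/-! ## The tree built from a sequence of letters -/

section Tree

variable {s : ℕ} {ω : ℕ → Fin s}

theorem mem_visited_empty {v : Fin s} {n : ℕ} : v ∈ visited ∅ ω n ↔ ∃ i < n, ω i = v := by
  simp [visited]

theorem builds_iff {n : ℕ} {r : Fin s} {π : Fin s → Fin s} {q : Fin n → Fin s} :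
    Builds r π q ω ↔ ω 0 = r ∧ ∀ i, (ω (i + 1) ∉ visited ∅ ω (i + 1) → π (ω (i + 1)) = ω i) ∧
      (ω (i + 1) ∈ visited ∅ ω (i + 1) → ∀ h : repeats ∅ ω (i + 1) < n,
        q ⟨repeats ∅ ω (i + 1), h⟩ = ω i) := by
  refine and_congr_right ?_
  rintro rfl
  refine forall_congr' fun i => ?_
  have h1 : visited {ω 0} (fun n => ω (n + 1)) i = visited ∅ ω (i + 1) := by
    conv_rhs => rw [← consSeq_shift ω]
    exact (visited_consSeq ∅ (ω 0) _ i).symm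
  have h2 : repeats {ω 0} (fun n => ω (n + 1)) i = repeats ∅ ω (i + 1) := by
    conv_rhs => rw [← consSeq_shift ω]
    exact (repeats_consSeq ∅ (ω 0) _ i).symm
  have h3 : previous (ω 0) (fun n => ω (n + 1)) i = ω i := by cases i <;> rfl
  rw [h1, h2, h3]
  simp [List.getElem?_ofFn]

theorem repeats_succ (n : ℕ) : repeats ∅ ω (n + 1) =
    repeats ∅ ω n + if ω n ∈ visited ∅ ω n then 1 else 0 := by
  simp only [repeats, Finset.card_filter]
  rw [Finset.sum_range_succ]

theorem visited_succ (n : ℕ) : visited ∅ ω (n + 1) = insert (ω n) (visited ∅ ω n) := by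
  simp [visited, Finset.range_add_one]

theorem repeats_mono : Monotone (repeats ∅ ω) :=
  monotone_nat_of_le_succ fun n => by rw [repeats_succ]; omega

theorem repeats_add_card_visited (n : ℕ) : repeats ∅ ω n + (visited ∅ ω n).card = n := by
  induction n with
  | zero => simp [repeats, visited]
  | succ n ih =>
    rw [repeats_succ, visited_succ]
    split_ifs with h
    · rw [Finset.insert_eq_of_mem h]
      omega
    · rw [Finset.card_insert_of_notMem h]
      omega

/-- At most `s` letters are fresh, so the number of repetitions is unbounded; it grows by one at a
time and takes every value. -/
theorem exists_repeat (ω : ℕ → Fin s) (j : ℕ) :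
    ∃ n, ω (n + 1) ∈ visited ∅ ω (n + 1) ∧ repeats ∅ ω (n + 1) = j := by
  have hex : ∃ N, j < repeats ∅ ω N := by
    refine ⟨j + s + 1, ?_⟩
    have h1 := repeats_add_card_visited (ω := ω) (j + s + 1)
    have h2 := Finset.card_le_univ (visited ∅ ω (j + s + 1))
    rw [Fintype.card_fin] at h2
    omega
  classical
  have hN := Nat.find_spec hex
  have hmin := fun i hi => Nat.find_min (m := i) hex hi
  generalize Nat.find hex = N at hN hmin
  rcases N with _ | _ | n
  · simp [repeats] at hN
  · rw [zero_add, repeats_succ] at hN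
    simp [repeats, visited] at hN
  · have h1 := hmin (n + 1) (by omega)
    rw [repeats_succ] at hN
    split_ifs at hN with h
    · exact ⟨n, h, by omega⟩
    · omega

theorem repeat_unique {n n' : ℕ} (hn : ω (n + 1) ∈ visited ∅ ω (n + 1))
    (hn' : ω (n' + 1) ∈ visited ∅ ω (n' + 1))
    (h : repeats ∅ ω (n + 1) = repeats ∅ ω (n' + 1)) : n = n' := by
  have key : ∀ {a b : ℕ}, ω (a + 1) ∈ visited ∅ ω (a + 1) →
      repeats ∅ ω (a + 1) = repeats ∅ ω (b + 1) → b ≤ a := by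
    intro a b ha hab
    by_contra hlt
    have h1 := repeats_mono (ω := ω) (show a + 2 ≤ b + 1 by omega)
    rw [repeats_succ, if_pos ha] at h1
    omega
  exact le_antisymm (key hn' h.symm) (key hn h)

theorem exists_fresh (hall : ∀ v, ∃ n, ω n = v) {v : Fin s} (hv : v ≠ ω 0) :
    ∃ n, ω (n + 1) = v ∧ ω (n + 1) ∉ visited ∅ ω (n + 1) := by
  classical
  have hN := Nat.find_spec (hall v)
  have hmin := fun i hi => Nat.find_min (m := i) (hall v) hi
  generalize Nat.find (hall v) = N at hN hmin
  rcases N with _ | n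
  · exact absurd hN.symm hv
  · refine ⟨n, hN, ?_⟩
    rw [mem_visited_empty]
    rintro ⟨i, hi, h⟩
    exact hmin i hi (h.trans hN)

theorem fresh_unique {n n' : ℕ} (hn : ω n ∉ visited ∅ ω n) (hn' : ω n' ∉ visited ∅ ω n')
    (h : ω n = ω n') : n = n' := by
  rw [mem_visited_empty] at hn hn'
  push Not at hn hn'
  rcases lt_trichotomy n n' with h1 | h1 | h1
  · exact absurd h (hn' n h1)
  · exact h1
  · exact absurd h.symm (hn n' h1)

/-- `F` gives the fathers of all the stars in the tree built from `ω`. -/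
def IsStarFather (ω : ℕ → Fin s) (F : ℕ → Fin s) : Prop :=
  F 0 = ω 0 ∧ ∀ n, ω (n + 1) ∈ visited ∅ ω (n + 1) → F (repeats ∅ ω (n + 1) + 1) = ω n

theorem exists_isStarFather (ω : ℕ → Fin s) : ∃ F, IsStarFather ω F := by
  choose f hf1 hf2 using exists_repeat ω
  refine ⟨fun j => Nat.casesOn j (ω 0) fun j => ω (f j), rfl, fun n hn => ?_⟩
  change ω (f (repeats ∅ ω (n + 1))) = ω n
  rw [repeat_unique (hf1 _) hn (hf2 _)]

theorem exists_isRooted (hall : ∀ v, ∃ n, ω n = v) :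
    ∃ π, IsRooted (ω 0) π ∧ ∀ n, ω (n + 1) ∉ visited ∅ ω (n + 1) → π (ω (n + 1)) = ω n := by
  classical
  choose! f hf using fun v (hv : v ≠ ω 0) => exists_fresh hall hv
  -- The depth of a vertex is the time of its first visit: its parent is the letter just before, so
  -- was first visited earlier.
  refine ⟨fun v => if v = ω 0 then ω 0 else ω (f v), ⟨by simp, fun v => Nat.find (hall v), ?_⟩, ?_⟩
  · intro v hv
    simp only [if_neg hv]
    refine (Nat.find_lt_iff _ _).2 ⟨f v, ?_, rfl⟩
    by_contra hle
    have h1 : Nat.find (hall v) < f v + 1 := by omega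
    exact (hf v hv).2 (mem_visited_empty.2 ⟨_, h1, (Nat.find_spec (hall v)).trans (hf v hv).1.symm⟩)
  · intro n hn
    have h0 : ω (n + 1) ≠ ω 0 := fun h => hn (mem_visited_empty.2 ⟨0, by omega, h.symm⟩)
    simp only [if_neg h0]
    obtain ⟨h1, h2⟩ := hf _ h0
    have := fresh_unique h2 hn h1
    rw [show f (ω (n + 1)) = n by omega]

theorem existsUnique_builds (hall : ∀ v, ∃ n, ω n = v) (n : ℕ) :
    ∃! x : Fin s × (Fin s → Fin s) × (Fin n → Fin s),
      IsRooted x.1 x.2.1 ∧ Builds x.1 x.2.1 x.2.2 ω := by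
  obtain ⟨π, hπ, hbuild⟩ := exists_isRooted hall
  obtain ⟨F, hF0, hF⟩ := exists_isStarFather ω
  refine ⟨(ω 0, π, fun i => F (i + 1)), ⟨hπ, builds_iff.2 ⟨rfl, fun i => ⟨hbuild i, fun h _ =>
    hF i h⟩⟩⟩, ?_⟩
  rintro ⟨r, π', q⟩ ⟨hπ', hb⟩
  obtain ⟨rfl, hb⟩ := builds_iff.1 hb
  simp only at hπ' hb
  have h1 : π' = π := by
    funext v
    by_cases hv : v = ω 0
    · rw [hv, hπ.1, hπ'.1]
    · obtain ⟨i, rfl, hi⟩ := exists_fresh hall hv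
      rw [(hb i).1 hi, hbuild i hi]
  have h2 : q = fun i : Fin n => F (i + 1) := by
    funext i
    obtain ⟨l, hl, hli⟩ := exists_repeat ω i
    have h3 := (hb l).2 hl (hli ▸ i.2)
    have h4 : (⟨repeats ∅ ω (l + 1), hli ▸ i.2⟩ : Fin n) = i := Fin.ext hli
    rw [h4] at h3
    rw [h3, ← hF l hl, hli]
  rw [h1, h2]

theorem Builds.starF_eq {n : ℕ} {r : Fin s} {π : Fin s → Fin s} {q : Fin n → Fin s}
    (hb : Builds r π q ω) {F : ℕ → Fin s} (hF : IsStarFather ω F) {j : ℕ} (h1 : 1 ≤ j)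
    (hj : j ≤ n) : F j = starF r q j := by
  obtain ⟨l, hl, hlj⟩ := exists_repeat ω (j - 1)
  have hlt : j - 1 < n := by omega
  have h3 := ((builds_iff.1 hb).2 l).2 hl (hlj ▸ hlt)
  have h4 := hF.2 l hl
  rw [hlj, show j - 1 + 1 = j by omega] at h4
  rw [starF, dif_pos hlt, h4, ← h3]
  congr 1
  exact Fin.ext hlj

/-- The letters of `ω` as elements of `ℕ∞`. -/
def letters (ω : ℕ → Fin s) (n : ℕ) : ℕ∞ := ((ω n : ℕ) : ℕ∞)

theorem abVertex_letters (n : ℕ) : abVertex (letters ω) n = .V (ω n) := by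
  simp [abVertex, letters]

theorem ofEdgeSet_insert_verts {α : Type} (e : Sym2 α) (E : Set (Sym2 α)) :
    (Multigraph.ofEdgeSet (insert e E)).verts = {v | v ∈ e} ∪ (Multigraph.ofEdgeSet E).verts := by
  ext v
  simp [Multigraph.ofEdgeSet]

/-- The edge added to the tree after the letter `ω n`. -/
def newEdge (ω : ℕ → Fin s) (n : ℕ) : Sym2 Vertex :=
  if ω (n + 1) ∉ visited ∅ ω (n + 1) then s(.V (ω n), .V (ω (n + 1)))
  else s(.V (ω n), .star (repeats ∅ ω (n + 1) + 1))

/-- The two statements go together because the next edge is chosen by inspecting the present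
vertices. The stars present are `0, …, repeats`, so the next one has index `repeats + 1`. The edge
set number `n` has used the letters `0, …, n`, hence the argument `n + 1`. -/
theorem abEdges_letters_verts (n : ℕ) : (Multigraph.ofEdgeSet (abEdges (letters ω) n)).verts =
      {v | (∃ i ∈ visited ∅ ω (n + 1), v = .V i) ∨ ∃ j ≤ repeats ∅ ω (n + 1), v = .star j} ∧
    abEdges (letters ω) (n + 1) = insert (newEdge ω n) (abEdges (letters ω) n) := by
  have hstep : ∀ n, (Multigraph.ofEdgeSet (abEdges (letters ω) n)).verts =
      {v | (∃ i ∈ visited ∅ ω (n + 1), v = .V i) ∨ ∃ j ≤ repeats ∅ ω (n + 1), v = .star j} →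
      abEdges (letters ω) (n + 1) = insert (newEdge ω n) (abEdges (letters ω) n) := by
    intro n hn
    rw [abEdges, newEdge, hn, abVertex_letters, abVertex_letters]
    congr 1
    have h1 : (Vertex.V (ω (n + 1)) ∉ {v | (∃ i ∈ visited ∅ ω (n + 1), v = .V i) ∨
        ∃ j ≤ repeats ∅ ω (n + 1), v = .star j}) ↔ ω (n + 1) ∉ visited ∅ ω (n + 1) := by
      simp [Fin.val_inj]
    have h2 : sInf {j | Vertex.star j ∉ {v | (∃ i ∈ visited ∅ ω (n + 1), v = Vertex.V i) ∨
        ∃ j ≤ repeats ∅ ω (n + 1), v = .star j}} = repeats ∅ ω (n + 1) + 1 := by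
      have : {j | Vertex.star j ∉ {v | (∃ i ∈ visited ∅ ω (n + 1), v = Vertex.V i) ∨
          ∃ j ≤ repeats ∅ ω (n + 1), v = .star j}} = Set.Ici (repeats ∅ ω (n + 1) + 1) := by
        ext j
        simp
      rw [this, csInf_Ici]
    rw [h2]
    by_cases h : ω (n + 1) ∉ visited ∅ ω (n + 1)
    · rw [if_pos h, if_pos (h1.2 h)]
    · rw [if_neg h, if_neg (fun h' => h (h1.1 h'))]
  have hverts : ∀ n, (Multigraph.ofEdgeSet (abEdges (letters ω) n)).verts =
      {v | (∃ i ∈ visited ∅ ω (n + 1), v = .V i) ∨ ∃ j ≤ repeats ∅ ω (n + 1), v = .star j} := by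
    intro n
    induction n with
    | zero =>
      rw [abEdges, abVertex_letters]
      ext v
      have h1 : visited ∅ ω 1 = {ω 0} := by simp [visited]
      have h2 : repeats ∅ ω 1 = 0 := by simp [repeats, visited]
      simp [Multigraph.ofEdgeSet, h1, h2]
      tauto
    | succ n ih =>
      rw [hstep n ih, ofEdgeSet_insert_verts, ih, visited_succ (n + 1), repeats_succ (n + 1)]
      have hn : ω n ∈ visited ∅ ω (n + 1) := mem_visited_empty.2 ⟨n, by omega, rfl⟩
      ext v
      simp only [newEdge, mem_union, mem_ofPred_eq, Finset.mem_insert]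
      by_cases h : ω (n + 1) ∈ visited ∅ ω (n + 1)
      · simp only [h, not_true_eq_false, if_false, if_true, Sym2.mem_iff]
        constructor
        · rintro ((rfl | rfl) | (⟨i, hi, rfl⟩ | ⟨j, hj, rfl⟩))
          · exact .inl ⟨_, .inr hn, rfl⟩
          · exact .inr ⟨_, le_rfl, rfl⟩
          · exact .inl ⟨i, .inr hi, rfl⟩
          · exact .inr ⟨j, by omega, rfl⟩
        · rintro (⟨i, rfl | hi, rfl⟩ | ⟨j, hj, rfl⟩)
          · exact .inr (.inl ⟨_, h, rfl⟩)
          · exact .inr (.inl ⟨i, hi, rfl⟩)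
          · rcases Nat.le_succ_iff.1 hj with hj | rfl
            · exact .inr (.inr ⟨j, hj, rfl⟩)
            · exact .inl (.inr rfl)
      · simp only [h, not_false_eq_true, if_true, if_false, Sym2.mem_iff, add_zero]
        constructor
        · rintro ((rfl | rfl) | (⟨i, hi, rfl⟩ | ⟨j, hj, rfl⟩))
          · exact .inl ⟨_, .inr hn, rfl⟩
          · exact .inl ⟨_, .inl rfl, rfl⟩
          · exact .inl ⟨i, .inr hi, rfl⟩
          · exact .inr ⟨j, hj, rfl⟩
        · rintro (⟨i, rfl | hi, rfl⟩ | ⟨j, hj, rfl⟩)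
          · exact .inl (.inr rfl)
          · exact .inr (.inl ⟨i, hi, rfl⟩)
          · exact .inr (.inr ⟨j, hj, rfl⟩)
  exact ⟨hverts n, hstep n (hverts n)⟩

theorem mem_iUnion_abEdges_letters {e : Sym2 Vertex} : e ∈ ⋃ n, abEdges (letters ω) n ↔
    e = s(.star 0, .V (ω 0)) ∨ ∃ n, e = newEdge ω n := by
  have key : ∀ n, e ∈ abEdges (letters ω) n ↔
      e = s(.star 0, .V (ω 0)) ∨ ∃ i < n, e = newEdge ω i := by
    intro n
    induction n with
    | zero => simp [abEdges, abVertex_letters]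
    | succ n ih =>
      rw [(abEdges_letters_verts n).2, mem_insert_iff, ih]
      constructor
      · rintro (rfl | h | ⟨i, hi, rfl⟩)
        exacts [.inr ⟨n, by omega, rfl⟩, .inl h, .inr ⟨i, by omega, rfl⟩]
      · rintro (h | ⟨i, hi, rfl⟩)
        · exact .inr (.inl h)
        · rcases Nat.lt_succ_iff_lt_or_eq.1 hi with hi | rfl
          exacts [.inr (.inr ⟨i, hi, rfl⟩), .inl rfl]
  simp only [mem_iUnion, key]
  constructor
  · rintro ⟨n, h | ⟨i, -, h⟩⟩
    exacts [.inl h, .inr ⟨i, h⟩]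
  · rintro (h | ⟨i, h⟩)
    exacts [⟨0, .inl h⟩, ⟨i + 1, .inr ⟨i, by omega, h⟩⟩]

/-- Every vertex other than the root has one fresh visit and every star one repetition, so parent
edges and star edges exhaust the tree. Infinitely many repetitions occur, hence all stars are
present. -/
theorem abTree_letters (hall : ∀ v, ∃ n, ω n = v) {π : Fin s → Fin s} (hπ : IsRooted (ω 0) π)
    (hbuild : ∀ n, ω (n + 1) ∉ visited ∅ ω (n + 1) → π (ω (n + 1)) = ω n) {F : ℕ → Fin s}
    (hF : IsStarFather ω F) : abTree (letters ω) = starred (treeM (ω 0) π) F Set.univ := by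
  classical
  have hmem : ∀ e, e ∈ ⋃ n, abEdges (letters ω) n ↔
      (∃ v, v ≠ ω 0 ∧ e = vEdge s(v, π v)) ∨ ∃ j, e = s(.V (F j), .star j) := by
    intro e
    rw [mem_iUnion_abEdges_letters]
    constructor
    · rintro (rfl | ⟨n, rfl⟩)
      · exact .inr ⟨0, by rw [hF.1, Sym2.eq_swap]⟩
      · rw [newEdge]
        split_ifs with h
        · exact .inr ⟨_, by rw [hF.2 n h]⟩
        · have h0 : ω (n + 1) ≠ ω 0 := fun h' => h (mem_visited_empty.2 ⟨0, by omega, h'.symm⟩)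
          exact .inl ⟨_, h0, by rw [hbuild n h, vEdge_mk, Sym2.eq_swap]⟩
    · rintro (⟨v, hv, rfl⟩ | ⟨j, rfl⟩)
      · obtain ⟨n, rfl, hn⟩ := exists_fresh hall hv
        exact .inr ⟨n, by rw [newEdge, if_pos hn, hbuild n hn, vEdge_mk, Sym2.eq_swap]⟩
      · rcases j with _ | j
        · exact .inl (by rw [hF.1, Sym2.eq_swap])
        · obtain ⟨n, hn, hj⟩ := exists_repeat ω j
          exact .inr ⟨n, by rw [newEdge, if_neg (not_not.2 hn), ← hF.2 n hn, hj]⟩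
  refine Multigraph.ext ?_ ?_
  · ext v
    simp only [abTree, Multigraph.ofEdgeSet, starred, hmem, mem_ofPred_eq, image_univ, mem_union]
    constructor
    · rintro ⟨e, ⟨u, hu, rfl⟩ | ⟨j, rfl⟩, hv⟩
      · exact .inl (mem_range_V_of_mem_vEdge hv)
      · rcases Sym2.mem_iff.1 hv with rfl | rfl
        exacts [.inl ⟨F j, rfl⟩, .inr ⟨j, rfl⟩]
    · rintro (⟨i, rfl⟩ | ⟨j, rfl⟩)
      · by_cases hi : i = ω 0
        · exact ⟨_, .inr ⟨0, rfl⟩, by simp [hi, hF.1]⟩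
        · exact ⟨_, .inl ⟨i, hi, rfl⟩, by simp⟩
      · exact ⟨_, .inr ⟨j, rfl⟩, by simp⟩
  · ext e
    simp only [abTree, Multigraph.ofEdgeSet, hmem]
    rcases starred_mult_cases (treeM (ω 0) π) F Set.univ e with ⟨e', rfl⟩ | ⟨j, hj, rfl⟩ | h
    · have h2 : ¬ ∃ j, vEdge e' = s(Vertex.V (F j), Vertex.star j) := by
        rintro ⟨j, hj⟩
        exact star_notMem_vEdge e' j (hj ▸ by simp)
      simp only [h2, or_false, vEdge_inj, starred_mult_vEdge]
      have h3 := hπ.treeM_le_one e'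
      split_ifs with h
      · have := treeM_pos_iff.2 h
        omega
      · have : ¬ 0 < treeM (ω 0) π e' := fun h' => h (treeM_pos_iff.1 h')
        omega
    · rw [starred_mult_star _ _ _ hj, if_pos (.inr ⟨j, rfl⟩)]
    · rw [h, if_neg]
      rintro (⟨v, hv, rfl⟩ | ⟨j, rfl⟩)
      · rw [starred_mult_vEdge] at h
        exact (treeM_pos_iff.2 ⟨v, hv, rfl⟩ : 0 < treeM (ω 0) π s(v, π v)).ne' h
      · rw [starred_mult_star _ _ _ (mem_univ j)] at h
        omega

/-- On the event that the letters build the tree `π` with the fathers `q` of the first `2 k`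
stars, the bias and the final multigraph are functions of `π` and `q`. -/
theorem Builds.treeBias_and_final {k : ℕ} {r : Fin s} {π : Fin s → Fin s}
    {q : Fin (2 * k) → Fin s} (hb : Builds r π q ω) (hall : ∀ v, ∃ n, ω n = v)
    (hπ : IsRooted r π) :
    treeBias k (abTree (letters ω)) =
      (circM (glued (treeM r π) (starF r q) k) : ℝ≥0∞) /
        ∏ i ∈ Finset.Icc 1 k, (squareM (glued (treeM r π) (starF r q) i) : ℝ≥0∞) ∧
    (glueStars (abTree (letters ω)) k).removeVerts (Set.range Vertex.star) =
      ofMatrix (glued (treeM r π) (starF r q) k) := by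
  obtain ⟨F, hF⟩ := exists_isStarFather ω
  have hb' := builds_iff.1 hb
  obtain ⟨rfl, hb'⟩ := hb'
  have hglue : ∀ i ≤ k, glued (treeM (ω 0) π) F i = glued (treeM (ω 0) π) (starF (ω 0) q) i :=
    fun i hi => glued_congr _ fun j h1 hj => hb.starF_eq hF h1 (by omega)
  rw [abTree_letters hall hπ (fun n => (hb' n).1) hF, treeBias_starred _ _ (ω 0).pos,
    removeVerts_glueStars_starred, hglue k le_rfl]
  refine ⟨?_, rfl⟩
  congr 1
  exact Finset.prod_congr rfl fun i hi => by rw [hglue i (Finset.mem_Icc.1 hi).2]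

end Tree

/-! ## Connected multigraphs with given degrees -/

section Existence

variable {s : ℕ}

theorem degM_add_single (m : Sym2 (Fin s) → ℕ) (a b v : Fin s) :
    degM (m + Pi.single s(a, b) 1) v =
      degM m v + ((if v = a then 1 else 0) + if v = b then 1 else 0) := by
  rw [degM_add, degM_single]

/-- Leaf removal: for at least two vertices the degree sum forces a vertex of degree one. It is hung
on a vertex `u` that keeps a positive degree, unless `u` is the only one left. -/
theorem exists_tree_of_degrees (n : ℕ) (S : Finset (Fin s)) (hS : S.card = n + 1)
    (d : Fin s → ℕ) (hd : 1 ≤ n → ∀ i ∈ S, 1 ≤ d i) (hsum : ∑ i ∈ S, d i = 2 * n) :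
    ∃ m : Sym2 (Fin s) → ℕ, (∀ i ∈ S, degM m i = d i) ∧ (∀ i ∉ S, degM m i = 0) ∧
      ∀ u ∈ S, ∀ v ∈ S, Relation.ReflTransGen (fun a b => 0 < m s(a, b)) u v := by
  induction n generalizing S d with
  | zero =>
    obtain ⟨x, rfl⟩ := Finset.card_eq_one.1 hS
    refine ⟨0, ?_, fun i _ => by simp [degM], ?_⟩
    · simpa [degM] using hsum.symm
    · simp [Relation.ReflTransGen.refl]
  | succ n ih =>
    have hd := hd (by omega)
    obtain ⟨v, hv, hdv⟩ : ∃ v ∈ S, d v < 2 := by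
      refine Finset.exists_lt_of_sum_lt ?_
      rw [Finset.sum_const, hS, smul_eq_mul]
      omega
    have hdv : d v = 1 := le_antisymm (by omega) (hd v hv)
    have hcard : (S.erase v).card = n + 1 := by rw [Finset.card_erase_of_mem hv]; omega
    have hsum' : ∑ i ∈ S.erase v, d i = 2 * n + 1 := by
      have := Finset.add_sum_erase S d hv
      omega
    obtain ⟨u, hu, hdu⟩ : ∃ u ∈ S.erase v, 1 ≤ n → 1 < d u := by
      rcases Nat.eq_zero_or_pos n with rfl | hn
      · obtain ⟨u, hu⟩ := Finset.card_pos.1 (by omega : 0 < (S.erase v).card)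
        exact ⟨u, hu, by omega⟩
      · obtain ⟨u, hu, h⟩ : ∃ u ∈ S.erase v, 1 < d u := by
          refine Finset.exists_lt_of_sum_lt ?_
          rw [Finset.sum_const, hcard, smul_eq_mul]
          omega
        exact ⟨u, hu, fun _ => h⟩
    have hu1 := hd u (Finset.mem_of_mem_erase hu)
    set d' : Fin s → ℕ := fun i => d i - if i = u then 1 else 0 with hd'
    have hdd' : ∀ i, d i = d' i + if i = u then 1 else 0 := by
      intro i
      simp only [hd']
      split_ifs with h
      · subst h
        omega
      · omega
    have huv : u ≠ v := Finset.ne_of_mem_erase hu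
    obtain ⟨m, hm1, hm2, hm3⟩ := ih (S.erase v) hcard d' (by
      intro hn i hi
      have := hd i (Finset.mem_of_mem_erase hi)
      simp only [hd']
      split_ifs with h
      · subst h
        have := hdu hn
        omega
      · omega) (by
      have h1 : ∑ i ∈ S.erase v, d i = ∑ i ∈ S.erase v, (d' i + if i = u then 1 else 0) :=
        Finset.sum_congr rfl fun i _ => hdd' i
      rw [Finset.sum_add_distrib, Finset.sum_ite_eq' (S.erase v) u, if_pos hu] at h1
      omega)
    refine ⟨m + Pi.single s(u, v) 1, ?_, ?_, ?_⟩
    · intro i hi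
      rw [degM_add_single]
      by_cases hiv : i = v
      · subst hiv
        rw [hm2 i (by simp), hdv]
        simp [huv.symm]
      · rw [hm1 i (Finset.mem_erase.2 ⟨hiv, hi⟩), hdd' i]
        simp [hiv]
    · intro i hi
      have hiu : i ≠ u := fun h => hi (h ▸ Finset.mem_of_mem_erase hu)
      have hiv : i ≠ v := fun h => hi (h ▸ hv)
      rw [degM_add_single, hm2 i (fun h => hi (Finset.mem_of_mem_erase h))]
      simp [hiu, hiv]
    · set R : Fin s → Fin s → Prop :=
        fun a b => 0 < (m + Pi.single s(u, v) 1 : Sym2 (Fin s) → ℕ) s(a, b)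
      have hR : Std.Symm R := ⟨fun a b h => by simpa only [R, Sym2.eq_swap] using h⟩
      have hmono : ∀ a b, Relation.ReflTransGen (fun a b => 0 < m s(a, b)) a b →
          Relation.ReflTransGen R a b :=
        Relation.ReflTransGen.mono fun a b h => by
          simp only [R, Pi.add_apply]
          omega
      have hto : ∀ a ∈ S, Relation.ReflTransGen R a u := by
        intro a ha
        by_cases hav : a = v
        · subst hav
          exact .single (by simp [R, Sym2.eq_swap])
        · exact hmono _ _ (hm3 a (Finset.mem_erase.2 ⟨hav, ha⟩) u hu)
      exact fun a ha b hb => (hto a ha).trans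
        ((@Relation.ReflTransGen.stdSymm _ R hR).symm _ _ (hto b hb))

/-- Two units of degree are taken off one after the other and restored by one edge, a loop if both
come from the same vertex. For `s ≥ 2` the degree sum exceeds `s` at each removal, so some degree
can be lowered and stay positive. -/
theorem exists_connM_of_degrees (hs : 0 < s) (k : ℕ) (d : Fin s → ℕ)
    (hd : 2 ≤ s → ∀ i, 1 ≤ d i) (hsum : ∑ i, d i + 2 = 2 * s + 2 * k) :
    ∃ m : Sym2 (Fin s) → ℕ, ConnM m ∧ ∀ i, degM m i = d i := by
  induction k generalizing d with
  | zero =>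
    obtain ⟨m, h1, -, h3⟩ := exists_tree_of_degrees (s - 1) Finset.univ (by simp; omega) d
      (fun h i _ => hd (by omega) i) (by omega)
    exact ⟨m, fun u v => h3 u (Finset.mem_univ u) v (Finset.mem_univ v),
      fun i => h1 i (Finset.mem_univ i)⟩
  | succ k ih =>
    have step : ∀ d : Fin s → ℕ, (2 ≤ s → ∀ i, 1 ≤ d i) → (2 ≤ s → s + 1 ≤ ∑ i, d i) →
        1 ≤ ∑ i, d i → ∃ u, ∃ d' : Fin s → ℕ, (2 ≤ s → ∀ i, 1 ≤ d' i) ∧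
          (∀ i, d i = d' i + if i = u then 1 else 0) ∧ ∑ i, d i = ∑ i, d' i + 1 := by
      intro d hd hlt hpos
      obtain ⟨u, hu0, hu⟩ : ∃ u, 0 < d u ∧ (2 ≤ s → 1 < d u) := by
        by_cases hs2 : 2 ≤ s
        · obtain ⟨u, -, hu⟩ : ∃ u ∈ Finset.univ, 1 < d u := by
            refine Finset.exists_lt_of_sum_lt ?_
            simp
            exact hlt hs2
          exact ⟨u, by omega, fun _ => hu⟩
        · obtain ⟨u, -, hu⟩ := Finset.exists_ne_zero_of_sum_ne_zero (by omega : ∑ i, d i ≠ 0)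
          exact ⟨u, by omega, fun h => absurd h hs2⟩
      have hdd' : ∀ i, d i = (d i - if i = u then 1 else 0) + if i = u then 1 else 0 := by
        intro i
        split_ifs with h
        · subst h
          omega
        · omega
      refine ⟨u, fun i => d i - if i = u then 1 else 0, ?_, hdd', ?_⟩
      · intro hs2 i
        have := hd hs2 i
        simp only
        split_ifs with h
        · subst h
          have := hu hs2
          omega
        · omega
      · have h1 := Finset.sum_congr (s₁ := Finset.univ) rfl fun i _ => hdd' i
        rw [Finset.sum_add_distrib, Finset.sum_ite_eq' Finset.univ u,
          if_pos (Finset.mem_univ u)] at h1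
        exact h1
    obtain ⟨u, d₁, hd₁, hdd₁, hsum₁⟩ := step d hd (by omega) (by omega)
    obtain ⟨v, d₂, hd₂, hdd₂, hsum₂⟩ := step d₁ hd₁ (by omega) (by omega)
    obtain ⟨m, hm, hdeg⟩ := ih d₂ hd₂ (by omega)
    refine ⟨m + Pi.single s(u, v) 1, hm.mono fun e => by simp, fun i => ?_⟩
    rw [degM_add_single, hdeg, hdd₁, hdd₂]
    omega

end Existence

/-! ## Counting matchings -/

section Counting

/-- Passes from an identity for each partner of a given colour to one for their sum, without
division. -/
theorem sum_eq_of_forall_card_mul {X : Type*} {A : Finset X} {f : X → ℕ} {K : ℕ}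
    (h : ∀ x ∈ A, A.card * f x = K) (h0 : A = ∅ → K = 0) : ∑ x ∈ A, f x = K := by
  rcases A.eq_empty_or_nonempty with rfl | hA
  · simp [h0 rfl]
  · refine Nat.eq_of_mul_eq_mul_left (Finset.card_pos.2 hA) ?_
    rw [Finset.mul_sum, Finset.sum_congr rfl h, Finset.sum_const, smul_eq_mul]

theorem degM_eq_sum {s : ℕ} (m : Sym2 (Fin s) → ℕ) (i : Fin s) :
    degM m i = ∑ j, m s(i, j) * if i = j then 2 else 1 := by
  rw [degM, ← Finset.add_sum_erase _ _ (Finset.mem_univ i),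
    ← Finset.add_sum_erase _ (fun j => m s(i, j) * if i = j then 2 else 1) (Finset.mem_univ i),
    if_pos rfl, Finset.sum_congr (s₁ := Finset.univ.erase i) (f := fun j => m s(i, j) * _) rfl
      (fun j hj => by rw [if_neg (Finset.ne_of_mem_erase hj).symm, mul_one])]
  omega

variable {s : ℕ} {X : Type} [DecidableEq X] (c : X → Fin s)

/-- The number of elements of `H` with colour `v`. -/
def colorCount (H : Finset X) (v : Fin s) : ℕ := {x ∈ H | c x = v}.card

/-- The number of elements `x` of `H` such that `x` and `f x` have the colours `e`. -/
def edgeColorCount (H : Finset X) (f : Equiv.Perm X) (e : Sym2 (Fin s)) : ℕ :=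
  {x ∈ H | s(c x, c (f x)) = e}.card

theorem colorCount_insert {H : Finset X} {h : X} (hh : h ∉ H) (v : Fin s) :
    colorCount c (insert h H) v = colorCount c H v + if v = c h then 1 else 0 := by
  rw [colorCount, colorCount, Finset.filter_insert]
  split_ifs with h1 h2 h2
  · rw [Finset.card_insert_of_notMem (by simp [hh])]
  · exact absurd h1.symm h2
  · exact absurd h2.symm h1
  · rfl

theorem prod_factorial_add_single (n : Fin s → ℕ) (a : Fin s) :
    ∏ v, (n v + if v = a then 1 else 0)! = (n a + 1) * ∏ v, (n v)! := by
  rw [← Finset.mul_prod_erase _ _ (Finset.mem_univ a),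
    ← Finset.mul_prod_erase _ (fun v => (n v)!) (Finset.mem_univ a), if_pos rfl,
    Nat.factorial_succ, mul_assoc]
  congr 2
  exact Finset.prod_congr rfl fun v hv => by rw [if_neg (Finset.ne_of_mem_erase hv), add_zero]

theorem swap_mul_apply_of_ne {h h' x : X} {f : Equiv.Perm X} (h1 : f x ≠ h) (h2 : f x ≠ h') :
    (Equiv.swap h h' * f) x = f x := by
  rw [Equiv.Perm.mul_apply, Equiv.swap_apply_of_ne_of_ne h1 h2]

/-- The new pair is seen from both of its elements, whence the factor 2, for loops too. -/
theorem edgeColorCount_insert {H : Finset X} {h h' : X} (hne : h ≠ h') (hh : h ∉ H) (hh' : h' ∉ H)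
    {f g : Equiv.Perm X} (hfg : ∀ x ∈ H, f x = g x) (h1 : f h = h') (h2 : f h' = h)
    (e : Sym2 (Fin s)) : edgeColorCount c (insert h (insert h' H)) f e =
      edgeColorCount c H g e + 2 * (Pi.single s(c h, c h') 1 : Sym2 (Fin s) → ℕ) e := by
  have h3 : h ∉ insert h' H := by simp [hne, hh]
  simp only [edgeColorCount, Finset.card_filter]
  rw [Finset.sum_insert h3, Finset.sum_insert hh', h1, h2, Sym2.eq_swap (a := c h'),
    Finset.sum_congr rfl fun x hx => by rw [hfg x hx], Pi.single_apply]
  by_cases he : s(c h, c h') = e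
  · rw [if_pos he, if_pos he.symm]
    omega
  · rw [if_neg he, if_neg (Ne.symm he)]
    omega

variable [Fintype X]

/-- The involutions with support `H` that have twice the edge numbers `m`. -/
def involutions (H : Finset X) (m : Sym2 (Fin s) → ℕ) : Finset (Equiv.Perm X) :=
  {f | (∀ x, f (f x) = x) ∧ (∀ x, f x ≠ x ↔ x ∈ H) ∧ ∀ e, edgeColorCount c H f e = 2 * m e}

theorem swap_mul_mem_involutions {H : Finset X} {h h' : X} (hne : h ≠ h') (hh : h ∉ H)
    (hh' : h' ∉ H) {m : Sym2 (Fin s) → ℕ} {g : Equiv.Perm X} (hg : g ∈ involutions c H m) :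
    Equiv.swap h h' * g ∈
      involutions c (insert h (insert h' H)) (m + Pi.single s(c h, c h') 1) := by
  simp only [involutions, Finset.mem_filter, Finset.mem_univ, true_and] at hg ⊢
  obtain ⟨hg1, hg2, hg3⟩ := hg
  have e1 : g h = h := by by_contra h0; exact hh ((hg2 h).1 h0)
  have e2 : g h' = h' := by by_contra h0; exact hh' ((hg2 h').1 h0)
  have f1 : (Equiv.swap h h' * g) h = h' := by simp [e1]
  have f2 : (Equiv.swap h h' * g) h' = h := by simp [e2]
  have n1 : ∀ x, x ≠ h → g x ≠ h := fun x hx h0 => hx (g.injective (h0.trans e1.symm))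
  have n2 : ∀ x, x ≠ h' → g x ≠ h' := fun x hx h0 => hx (g.injective (h0.trans e2.symm))
  have f3 : ∀ x, x ≠ h → x ≠ h' → (Equiv.swap h h' * g) x = g x := fun x hx hx' =>
    swap_mul_apply_of_ne (n1 x hx) (n2 x hx')
  refine ⟨fun x => ?_, fun x => ?_, fun e => ?_⟩
  · by_cases hx : x = h
    · rw [hx, f1, f2]
    · by_cases hx' : x = h'
      · rw [hx', f2, f1]
      · rw [f3 x hx hx', f3 _ (n1 x hx) (n2 x hx'), hg1]
  · by_cases hx : x = h
    · simp [hx, f1, hne.symm]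
    · by_cases hx' : x = h'
      · simp [hx', f2, hne]
      · rw [f3 x hx hx', hg2]
        simp [hx, hx']
  · rw [edgeColorCount_insert c hne hh hh' (g := g) _ f1 f2, hg3, Pi.add_apply, mul_add]
    exact fun x hx => f3 x (fun h0 => hh (h0 ▸ hx)) (fun h0 => hh' (h0 ▸ hx))

theorem swap_mul_mem_involutions' {H : Finset X} {h h' : X} (hne : h ≠ h') (hh : h ∉ H)
    (hh' : h' ∉ H) {m : Sym2 (Fin s) → ℕ} {f : Equiv.Perm X}
    (hf : f ∈ involutions c (insert h (insert h' H)) m) (hfh : f h = h') :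
    0 < m s(c h, c h') ∧
      Equiv.swap h h' * f ∈ involutions c H (m - Pi.single s(c h, c h') 1) := by
  simp only [involutions, Finset.mem_filter, Finset.mem_univ, true_and] at hf ⊢
  obtain ⟨hf1, hf2, hf3⟩ := hf
  have hfh' : f h' = h := by rw [← hfh, hf1]
  have n1 : ∀ x, x ≠ h' → f x ≠ h := fun x hx h0 => hx (f.injective (h0.trans hfh'.symm))
  have n2 : ∀ x, x ≠ h → f x ≠ h' := fun x hx h0 => hx (f.injective (h0.trans hfh.symm))
  have g1 : (Equiv.swap h h' * f) h = h := by simp [hfh]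
  have g2 : (Equiv.swap h h' * f) h' = h' := by simp [hfh']
  have g3 : ∀ x, x ≠ h → x ≠ h' → (Equiv.swap h h' * f) x = f x := fun x hx hx' =>
    swap_mul_apply_of_ne (n1 x hx') (n2 x hx)
  have hcount : ∀ e, 2 * m e = edgeColorCount c H (Equiv.swap h h' * f) e +
      2 * (Pi.single s(c h, c h') 1 : Sym2 (Fin s) → ℕ) e := fun e => by
    rw [← hf3, edgeColorCount_insert c hne hh hh' _ hfh hfh']
    exact fun x hx => (g3 x (fun h0 => hh (h0 ▸ hx)) (fun h0 => hh' (h0 ▸ hx))).symm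
  refine ⟨?_, fun x => ?_, fun x => ?_, fun e => ?_⟩
  · have := hcount s(c h, c h')
    simp only [Pi.single_eq_same] at this
    omega
  · by_cases hx : x = h
    · rw [hx, g1, g1]
    · by_cases hx' : x = h'
      · rw [hx', g2, g2]
      · rw [g3 x hx hx', g3 _ (n1 x hx') (n2 x hx), hf1]
  · by_cases hx : x = h
    · simp [hx, hfh, hh]
    · by_cases hx' : x = h'
      · simp [hx', hfh', hh']
      · rw [g3 x hx hx', hf2]
        simp [hx, hx']
  · have := hcount e
    rw [Pi.sub_apply]
    omega

/-- Multiplication by the transposition of `h` and `h'` separates this pair, or creates it, and is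
its own inverse. -/
theorem card_involutions_filter {H : Finset X} {h h' : X} (hne : h ≠ h') (hh : h ∉ H)
    (hh' : h' ∉ H) (m : Sym2 (Fin s) → ℕ) :
    {f ∈ involutions c (insert h (insert h' H)) m | f h = h'}.card =
      if 0 < m s(c h, c h') then (involutions c H (m - Pi.single s(c h, c h') 1)).card else 0 := by
  split_ifs with hm
  · have hadd : m - Pi.single s(c h, c h') 1 + Pi.single s(c h, c h') 1 = m := by
      refine tsub_add_cancel_of_le fun e => ?_
      by_cases he : e = s(c h, c h')
      · subst he
        simp
        omega
      · simp [he]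
    refine Finset.card_nbij' (fun f => Equiv.swap h h' * f) (fun g => Equiv.swap h h' * g)
      ?_ ?_ ?_ ?_
    · intro f hf
      rw [Finset.mem_coe, Finset.mem_filter] at hf
      exact (swap_mul_mem_involutions' c hne hh hh' hf.1 hf.2).2
    · intro g hg
      have h1 := swap_mul_mem_involutions c hne hh hh' hg
      rw [hadd] at h1
      rw [Finset.mem_coe, Finset.mem_filter]
      refine ⟨h1, ?_⟩
      simp only [Finset.mem_coe, involutions, Finset.mem_filter] at hg
      have e1 : g h = h := by by_contra h0; exact hh ((hg.2.2.1 h).1 h0)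
      simp [e1]
    · intro f _
      simp [← mul_assoc]
    · intro f _
      simp [← mul_assoc]
  · rw [Finset.card_eq_zero, Finset.filter_eq_empty_iff]
    exact fun f hf hfh => hm (swap_mul_mem_involutions' c hne hh hh' hf hfh).1

/-- Induction on `H`: fix `h`, of colour `i`, and split by its partner. Removing the pair lowers `m`
by one edge, so `circM_add_single` and the induction hypothesis show that all partners of colour `j`
together contribute in proportion to `m s(i, j)`, doubled if `i = j`. These weights add up to the
degree of `i`, which is `colorCount c H i`. -/
theorem card_involutions_mul_circM (H : Finset X) (m : Sym2 (Fin s) → ℕ)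
    (hdeg : ∀ v, degM m v = colorCount c H v) :
    (involutions c H m).card * circM m = ∏ v, (colorCount c H v)! := by
  induction hn : H.card using Nat.strong_induction_on generalizing H m with
  | _ n ih =>
    rcases H.eq_empty_or_nonempty with rfl | ⟨h, hh⟩
    · have hm : m = 0 := by
        have h1 := sum_degM m
        rw [Finset.sum_eq_zero fun v _ => by rw [hdeg v]; simp [colorCount]] at h1
        have h2 : ∑ e, m e = 0 := by omega
        funext e
        exact Finset.sum_eq_zero_iff.1 h2 e (Finset.mem_univ e)
      have h1 : involutions c ∅ m = {1} := by
        ext f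
        simp only [involutions, Finset.mem_filter, Finset.mem_univ, true_and,
          Finset.mem_singleton, Finset.notMem_empty, iff_false, not_not]
        constructor
        · exact fun hf => Equiv.ext hf.2.1
        · rintro rfl
          refine ⟨fun _ => rfl, fun _ => rfl, fun e => ?_⟩
          rw [hm]
          rfl
      rw [h1, hm]
      simp [circM, colorCount]
    · set i := c h with hi
      have hterm : ∀ h' ∈ H.erase h, colorCount c H i *
          ({x ∈ H.erase h | c x = c h'}.card *
            ({f ∈ involutions c H m | f h = h'}.card * circM m)) =
          (m s(i, c h') * if i = c h' then 2 else 1) * ∏ v, (colorCount c H v)! := by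
        intro h' hh'
        have hne : h ≠ h' := (Finset.ne_of_mem_erase hh').symm
        obtain ⟨H', hH'⟩ : ∃ H', H' = (H.erase h).erase h' := ⟨_, rfl⟩
        have hH : H = insert h (insert h' H') := by
          rw [hH', Finset.insert_erase hh', Finset.insert_erase hh]
        have n1 : h ∉ H' := by simp [hH']
        have n2 : h' ∉ H' := by simp [hH']
        have n3 : h ∉ insert h' H' := by simp [hne, n1]
        have hcc : ∀ v, colorCount c H v =
            colorCount c H' v + (if v = c h' then 1 else 0) + if v = i then 1 else 0 := fun v => by
          rw [hH, colorCount_insert c n3, colorCount_insert c n2]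
        have hfib : {x ∈ H.erase h | c x = c h'}.card = colorCount c H' (c h') + 1 := by
          have : H.erase h = insert h' H' := by rw [hH', Finset.insert_erase hh']
          rw [this]
          exact (colorCount_insert c n2 (c h')).trans (by rw [if_pos rfl])
        have hprod : ∏ v, (colorCount c H v)! = colorCount c H i *
            ((colorCount c H' (c h') + 1) * ∏ v, (colorCount c H' v)!) := by
          rw [← prod_factorial_add_single, Finset.prod_congr rfl fun v _ => by rw [hcc v],
            prod_factorial_add_single, hcc i, if_pos rfl]
        rw [hfib, hprod]
        conv_lhs => rw [hH]
        rw [card_involutions_filter c hne n1 n2, ← hH]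
        by_cases hm : 0 < m s(i, c h')
        · obtain ⟨m', hm'⟩ : ∃ m', m' = m - Pi.single s(i, c h') 1 := ⟨_, rfl⟩
          have hadd : m = m' + Pi.single s(i, c h') 1 := by
            rw [hm']
            refine (tsub_add_cancel_of_le fun e => ?_).symm
            by_cases he : e = s(i, c h')
            · subst he
              simp
              omega
            · simp [he]
          have hcirc := circM_add_single m' i (c h')
          have hdeg' : ∀ v, degM m' v = colorCount c H' v := by
            intro v
            have h1 := hdeg v
            have h2 := hcc v
            rw [hadd, degM_add_single] at h1
            omega
          have hlt : H'.card < n := by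
            rw [← hn, hH, Finset.card_insert_of_notMem n3, Finset.card_insert_of_notMem n2]
            omega
          have hP := ih _ hlt H' m' hdeg' rfl
          have hms : m s(i, c h') = m' s(i, c h') + 1 := by rw [hadd]; simp
          rw [if_pos hm, ← hm', hadd, hcirc, ← hP, ← hadd, hms]
          ring
        · rw [if_neg hm, show m s(i, c h') = 0 by omega]
          simp
      have hcard : (involutions c H m).card =
          ∑ h' ∈ H.erase h, {f ∈ involutions c H m | f h = h'}.card := by
        refine Finset.card_eq_sum_card_fiberwise fun f hf => ?_
        simp only [involutions, Finset.mem_coe, Finset.mem_filter, Finset.mem_univ,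
          true_and] at hf
        have h1 := (hf.2.1 h).2 hh
        refine Finset.mem_erase.2 ⟨h1, (hf.2.1 _).1 ?_⟩
        rw [hf.1]
        exact h1.symm
      have hpos : 0 < colorCount c H i := Finset.card_pos.2 ⟨h, by simp [hh, hi]⟩
      have hcol : ∀ j, colorCount c H j =
          {x ∈ H.erase h | c x = j}.card + if j = i then 1 else 0 := by
        intro j
        conv_lhs => rw [← Finset.insert_erase hh, colorCount_insert c (Finset.notMem_erase h H)]
        rfl
      refine Nat.eq_of_mul_eq_mul_left hpos ?_
      rw [hcard, Finset.sum_mul, Finset.mul_sum, ← Finset.sum_fiberwise (g := c)]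
      have hfiber : ∀ j, ∑ h' ∈ H.erase h with c h' = j, colorCount c H i *
          ({f ∈ involutions c H m | f h = h'}.card * circM m) =
          (m s(i, j) * if i = j then 2 else 1) * ∏ v, (colorCount c H v)! := by
        intro j
        refine sum_eq_of_forall_card_mul (fun h' hh' => ?_) fun hempty => ?_
        · obtain ⟨h1, rfl⟩ := Finset.mem_filter.1 hh'
          rw [← hterm h' h1]
          ring
        -- Without a partner of colour `j`, the degree of `j` is 0, or is 1 with `j = i`. A loop
        -- counts twice, so `m s(i, j) = 0` in both cases.
        · have h1 := hcol j
          rw [hempty, Finset.card_empty, ← hdeg, degM] at h1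
          have h2 : m s(i, j) ≤ ∑ w, m s(j, w) := by
            rw [Sym2.eq_swap]
            exact Finset.single_le_sum (f := fun w => m s(j, w)) (fun _ _ => Nat.zero_le _)
              (Finset.mem_univ i)
          suffices m s(i, j) = 0 by simp [this]
          by_cases hij : j = i
          · subst hij
            rw [if_pos rfl] at h1
            omega
          · rw [if_neg hij] at h1
            omega
      rw [Finset.sum_congr rfl fun j _ => hfiber j, ← Finset.sum_mul, ← degM_eq_sum, hdeg]

end Counting

/-! ## Biased laws -/

section Biased

variable {s : ℕ}

theorem biased_map_ofMatrix (hs : 0 < s) (μ : Measure (Sym2 (Fin s) → ℕ)) :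
    biased (μ.map fun m => ofMatrix m) =
      Measure.sum fun m => (μ {m} * circM m) • Measure.dirac (ofMatrix m) := by
  have hmeas : Measurable fun m : Sym2 (Fin s) → ℕ => ofMatrix m := measurable_of_countable _
  conv_lhs => rw [← Measure.sum_smul_dirac μ, Measure.map_sum hmeas.aemeasurable]
  rw [biased, withDensity_sum]
  congr 1
  funext m
  rw [Measure.map_smul, Measure.map_dirac' hmeas, withDensity_smul_measure]
  ext B hB
  classical
  rw [Measure.smul_apply, Measure.smul_apply, withDensity_apply _ hB, restrict_dirac]
  by_cases hm : ofMatrix m ∈ B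
  · simp [hm, ofMatrix_circ m hs]
  · simp [hm]

/-- Common end of both parts: the biased mass on `C` is carried by `M` and equals `K * wt` there, so
normalisation removes `K`. -/
theorem hasBiasedConditionedLaw_of_finset (hs : 0 < s) (μ : Measure (Sym2 (Fin s) → ℕ))
    (C : Set (Multigraph Vertex)) (ν : Measure (Multigraph Vertex))
    (M : Finset (Sym2 (Fin s) → ℕ)) (hM : M.Nonempty) (wt : (Sym2 (Fin s) → ℕ) → ℝ≥0∞)
    (hwt0 : ∀ m ∈ M, wt m ≠ 0) (hwt : ∀ m ∈ M, wt m ≠ ∞) (K : ℝ≥0∞) (hK0 : K ≠ 0) (hK : K ≠ ∞)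
    (hC : ∀ m, ofMatrix m ∈ C → m ∉ M → μ {m} = 0)
    (hMC : ∀ m ∈ M, ofMatrix m ∈ C ∧ μ {m} * circM m = K * wt m)
    (hν : ∀ B, MeasurableSet B →
      ν B = (∑ m ∈ M, wt m)⁻¹ * ∑ m ∈ M, wt m * B.indicator 1 (ofMatrix m)) :
    HasBiasedConditionedLaw (μ.map fun m => ofMatrix m) C ν := by
  have key : ∀ B, biased (μ.map fun m => ofMatrix m) (B ∩ C) =
      K * ∑ m ∈ M, wt m * B.indicator 1 (ofMatrix m) := by
    intro B
    rw [biased_map_ofMatrix hs, Measure.sum_apply_of_countable, tsum_eq_sum (s := M)]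
    · rw [Finset.mul_sum]
      refine Finset.sum_congr rfl fun m hm => ?_
      obtain ⟨h1, h2⟩ := hMC m hm
      rw [Measure.smul_apply, Measure.dirac_apply, smul_eq_mul, h2, mul_assoc]
      by_cases hB : ofMatrix m ∈ B <;> simp [hB, h1]
    · intro m hm
      rw [Measure.smul_apply, Measure.dirac_apply, smul_eq_mul]
      by_cases hmC : ofMatrix m ∈ C
      · simp [hC m hmC hm]
      · simp [hmC]
  have hmass : biased (μ.map fun m => ofMatrix m) C = K * ∑ m ∈ M, wt m := by
    simpa using key Set.univ
  have h0 : ∑ m ∈ M, wt m ≠ 0 := by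
    obtain ⟨m, hm⟩ := hM
    exact fun h => hwt0 m hm (Finset.sum_eq_zero_iff.1 h m hm)
  refine ⟨?_, ?_, ?_⟩
  · rw [hmass]
    exact pos_iff_ne_zero.2 (mul_ne_zero hK0 h0)
  · rw [hmass]
    exact ENNReal.mul_lt_top hK.lt_top (ENNReal.sum_lt_top.2 fun m hm => (hwt m hm).lt_top)
  · ext B hB
    rw [ProbabilityTheory.cond, Measure.smul_apply, Measure.restrict_apply hB, key, hmass, smul_eq_mul, hν B hB,
      ENNReal.mul_inv (.inl hK0) (.inl hK), mul_mul_mul_comm, ENNReal.inv_mul_cancel hK0 hK,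
      one_mul]

end Biased

/-! ## The configuration model -/

section ConfigurationModel

variable {s : ℕ} {d : Fin s → ℕ}

instance : Finite (Matching d) := by
  unfold Matching
  infer_instance

/-- A matching as a permutation of the half-edges. -/
def Matching.toPerm (f : Matching d) : Equiv.Perm (HalfEdge d) :=
  Function.Involutive.toPerm f.1 f.2.1

theorem card_eq_matchCount (f : Matching d) (i j : Fin s) :
    {x : HalfEdge d | x.1 = i ∧ (f.1 x).1 = j}.ncard = matchCount f i j := by
  rw [matchCount_eq]
  rfl

/-- The matching restricts to a fixed-point-free involution of these half-edges, so they cancel in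
pairs modulo 2. Hence the halving in `cmMatrix` is exact. -/
theorem even_matchCount_self (f : Matching d) (i : Fin s) : Even (matchCount f i i) := by
  classical
  rw [← card_eq_matchCount, Set.ncard_eq_toFinset_card', ← ZMod.natCast_eq_zero_iff_even,
    Finset.card_eq_sum_ones, Nat.cast_sum]
  refine Finset.sum_involution (fun x _ => f.1 x) ?_ ?_ ?_ ?_
  · intro x _
    decide
  · intro x _ _
    exact f.2.2 x
  · intro x hx
    simp only [Set.mem_toFinset, mem_ofPred_eq] at hx ⊢
    rw [f.2.1]
    exact hx.symm
  · intro x _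
    exact f.2.1 x

theorem edgeColorCount_toPerm (f : Matching d) (e : Sym2 (Fin s)) :
    edgeColorCount Sigma.fst Finset.univ f.toPerm e = 2 * cmMatrix f e := by
  classical
  induction e with
  | _ i j =>
    have hset : ∀ i j, {x : HalfEdge d | x.1 = i ∧ (f.1 x).1 = j}.ncard =
        ({x | x.1 = i ∧ (f.1 x).1 = j} : Finset (HalfEdge d)).card := fun i j => by
      rw [Set.ncard_eq_toFinset_card']
      congr 1
      ext x
      simp
    change ({x | s(x.1, (f.1 x).1) = s(i, j)} : Finset (HalfEdge d)).card =
      2 * (if i = j then matchCount f i i / 2 else matchCount f i j)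
    split_ifs with hij
    · subst hij
      rw [Nat.mul_div_cancel' (even_matchCount_self f i).two_dvd, ← card_eq_matchCount, hset]
      congr 1
      ext x
      simp
    · rw [two_mul]
      conv_rhs =>
        arg 2
        rw [matchCount_comm]
      rw [← card_eq_matchCount, ← card_eq_matchCount, hset, hset,
        ← Finset.card_union_of_disjoint]
      · congr 1
        ext x
        simp
      · rw [Finset.disjoint_filter]
        rintro x - ⟨h1, -⟩ ⟨h2, -⟩
        exact hij (h1.symm.trans h2)

theorem degM_cmMatrix (f : Matching d) (i : Fin s) : degM (cmMatrix f) i = d i := by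
  classical
  have h1 : ∀ j, cmMatrix f s(i, j) * (if i = j then 2 else 1) = matchCount f i j := by
    intro j
    change (if i = j then matchCount f i i / 2 else matchCount f i j) * _ = _
    split_ifs with hij
    · subst hij
      exact Nat.div_mul_cancel (even_matchCount_self f i).two_dvd
    · rw [mul_one]
  have h2 : degM (cmMatrix f) i = ∑ j, matchCount f i j := by
    rw [degM_eq_sum]
    exact Finset.sum_congr rfl fun j _ => h1 j
  rw [h2]
  simp only [matchCount]
  rw [Finset.sum_comm]
  simp

/-- Matchings are involutions with full support, and a half-edge is coloured by its vertex. -/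
theorem card_matchings_mul_circM (m : Sym2 (Fin s) → ℕ) (hm : ∀ i, degM m i = d i) :
    {f : Matching d | cmMatrix f = m}.ncard * circM m = ∏ i, (d i)! := by
  classical
  have hcolor : ∀ i, colorCount Sigma.fst (Finset.univ : Finset (HalfEdge d)) i = d i := by
    intro i
    rw [colorCount, Finset.card_filter, Fintype.sum_sigma, Finset.sum_eq_single i]
    · simp
    · intro j _ hj
      simp [hj]
    · simp
  have h := card_involutions_mul_circM Sigma.fst (Finset.univ : Finset (HalfEdge d)) m
    fun v => by rw [hcolor, hm]
  simp only [hcolor] at h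
  rw [← h]
  congr 1
  rw [← Set.ncard_coe_finset]
  refine Set.ncard_congr (fun f _ => f.toPerm) ?_ ?_ ?_
  · rintro f rfl
    simp only [involutions, Finset.coe_filter, Finset.mem_univ, true_and, mem_ofPred_eq]
    exact ⟨f.2.1, fun x => iff_of_true (f.2.2 x) trivial, edgeColorCount_toPerm f⟩
  · intro f g _ _ hfg
    exact Subtype.ext (funext fun x => DFunLike.congr_fun hfg x)
  · intro g hg
    simp only [involutions, Finset.coe_filter, Finset.mem_univ, true_and, mem_ofPred_eq,
      iff_true] at hg
    refine ⟨⟨g, hg.1, hg.2.1⟩, ?_, Equiv.ext fun x => rfl⟩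
    funext e
    have h1 := edgeColorCount_toPerm (d := d) ⟨g, hg.1, hg.2.1⟩ e
    have h2 := hg.2.2 e
    have h3 : Matching.toPerm (d := d) ⟨g, hg.1, hg.2.1⟩ = g := Equiv.ext fun x => rfl
    rw [h3] at h1
    omega

open Classical in
/-- The connected matrices of edge numbers with degrees `d`, for `N` large enough. -/
def connWithDegrees (d : Fin s → ℕ) : Finset (Sym2 (Fin s) → ℕ) :=
  {m ∈ Fintype.piFinset fun _ => Finset.range (∑ i, d i + 1) | ConnM m ∧ ∀ i, degM m i = d i}

theorem mem_connWithDegrees {m : Sym2 (Fin s) → ℕ} :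
    m ∈ connWithDegrees d ↔ ConnM m ∧ ∀ i, degM m i = d i := by
  classical
  rw [connWithDegrees, Finset.mem_filter, and_iff_right_iff_imp]
  rintro ⟨-, h⟩
  rw [Fintype.mem_piFinset]
  intro e
  have h1 := sum_degM m
  have h2 := Finset.single_le_sum (f := m) (fun _ _ => Nat.zero_le _) (Finset.mem_univ e)
  have h3 : ∑ i, d i = ∑ i, degM m i := Finset.sum_congr rfl fun i _ => (h i).symm
  rw [Finset.mem_range]
  omega

/-- The surplus condition is implied by the degrees, whose sum is twice the number of edges. -/
theorem dkGraphs_eq (hs : 0 < s) (k : ℕ) (hsum : ((∑ i, d i : ℕ) : ℤ) = 2 * s + 2 * k - 2) :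
    dkGraphs (fun i => (d i : ℤ) - 1) k = (fun m => ofMatrix m) '' (connWithDegrees d : Set (Sym2 (Fin s) → ℕ)) := by
  ext G
  constructor
  · rintro ⟨hverts, hconn, hdeg, -⟩
    obtain ⟨m, rfl⟩ := exists_ofMatrix_eq G hverts
    refine ⟨m, mem_connWithDegrees.2 ⟨(ofMatrix_connected_iff m hs).1 hconn, fun i => ?_⟩, rfl⟩
    have := hdeg i
    rw [ofMatrix_degree] at this
    simp only at this
    omega
  · rintro ⟨m, hm, rfl⟩
    obtain ⟨h1, h2⟩ := mem_connWithDegrees.1 hm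
    refine ⟨rfl, (ofMatrix_connected_iff m hs).2 h1, fun i => ?_, ?_⟩
    · rw [ofMatrix_degree, h2]
      ring
    · have h3 := sum_degM m
      have h4 : ∑ i, d i = ∑ i, degM m i := Finset.sum_congr rfl fun i _ => (h2 i).symm
      rw [ofMatrix_surplus]
      omega

theorem cm_hasBiasedConditionedLaw (hs : 0 < s) (hd : 2 ≤ s → ∀ i, 1 ≤ d i) (k : ℕ)
    (hsum : ((∑ i, d i : ℕ) : ℤ) = 2 * s + 2 * k - 2) :
    HasBiasedConditionedLaw (cmLaw d) {G | G.Connected} (dkLaw (fun i => (d i : ℤ) - 1) k) := by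
  classical
  have hfin : Fintype (Matching d) := Fintype.ofFinite _
  have hlaw : cmLaw d = ((uniformOn (Set.univ : Set (Matching d))).map fun f => cmMatrix f).map
      fun m => ofMatrix m := by
    rw [Measure.map_map (measurable_of_countable _) measurable_from_top]
    rfl
  have hsingle : ∀ m, (uniformOn (Set.univ : Set (Matching d))).map (fun f => cmMatrix f) {m} =
      ({f : Matching d | cmMatrix f = m}.ncard : ℝ≥0∞) / Fintype.card (Matching d) := by
    intro m
    rw [Measure.map_apply measurable_from_top (measurableSet_singleton m), uniformOn_univ,
      Measure.count_apply MeasurableSpace.measurableSet_top,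
      ← (Set.toFinite _).cast_ncard_eq]
    rfl
  obtain ⟨m₀, hm₀⟩ : ∃ m, m ∈ connWithDegrees d := by
    obtain ⟨m, h⟩ := exists_connM_of_degrees hs k d hd (by omega)
    exact ⟨m, mem_connWithDegrees.2 h⟩
  -- The number of matchings over `m₀`, times `circM m₀`, is `∏ d_i! > 0`, so matchings exist.
  have hcard0 : Fintype.card (Matching d) ≠ 0 := by
    have h1 := card_matchings_mul_circM m₀ (mem_connWithDegrees.1 hm₀).2
    intro h0
    have : IsEmpty (Matching d) := Fintype.card_eq_zero_iff.1 h0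
    rw [Set.eq_empty_of_isEmpty {f : Matching d | cmMatrix f = m₀}, Set.ncard_empty, zero_mul] at h1
    exact (Finset.prod_pos fun i _ => Nat.factorial_pos (d i)).ne h1
  rw [hlaw]
  refine hasBiasedConditionedLaw_of_finset hs _ _ _ (connWithDegrees d) ⟨m₀, hm₀⟩ (fun _ => 1)
    (by simp) (by simp) ((∏ i, (d i)! : ℕ) / Fintype.card (Matching d) : ℝ≥0∞) ?_ ?_ ?_ ?_ ?_
  · refine ENNReal.div_ne_zero.2 ⟨?_, ENNReal.natCast_ne_top _⟩
    exact_mod_cast (Finset.prod_pos fun i _ => Nat.factorial_pos (d i)).ne'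
  · exact ENNReal.div_ne_top (ENNReal.natCast_ne_top _) (by exact_mod_cast hcard0)
  · intro m hm hm'
    rw [hsingle, Set.eq_empty_iff_forall_notMem (s := {f | cmMatrix f = m}) |>.2, Set.ncard_empty, Nat.cast_zero,
      ENNReal.zero_div]
    rintro f rfl
    exact hm' (mem_connWithDegrees.2 ⟨(ofMatrix_connected_iff _ hs).1 hm, degM_cmMatrix f⟩)
  · intro m hm
    obtain ⟨h1, h2⟩ := mem_connWithDegrees.1 hm
    refine ⟨(ofMatrix_connected_iff m hs).2 h1, ?_⟩
    rw [hsingle, mul_one, ← card_matchings_mul_circM m h2, Nat.cast_mul, ENNReal.mul_div_right_comm]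
  · intro B hB
    have hcount : ∀ A : Finset (Sym2 (Fin s) → ℕ), Measure.count
        ((fun m => ofMatrix m) '' (A : Set (Sym2 (Fin s) → ℕ))) = (A.card : ℝ≥0∞) := fun A => by
      rw [← Finset.coe_image, Measure.count_apply_finset,
        Finset.card_image_of_injective _ ofMatrix_injective]
    have hinter : (fun m => ofMatrix m) '' (connWithDegrees d : Set (Sym2 (Fin s) → ℕ)) ∩ B =
        (fun m => ofMatrix m) '' (({m ∈ connWithDegrees d | ofMatrix m ∈ B} : Finset _) :
          Set (Sym2 (Fin s) → ℕ)) := by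
      ext G
      simp only [mem_inter_iff, mem_image, Finset.mem_coe, Finset.mem_filter]
      constructor
      · rintro ⟨⟨m, hm, rfl⟩, hB⟩
        exact ⟨m, ⟨hm, hB⟩, rfl⟩
      · rintro ⟨m, ⟨hm, hB⟩, rfl⟩
        exact ⟨⟨m, hm, rfl⟩, hB⟩
    rw [dkLaw, dkGraphs_eq hs k hsum, uniformOn, cond_apply
      ((Finset.finite_toSet _).image _).measurableSet, hinter, hcount, hcount, Finset.card_filter]
    congr 1
    · simp
    · rw [Nat.cast_sum]
      refine Finset.sum_congr rfl fun m _ => ?_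
      by_cases hm : ofMatrix m ∈ B <;> simp [hm]

end ConfigurationModel

/-! ## Degree weights -/

section Weights

variable {s : ℕ}

theorem matrix_induction {Q : (Sym2 (Fin s) → ℕ) → Prop} (h0 : Q 0)
    (hadd : ∀ m a b, Q m → Q (m + Pi.single s(a, b) 1)) (m : Sym2 (Fin s) → ℕ) : Q m := by
  classical
  induction hn : ∑ e, m e generalizing m with
  | zero =>
    have : m = 0 := funext fun e => Finset.sum_eq_zero_iff.1 hn e (Finset.mem_univ e)
    rwa [this]
  | succ n ih =>
    obtain ⟨e, -, he⟩ := Finset.exists_ne_zero_of_sum_ne_zero (by omega : ∑ e, m e ≠ 0)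
    have hm : m = (m - Pi.single e 1) + Pi.single e 1 := by
      refine (tsub_add_cancel_of_le fun e' => ?_).symm
      by_cases h : e' = e
      · subst h
        simp
        omega
      · simp [h]
    induction e with
    | _ a b =>
      rw [hm]
      refine hadd _ a b (ih _ ?_)
      have : ∑ e, m e = ∑ e, (m - Pi.single s(a, b) 1 : Sym2 (Fin s) → ℕ) e + 1 := by
        conv_lhs => rw [hm]
        simp only [Pi.add_apply, Finset.sum_add_distrib, Finset.sum_pi_single',
          Finset.mem_univ, if_true]
      omega

/-- The product of `p v ^ deg v`. -/
def degWeight {R : Type*} [CommMonoid R] (p : Fin s → R) (m : Sym2 (Fin s) → ℕ) : R :=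
  ∏ v, p v ^ degM m v

theorem degWeight_add {R : Type*} [CommMonoid R] (p : Fin s → R) (m m' : Sym2 (Fin s) → ℕ) :
    degWeight p (m + m') = degWeight p m * degWeight p m' := by
  simp only [degWeight, degM_add, pow_add, Finset.prod_mul_distrib]

theorem degWeight_single {R : Type*} [CommMonoid R] (p : Fin s → R) (a b : Fin s) :
    degWeight p (Pi.single s(a, b) 1) = p a * p b := by
  simp only [degWeight, degM_single, pow_add, Finset.prod_mul_distrib]
  simp

theorem degWeight_zero {R : Type*} [CommMonoid R] (p : Fin s → R) :
    degWeight p (0 : Sym2 (Fin s) → ℕ) = 1 := by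
  simp [degWeight, degM]

theorem degWeight_sum_single {R ι : Type*} [CommMonoid R] (p : Fin s → R) (S : Finset ι)
    (f g : ι → Fin s) :
    degWeight p (∑ i ∈ S, Pi.single s(f i, g i) 1) = ∏ i ∈ S, p (f i) * p (g i) := by
  classical
  induction S using Finset.induction_on with
  | empty => simp [degWeight_zero]
  | insert a S ha ih =>
    rw [Finset.sum_insert ha, Finset.prod_insert ha, degWeight_add, degWeight_single, ih]

theorem prod_range_two_mul {R : Type*} [CommMonoid R] (f : ℕ → R) (k : ℕ) :
    ∏ j ∈ Finset.range k, f (2 * j) * f (2 * j + 1) = ∏ i ∈ Finset.range (2 * k), f i := by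
  induction k with
  | zero => simp
  | succ k ih =>
    rw [Finset.prod_range_succ, ih, show 2 * (k + 1) = 2 * k + 1 + 1 by ring,
      Finset.prod_range_succ, Finset.prod_range_succ, mul_assoc]

/-- The weight of a rooted tree with `k` pairs of star leaves, in terms of the degrees after
gluing. -/
theorem degWeight_glued {R : Type*} [CommMonoid R] (p : Fin s → R) {k : ℕ} (r : Fin s)
    (π : Fin s → Fin s) (q : Fin (2 * k) → Fin s) :
    p r * degWeight p (glued (treeM r π) (starF r q) k) =
      (∏ v, p v) * ((∏ v ∈ Finset.univ.erase r, p (π v)) * ∏ i, p (q i)) := by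
  have h1 : ∏ j ∈ Finset.range k, p (starF r q (2 * j + 1)) * p (starF r q (2 * j + 2)) =
      ∏ i, p (q i) := by
    rw [prod_range_two_mul (fun j => p (starF r q (j + 1))), Finset.prod_range]
    refine Finset.prod_congr rfl fun i _ => ?_
    simp [starF]
  rw [glued, degWeight_add, treeM, degWeight_sum_single, degWeight_sum_single, h1,
    Finset.prod_mul_distrib, ← Finset.mul_prod_erase _ p (Finset.mem_univ r)]
  simp only [mul_assoc]

end Weights

/-! ## Multiplicative multigraphs -/

section Multiplicative

variable {s : ℕ}

open Classical in
/-- The connected matrices of edge numbers with surplus `k`. -/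
def connWithSurplus (s k : ℕ) : Finset (Sym2 (Fin s) → ℕ) :=
  {m ∈ Fintype.piFinset fun _ => Finset.range (s + k) | ConnM m ∧ ∑ e, m e + 1 = s + k}

theorem mem_connWithSurplus {k : ℕ} {m : Sym2 (Fin s) → ℕ} :
    m ∈ connWithSurplus s k ↔ ConnM m ∧ ∑ e, m e + 1 = s + k := by
  classical
  rw [connWithSurplus, Finset.mem_filter, and_iff_right_iff_imp]
  rintro ⟨-, h⟩
  rw [Fintype.mem_piFinset]
  intro e
  have h2 := Finset.single_le_sum (f := m) (fun _ _ => Nat.zero_le _) (Finset.mem_univ e)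
  rw [Finset.mem_range]
  omega

theorem glued_mem_connWithSurplus {k : ℕ} {r : Fin s} {π : Fin s → Fin s} (hπ : IsRooted r π)
    (F : ℕ → Fin s) : glued (treeM r π) F k ∈ connWithSurplus s k := by
  refine mem_connWithSurplus.2 ⟨glued_connM hπ F k, ?_⟩
  have := sum_treeM r π
  rw [sum_glued]
  omega

theorem connWithSurplus_nonempty (hs : 0 < s) (k : ℕ) : (connWithSurplus s k).Nonempty :=
  ⟨_, glued_mem_connWithSurplus (r := ⟨0, hs⟩) (π := fun _ => ⟨0, hs⟩)
    ⟨rfl, fun v => v, fun _ hv => Nat.pos_of_ne_zero fun h => hv (Fin.ext h)⟩ fun _ => ⟨0, hs⟩⟩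

/-- The factor 2 of a loop cancels the half in its rate, so every edge `{a, b}` contributes `λ w_a
w_b`. -/
theorem prod_mgRate_pow {lam : ℝ} {w : Fin s → ℝ} (hlam : 0 < lam) (hw : ∀ i, 0 < w i)
    (m : Sym2 (Fin s) → ℕ) :
    (∏ e, (mgRate lam w e : ℝ) ^ m e) * ∏ v, 2 ^ m s(v, v) =
      lam ^ (∑ e, m e) * degWeight w m := by
  classical
  induction m using matrix_induction with
  | h0 => simp [degWeight_zero]
  | hadd m a b ih =>
    have h1 : (mgRate lam w s(a, b) : ℝ) * (if a = b then 2 else 1) = lam * (w a * w b) := by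
      change ((if a = b then (lam * w a ^ 2 / 2).toNNReal else (lam * (w a * w b)).toNNReal : ℝ≥0)
        : ℝ) * _ = _
      have ha := hw a
      have hb := hw b
      split_ifs with hab
      · subst hab
        rw [Real.coe_toNNReal _ (by positivity)]
        ring
      · rw [Real.coe_toNNReal _ (by positivity), mul_one]
    have h2 : ∏ e, (mgRate lam w e : ℝ) ^ (m + Pi.single s(a, b) 1 : Sym2 (Fin s) → ℕ) e =
        (∏ e, (mgRate lam w e : ℝ) ^ m e) * mgRate lam w s(a, b) := by
      simp only [Pi.add_apply, pow_add, Finset.prod_mul_distrib]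
      congr 1
      rw [Finset.prod_eq_single s(a, b)] <;> simp +contextual
    have h3 : ∏ v, (2 : ℝ) ^ (m + Pi.single s(a, b) 1 : Sym2 (Fin s) → ℕ) s(v, v) =
        (∏ v, 2 ^ m s(v, v)) * if a = b then 2 else 1 := by
      simp only [Pi.add_apply, pow_add, Finset.prod_mul_distrib]
      congr 1
      split_ifs with hab
      · subst hab
        rw [Finset.prod_eq_single a] <;> simp +contextual
      · refine Finset.prod_eq_one fun v _ => ?_
        rw [Pi.single_eq_of_ne, pow_zero]
        simp
        grind
    have h4 : ∑ e, (m + Pi.single s(a, b) 1 : Sym2 (Fin s) → ℕ) e = ∑ e, m e + 1 := by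
      simp only [Pi.add_apply, Finset.sum_add_distrib, Finset.sum_pi_single',
        Finset.mem_univ, if_true]
    rw [h2, h3, h4, degWeight_add, degWeight_single, pow_succ]
    calc _ = ((∏ e, (mgRate lam w e : ℝ) ^ m e) * ∏ v, 2 ^ m s(v, v)) *
          ((mgRate lam w s(a, b) : ℝ) * (if a = b then 2 else 1)) := by ring
      _ = _ := by rw [ih, h1]; ring

theorem degWeight_mul_left (c : ℝ) (p : Fin s → ℝ) (m : Sym2 (Fin s) → ℕ) :
    degWeight (fun v => p v * c) m = degWeight p m * c ^ (2 * ∑ e, m e) := by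
  simp only [degWeight, mul_pow, Finset.prod_mul_distrib]
  rw [Finset.prod_pow_eq_pow_sum, sum_degM]

theorem measure_pi_poisson_mul_circM {lam : ℝ} {w : Fin s → ℝ} (hlam : 0 < lam)
    (hw : ∀ i, 0 < w i) (m : Sym2 (Fin s) → ℕ) :
    (Measure.pi fun e : Sym2 (Fin s) => poissonMeasure (mgRate lam w e)) {m} * circM m =
      ENNReal.ofReal ((∏ e, Real.exp (-(mgRate lam w e : ℝ))) * (lam ^ (∑ e, m e) *
        degWeight w m)) := by
  have h1 : (Measure.pi fun e : Sym2 (Fin s) => poissonMeasure (mgRate lam w e)) {m} =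
      ENNReal.ofReal (∏ e, Real.exp (-(mgRate lam w e : ℝ)) * (mgRate lam w e : ℝ) ^ m e /
        (m e)!) := by
    rw [Measure.pi_singleton, ENNReal.ofReal_prod_of_nonneg fun e _ => by positivity]
    exact Finset.prod_congr rfl fun e _ => poissonMeasure_singleton _ _
  rw [h1, ← ENNReal.ofReal_natCast, ← ENNReal.ofReal_mul (by positivity), ← prod_mgRate_pow hlam hw]
  congr 1
  rw [Finset.prod_div_distrib, Finset.prod_mul_distrib, circM]
  push_cast
  have : ∏ e, ((m e)! : ℝ) ≠ 0 := Finset.prod_ne_zero_iff.2 fun e _ => by positivity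
  field_simp

end Multiplicative

/-! ## The law of `(𝐩,k)`-graphs with finitely many vertices -/

section PkLaw

variable {s : ℕ}

/-- The probability measure on the indices with the weights `P.p`. -/
def indexLaw (s : ℕ) (P : OmegaP) : Measure (Fin s) :=
  ∑ i : Fin s, ENNReal.ofReal (P.p i) • Measure.dirac i

theorem indexLaw_singleton (P : OmegaP) (i : Fin s) :
    indexLaw s P {i} = ENNReal.ofReal (P.p i) := by
  classical
  simp [indexLaw, Measure.finsetSum_apply, Set.indicator_apply]

theorem letterLaw_eq_map (P : OmegaP) (h0 : ∀ i, s ≤ i → P.p i = 0) (hinf : P.pInf = 0) :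
    letterLaw P = (indexLaw s P).map fun i : Fin s => ((i : ℕ) : ℕ∞) := by
  ext B hB
  rw [Measure.map_apply (measurable_of_countable _) hB, letterLaw, hinf, ENNReal.ofReal_zero,
    zero_smul, add_zero, Measure.sum_apply _ hB, tsum_eq_sum (s := Finset.range s),
    Finset.sum_range, indexLaw, Measure.finsetSum_apply]
  · refine Finset.sum_congr rfl fun i _ => ?_
    simp only [Measure.smul_apply, Measure.dirac_apply]
    rfl
  · intro i hi
    rw [h0 i (by simpa using hi)]
    simp

theorem isProbabilityMeasure_indexLaw (P : OmegaP) (h0 : ∀ i, s ≤ i → P.p i = 0)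
    (hinf : P.pInf = 0) : IsProbabilityMeasure (indexLaw s P) := by
  constructor
  have h : letterLaw P Set.univ = 1 := measure_univ
  rwa [letterLaw_eq_map P h0 hinf, Measure.map_apply (measurable_of_countable _)
    MeasurableSet.univ, preimage_univ] at h

theorem lettersLaw_eq_map (P : OmegaP) (h0 : ∀ i, s ≤ i → P.p i = 0) (hinf : P.pInf = 0)
    [IsProbabilityMeasure (indexLaw s P)] :
    lettersLaw P = (Measure.infinitePi fun _ : ℕ => indexLaw s P).map letters := by
  have h := Measure.infinitePi_map_pi (μ := fun _ : ℕ => indexLaw s P)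
    (f := fun _ (i : Fin s) => ((i : ℕ) : ℕ∞)) (fun _ => measurable_of_countable _)
  rw [lettersLaw]
  simp only [letterLaw_eq_map P h0 hinf]
  exact h.symm

theorem measurable_letters : Measurable (letters (s := s)) :=
  measurable_pi_lambda _ fun n => (measurable_of_countable
    (fun i : Fin s => ((i : ℕ) : ℕ∞))).comp (measurable_pi_apply n)

/-- The index of a letter. -/
def indexOfLetter (hs : 0 < s) (a : ℕ∞) : Fin s :=
  if h : a.toNat < s then ⟨a.toNat, h⟩ else ⟨0, hs⟩

/-- The indices of the letters. -/
def indices (hs : 0 < s) (A : ℕ → ℕ∞) (n : ℕ) : Fin s := indexOfLetter hs (A n)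

theorem indices_letters (hs : 0 < s) (ω : ℕ → Fin s) : indices hs (letters ω) = ω := by
  funext n
  simp [indices, letters, indexOfLetter]

theorem measurable_indices (hs : 0 < s) : Measurable (indices hs) :=
  measurable_pi_lambda _ fun n =>
    (measurable_of_countable (indexOfLetter hs)).comp (measurable_pi_apply n)

theorem ae_letters_indices (hs : 0 < s) (P : OmegaP) (h0 : ∀ i, s ≤ i → P.p i = 0)
    (hinf : P.pInf = 0) (hpos : ∀ i : Fin s, 0 < P.p i) :
    ∀ᵐ A ∂lettersLaw P, letters (indices hs A) = A ∧ ∀ v, ∃ n, indices hs A n = v := by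
  have := isProbabilityMeasure_indexLaw P h0 hinf
  rw [lettersLaw_eq_map P h0 hinf, ae_map_iff measurable_letters.aemeasurable]
  · have h1 : ∀ i : Fin s, indexLaw s P {i} ≠ 0 := fun i => by
      rw [indexLaw_singleton]
      exact (ENNReal.ofReal_pos.2 (hpos i)).ne'
    filter_upwards [ae_all_iff.2 (ae_exists_eq (indexLaw s P) h1)] with ω hω
    rw [indices_letters]
    exact ⟨rfl, hω⟩
  · have h2 : MeasurableSet {A : ℕ → ℕ∞ | letters (indices hs A) = A} := by
      have : {A : ℕ → ℕ∞ | letters (indices hs A) = A} =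
          ⋂ n, (fun A : ℕ → ℕ∞ => A n) ⁻¹' {a | ((indexOfLetter hs a : ℕ) : ℕ∞) = a} := by
        ext A
        simp only [mem_ofPred_eq, mem_iInter, mem_preimage, funext_iff]
        rfl
      rw [this]
      exact MeasurableSet.iInter fun n =>
        measurable_pi_apply (X := fun _ => ℕ∞) n (Set.to_countable _).measurableSet
    have h3 : MeasurableSet {A : ℕ → ℕ∞ | ∀ v, ∃ n, indices hs A n = v} := by
      simp only [ofPred_forall, ofPred_exists]
      exact MeasurableSet.iInter fun v => MeasurableSet.iUnion fun n =>
        ((measurable_pi_apply (X := fun _ => Fin s) n).comp (measurable_indices hs))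
          (measurableSet_singleton v)
    exact h2.inter h3

/-- A measurable choice of the tree, with its root, and of the star fathers built from `ω`. -/
theorem exists_measurable_builds (hs : 0 < s) (n : ℕ) :
    ∃ X : (ℕ → Fin s) → Fin s × (Fin s → Fin s) × (Fin n → Fin s), Measurable X ∧
      ∀ ω, (∀ v, ∃ n, ω n = v) → ∀ x, X ω = x ↔ IsRooted x.1 x.2.1 ∧ Builds x.1 x.2.1 x.2.2 ω := by
  classical
  set Good : Fin s × (Fin s → Fin s) × (Fin n → Fin s) → (ℕ → Fin s) → Prop :=
    fun x ω => IsRooted x.1 x.2.1 ∧ Builds x.1 x.2.1 x.2.2 ω with hGood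
  have hG : ∀ x, MeasurableSet {ω | Good x ω} := fun x => by
    by_cases hx : IsRooted x.1 x.2.1
    · simpa only [hGood, hx, true_and] using measurableSet_builds x.1 x.2.1 x.2.2
    · simp only [hGood, hx, false_and, ofPred_false, MeasurableSet.empty]
  have hU : MeasurableSet {ω | ∃! x, Good x ω} := by
    simp only [ExistsUnique, ofPred_exists, ofPred_and, ofPred_forall]
    refine MeasurableSet.iUnion fun x => (hG x).inter (MeasurableSet.iInter fun y => ?_)
    by_cases hy : y = x
    · simp [hy]
    · simp only [hy, imp_false]
      exact (hG y).compl
  refine ⟨fun ω => if h : ∃! x, Good x ω then h.choose else (⟨0, hs⟩, fun _ => ⟨0, hs⟩,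
    fun _ => ⟨0, hs⟩), measurable_to_countable' fun x => ?_, fun ω hω x => ?_⟩
  · have : (fun ω => if h : ∃! x, Good x ω then h.choose else ((⟨0, hs⟩, fun _ => ⟨0, hs⟩,
        fun _ => ⟨0, hs⟩) : Fin s × (Fin s → Fin s) × (Fin n → Fin s))) ⁻¹' {x} =
        ({ω | ∃! x, Good x ω} ∩ {ω | Good x ω}) ∪ ({ω | ∃! x, Good x ω}ᶜ ∩
          {_ω | (⟨0, hs⟩, fun _ => ⟨0, hs⟩, fun _ => ⟨0, hs⟩) = x}) := by
      ext ω
      simp only [mem_preimage, mem_singleton_iff, mem_union, mem_inter_iff, mem_ofPred_eq,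
        mem_compl_iff]
      by_cases h : ∃! x, Good x ω
      · simp only [h, dif_pos, true_and, not_true_eq_false, false_and, or_false]
        constructor
        · rintro rfl
          exact h.choose_spec.1
        · exact fun hx => h.unique h.choose_spec.1 hx
      · simp [h]
    rw [this]
    exact (hU.inter (hG x)).union (hU.compl.inter (MeasurableSet.const _))
  · have h : ∃! x, Good x ω := existsUnique_builds hω n
    simp only [h, dif_pos]
    constructor
    · rintro rfl
      exact h.choose_spec.1
    · exact fun hx => h.unique h.choose_spec.1 hx

/-- The bias given the root, the parent function and the star fathers. -/
def buildBias (k : ℕ) (x : Fin s × (Fin s → Fin s) × (Fin (2 * k) → Fin s)) : ℝ≥0∞ :=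
  (circM (glued (treeM x.1 x.2.1) (starF x.1 x.2.2) k) : ℝ≥0∞) /
    ∏ i ∈ Finset.Icc 1 k, (squareM (glued (treeM x.1 x.2.1) (starF x.1 x.2.2) i) : ℝ≥0∞)

open Classical in
/-- The letters determine, up to a null set, a measurable triple of a root, a parent function and
star fathers, with an explicit law, which determines the bias and the glued multigraph. -/
theorem exists_measurable_triple (hs : 0 < s) (P : OmegaP) (h0 : ∀ i, s ≤ i → P.p i = 0)
    (hinf : P.pInf = 0) (hpos : ∀ i : Fin s, 0 < P.p i) (k : ℕ) :
    ∃ Y : (ℕ → ℕ∞) → Fin s × (Fin s → Fin s) × (Fin (2 * k) → Fin s), Measurable Y ∧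
      (∀ x, lettersLaw P (Y ⁻¹' {x}) = if IsRooted x.1 x.2.1 then
        (∏ v ∈ Finset.univ.erase x.1, ENNReal.ofReal (P.p (x.2.1 v))) *
          ∏ i, ENNReal.ofReal (P.p (x.2.2 i)) else 0) ∧
      ∀ᵐ A ∂lettersLaw P, treeBias k (abTree A) = buildBias k (Y A) ∧
        (glueStars (abTree A) k).removeVerts (Set.range Vertex.star) =
          ofMatrix (glued (treeM (Y A).1 (Y A).2.1) (starF (Y A).1 (Y A).2.2) k) := by
  have hprob := isProbabilityMeasure_indexLaw P h0 hinf
  obtain ⟨X, hX, hXspec⟩ := exists_measurable_builds hs (2 * k)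
  have hν : ∀ i : Fin s, indexLaw s P {i} ≠ 0 := fun i => by
    rw [indexLaw_singleton]
    exact (ENNReal.ofReal_pos.2 (hpos i)).ne'
  have hXi : Measurable fun A => X (indices hs A) := hX.comp (measurable_indices hs)
  refine ⟨fun A => X (indices hs A), hXi, fun x => ?_, ?_⟩
  · have hpre : letters ⁻¹' ((fun A => X (indices hs A)) ⁻¹' {x}) = X ⁻¹' {x} := by
      ext ω
      simp [indices_letters]
    have hxae : X ⁻¹' {x} =ᵐ[Measure.infinitePi fun _ : ℕ => indexLaw s P]
        {ω | IsRooted x.1 x.2.1 ∧ Builds x.1 x.2.1 x.2.2 ω} := by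
      filter_upwards [ae_all_iff.2 (ae_exists_eq (indexLaw s P) hν)] with ω hω
      exact propext (hXspec ω hω x)
    rw [lettersLaw_eq_map P h0 hinf,
      Measure.map_apply measurable_letters (hXi (measurableSet_singleton x)), hpre,
      measure_congr hxae]
    split_ifs with hx
    · simp only [hx, true_and]
      rw [measure_builds _ hν hx]
      simp only [indexLaw_singleton]
    · simp [hx]
  · filter_upwards [ae_letters_indices hs P h0 hinf hpos] with A hA
    obtain ⟨h1, h2⟩ := (hXspec _ hA.2 _).1 rfl
    have h3 := h2.treeBias_and_final hA.2 h1
    rwa [hA.1] at h3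

/-- Without this `Measure.map` would give zero. The final multigraph agrees almost everywhere with a
function of the measurable triple. -/
theorem aemeasurable_final (hs : 0 < s) (P : OmegaP) (h0 : ∀ i, s ≤ i → P.p i = 0)
    (hinf : P.pInf = 0) (hpos : ∀ i : Fin s, 0 < P.p i) (k : ℕ) :
    AEMeasurable (fun A => (glueStars (abTree A) k).removeVerts (Set.range Vertex.star))
      (biasedLetters P k) := by
  obtain ⟨Y, hY, -, hae⟩ := exists_measurable_triple hs P h0 hinf hpos k
  exact ⟨_, (measurable_of_countable fun x : Fin s × (Fin s → Fin s) × (Fin (2 * k) → Fin s) =>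
    ofMatrix (glued (treeM x.1 x.2.1) (starF x.1 x.2.2) k)).comp hY,
    (withDensity_absolutelyContinuous _ _).ae_le (hae.mono fun A hA => hA.2)⟩

open Classical in
theorem biasedLetters_map_apply (hs : 0 < s) (P : OmegaP) (h0 : ∀ i, s ≤ i → P.p i = 0)
    (hinf : P.pInf = 0) (hpos : ∀ i : Fin s, 0 < P.p i) (k : ℕ) {B : Set (Multigraph Vertex)}
    (hB : MeasurableSet B) :
    (biasedLetters P k).map
      (fun A => (glueStars (abTree A) k).removeVerts (Set.range Vertex.star)) B =
    ∑ x : Fin s × (Fin s → Fin s) × (Fin (2 * k) → Fin s), if IsRooted x.1 x.2.1 then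
      buildBias k x * B.indicator 1 (ofMatrix (glued (treeM x.1 x.2.1) (starF x.1 x.2.2) k)) *
        ((∏ v ∈ Finset.univ.erase x.1, ENNReal.ofReal (P.p (x.2.1 v))) *
          ∏ i, ENNReal.ofReal (P.p (x.2.2 i))) else 0 := by
  obtain ⟨Y, hY, hYlaw, hae⟩ := exists_measurable_triple hs P h0 hinf hpos k
  set G : Fin s × (Fin s → Fin s) × (Fin (2 * k) → Fin s) → Multigraph Vertex :=
    fun x => ofMatrix (glued (treeM x.1 x.2.1) (starF x.1 x.2.2) k) with hG
  have hdens : biasedLetters P k = (lettersLaw P).withDensity fun A => buildBias k (Y A) :=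
    withDensity_congr_ae (hae.mono fun A hA => hA.1)
  have hfinal : (fun A => (glueStars (abTree A) k).removeVerts (Set.range Vertex.star))
      =ᵐ[biasedLetters P k] fun A => G (Y A) :=
    (withDensity_absolutelyContinuous _ _).ae_le (hae.mono fun A hA => hA.2)
  have hGY : Measurable fun A => G (Y A) := (measurable_of_countable G).comp hY
  rw [Measure.map_congr hfinal, Measure.map_apply hGY hB, hdens,
    withDensity_apply _ (hGY hB), ← lintegral_indicator (hGY hB)]
  have hint : ∀ A, ((fun A => G (Y A)) ⁻¹' B).indicator (fun A => buildBias k (Y A)) A =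
      (fun x => buildBias k x * B.indicator 1 (G x)) (Y A) := by
    intro A
    by_cases h : G (Y A) ∈ B <;> simp [h]
  rw [lintegral_congr hint, ← lintegral_map (f := fun x => buildBias k x * B.indicator 1 (G x))
    (measurable_of_countable _) hY, lintegral_fintype]
  refine Finset.sum_congr rfl fun x _ => ?_
  rw [Measure.map_apply hY (measurableSet_singleton x), hYlaw, mul_ite, mul_zero]

/-- Triples are grouped by root and by final multigraph `m`. The probability of a triple depends
only on `r` and `m`, so the biases are summed by `circM_mul_cutWeight` to `2 ^ k`, and the roots by
`∑ p r = 1`. -/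
theorem biasedLetters_map_eq_sum (hs : 0 < s) (P : OmegaP) (h0 : ∀ i, s ≤ i → P.p i = 0)
    (hinf : P.pInf = 0) (hpos : ∀ i : Fin s, 0 < P.p i) (k : ℕ) {B : Set (Multigraph Vertex)}
    (hB : MeasurableSet B) :
    (biasedLetters P k).map
      (fun A => (glueStars (abTree A) k).removeVerts (Set.range Vertex.star)) B =
    ((∏ v : Fin s, ENNReal.ofReal (P.p v))⁻¹ * 2 ^ k) * ∑ m ∈ connWithSurplus s k,
      degWeight (fun v : Fin s => ENNReal.ofReal (P.p v)) m * B.indicator 1 (ofMatrix m) := by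
  classical
  have hprob := isProbabilityMeasure_indexLaw P h0 hinf
  set p : Fin s → ℝ≥0∞ := fun v => ENNReal.ofReal (P.p v) with hp
  have hp0 : ∏ v, p v ≠ 0 :=
    Finset.prod_ne_zero_iff.2 fun v _ => (ENNReal.ofReal_pos.2 (hpos v)).ne'
  have hptop : ∏ v, p v ≠ ∞ := ENNReal.prod_ne_top fun v _ => ENNReal.ofReal_ne_top
  have hpsum : ∑ v, p v = 1 := by
    rw [← sum_singleton_eq_one (indexLaw s P)]
    exact Finset.sum_congr rfl fun v _ => (indexLaw_singleton P v).symm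
  rw [biasedLetters_map_apply hs P h0 hinf hpos k hB, Fintype.sum_prod_type]
  have hroot : ∀ r : Fin s, ∑ y : (Fin s → Fin s) × (Fin (2 * k) → Fin s),
      (if IsRooted r y.1 then buildBias k (r, y) *
        B.indicator 1 (ofMatrix (glued (treeM r y.1) (starF r y.2) k)) *
        ((∏ v ∈ Finset.univ.erase r, p (y.1 v)) * ∏ i, p (y.2 i)) else 0) =
      ∑ m ∈ connWithSurplus s k, p r * ((∏ v, p v)⁻¹ * 2 ^ k *
        (degWeight p m * B.indicator 1 (ofMatrix m))) := by
    intro r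
    have hterm : ∀ m ∈ connWithSurplus s k, p r * ((∏ v, p v)⁻¹ * 2 ^ k *
        (degWeight p m * B.indicator 1 (ofMatrix m))) =
        ∑ π : Fin s → Fin s, ∑ q : Fin (2 * k) → Fin s,
          if IsRooted r π ∧ glued (treeM r π) (starF r q) k = m then
            (p r * ((∏ v, p v)⁻¹ * (degWeight p m * B.indicator 1 (ofMatrix m)))) *
            (circM m * ∏ i ∈ Finset.Icc 1 k,
              (squareM (glued (treeM r π) (starF r q) i) : ℝ≥0∞)⁻¹) else 0 := by
      intro m hm
      obtain ⟨hm1, hm2⟩ := mem_connWithSurplus.1 hm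
      rw [← circM_mul_cutWeight hs r k m hm1 hm2, Finset.sum_comm, cutWeight]
      simp only [Finset.mul_sum, Finset.sum_mul]
      refine Finset.sum_congr rfl fun q _ => Finset.sum_congr rfl fun π _ => ?_
      split_ifs
      · ring
      · simp
    rw [Finset.sum_congr rfl hterm, Finset.sum_comm, Fintype.sum_prod_type]
    refine Finset.sum_congr rfl fun π _ => ?_
    rw [Finset.sum_comm]
    refine Finset.sum_congr rfl fun q _ => ?_
    simp only
    by_cases hπ : IsRooted r π
    · rw [if_pos hπ, Finset.sum_eq_single_of_mem _ (glued_mem_connWithSurplus hπ (starF r q))]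
      · rw [if_pos ⟨hπ, rfl⟩, buildBias, div_eq_mul_inv]
        have hinv : (∏ i ∈ Finset.Icc 1 k,
            (squareM (glued (treeM r π) (starF r q) i) : ℝ≥0∞))⁻¹ = ∏ i ∈ Finset.Icc 1 k,
            (squareM (glued (treeM r π) (starF r q) i) : ℝ≥0∞)⁻¹ :=
          ENNReal.prod_inv_distrib fun i _ j _ _ => .inr (ENNReal.natCast_ne_top _)
        have hw : (∏ v ∈ Finset.univ.erase r, p (π v)) * ∏ i, p (q i) =
            (∏ v, p v)⁻¹ * (p r * degWeight p (glued (treeM r π) (starF r q) k)) := by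
          rw [degWeight_glued, ← mul_assoc, ENNReal.inv_mul_cancel hp0 hptop, one_mul]
        rw [hinv, hw]
        ring
      · intro m _ hne
        rw [if_neg]
        rintro ⟨-, h⟩
        exact hne h.symm
    · simp [hπ]
  rw [Finset.sum_congr rfl fun r _ => hroot r, Finset.sum_comm]
  simp only [← Finset.sum_mul, hpsum, one_mul, ← Finset.mul_sum]

theorem pkLaw_apply (hs : 0 < s) (P : OmegaP) (h0 : ∀ i, s ≤ i → P.p i = 0)
    (hinf : P.pInf = 0) (hpos : ∀ i : Fin s, 0 < P.p i) (k : ℕ) {B : Set (Multigraph Vertex)}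
    (hB : MeasurableSet B) :
    pkLaw P k B =
    (∑ m ∈ connWithSurplus s k, degWeight (fun v : Fin s => ENNReal.ofReal (P.p v)) m)⁻¹ *
      ∑ m ∈ connWithSurplus s k,
        degWeight (fun v : Fin s => ENNReal.ofReal (P.p v)) m * B.indicator 1 (ofMatrix m) := by
  set K : ℝ≥0∞ := (∏ v : Fin s, ENNReal.ofReal (P.p v))⁻¹ * 2 ^ k with hKdef
  have hp0 : ∏ v : Fin s, ENNReal.ofReal (P.p v) ≠ 0 :=
    Finset.prod_ne_zero_iff.2 fun v _ => (ENNReal.ofReal_pos.2 (hpos v)).ne'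
  have hptop : ∏ v : Fin s, ENNReal.ofReal (P.p v) ≠ ∞ :=
    ENNReal.prod_ne_top fun v _ => ENNReal.ofReal_ne_top
  have hK0 : K ≠ 0 := mul_ne_zero (ENNReal.inv_ne_zero.2 hptop) (by simp)
  have hK : K ≠ ∞ := ENNReal.mul_ne_top (ENNReal.inv_ne_top.2 hp0) (by finiteness)
  have hmass : biasedLetters P k Set.univ =
      K * ∑ m ∈ connWithSurplus s k, degWeight (fun v : Fin s => ENNReal.ofReal (P.p v)) m := by
    have h := biasedLetters_map_eq_sum hs P h0 hinf hpos k MeasurableSet.univ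
    rw [Measure.map_apply_of_aemeasurable (aemeasurable_final hs P h0 hinf hpos k)
      MeasurableSet.univ, preimage_univ] at h
    simpa using h
  rw [pkLaw, Measure.map_smul, Measure.smul_apply, smul_eq_mul,
    biasedLetters_map_eq_sum hs P h0 hinf hpos k hB, hmass,
    ENNReal.mul_inv (.inl hK0) (.inl hK), mul_mul_mul_comm, ENNReal.inv_mul_cancel hK0 hK, one_mul]

theorem mg_hasBiasedConditionedLaw (k : ℕ) (hs : 0 < s) {lam : ℝ} {w : Fin s → ℝ}
    (hW : OmegaMG lam w) :
    HasBiasedConditionedLaw (mgLaw lam w) {G | G.Connected ∧ G.surplus = k}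
      (pkLaw (normalizedWeights hs w hW.2.1 hW.2.2) k) := by
  obtain ⟨hlam, hw, hanti⟩ := hW
  set W := ∑ j, w j with hWdef
  have hWpos : 0 < W := Finset.sum_pos (fun j _ => hw j) ⟨⟨0, hs⟩, Finset.mem_univ _⟩
  have hP : ∀ i : Fin s, (normalizedWeights hs w hw hanti).p i = w i / W := fun i => by
    simp [normalizedWeights, hWdef]
  have hPpos : ∀ i : Fin s, 0 < (normalizedWeights hs w hw hanti).p i := fun i => by
    rw [hP]
    exact div_pos (hw i) hWpos
  set P := normalizedWeights hs w hw hanti with hPdef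
  have hwP : w = fun i : Fin s => P.p i * W := by
    funext i
    rw [hP, div_mul_cancel₀ _ hWpos.ne']
  -- There are `s + k - 1` edges, where `s ≥ 1` makes the subtraction exact. Replacing `w` by `p`
  -- costs one factor `W` for each half-edge.
  set L : ℝ := (∏ e, Real.exp (-(mgRate lam w e : ℝ))) * (lam ^ (s + k - 1) *
    W ^ (2 * (s + k - 1))) with hL
  have hLpos : 0 < L := by positivity
  refine hasBiasedConditionedLaw_of_finset hs _ _ _ (connWithSurplus s k)
    (connWithSurplus_nonempty hs k) (degWeight fun v : Fin s => ENNReal.ofReal (P.p v))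
    (fun m _ => Finset.prod_ne_zero_iff.2 fun v _ =>
      pow_ne_zero _ (ENNReal.ofReal_pos.2 (hPpos v)).ne')
    (fun m _ => ENNReal.prod_ne_top fun v _ => ENNReal.pow_ne_top ENNReal.ofReal_ne_top)
    (ENNReal.ofReal L) (ENNReal.ofReal_pos.2 hLpos).ne' ENNReal.ofReal_ne_top ?_ ?_
    fun B hB => pkLaw_apply hs P (fun i hi => dif_neg (by omega)) rfl hPpos k hB
  · rintro m ⟨h1, h2⟩ hm
    rw [ofMatrix_surplus] at h2
    exact absurd (mem_connWithSurplus.2 ⟨(ofMatrix_connected_iff m hs).1 h1, by omega⟩) hm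
  · intro m hm
    obtain ⟨h1, h2⟩ := mem_connWithSurplus.1 hm
    refine ⟨⟨(ofMatrix_connected_iff m hs).2 h1, by rw [ofMatrix_surplus]; omega⟩, ?_⟩
    have hdeg : degWeight (fun v : Fin s => ENNReal.ofReal (P.p v)) m =
        ENNReal.ofReal (degWeight (fun v : Fin s => P.p v) m) := by
      rw [degWeight, degWeight, ENNReal.ofReal_prod_of_nonneg fun v _ =>
        pow_nonneg (hPpos v).le _]
      exact Finset.prod_congr rfl fun v _ => (ENNReal.ofReal_pow (hPpos v).le _).symm
    have hdw : degWeight w m =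
        degWeight (fun v : Fin s => P.p v) m * W ^ (2 * ∑ e, m e) := by
      conv_lhs => rw [hwP]
      exact degWeight_mul_left W _ m
    rw [measure_pi_poisson_mul_circM hlam hw, hdeg, ← ENNReal.ofReal_mul hLpos.le, hdw,
      show ∑ e, m e = s + k - 1 by omega, hL]
    congr 1
    ring

end PkLaw

end ConnMultigraph

end

theorem mainTheorem5 (k : ℕ) :
    (∀ (s : ℕ) (d : Fin s → ℕ), 0 < s → ConnMultigraph.OmegaCM d → (2 ≤ s → ∀ i, 1 ≤ d i) →
      ((∑ i, d i : ℕ) : ℤ) = 2 * s + 2 * k - 2 →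
      ConnMultigraph.HasBiasedConditionedLaw (ConnMultigraph.cmLaw d)
        {G | G.Connected}
        (ConnMultigraph.dkLaw (fun i => (d i : ℤ) - 1) k)) ∧
    (∀ (s : ℕ) (lam : ℝ) (w : Fin s → ℝ) (hs : 0 < s) (hW : ConnMultigraph.OmegaMG lam w),
      ConnMultigraph.HasBiasedConditionedLaw (ConnMultigraph.mgLaw lam w)
        {G | G.Connected ∧ G.surplus = k}
        (ConnMultigraph.pkLaw (ConnMultigraph.normalizedWeights hs w hW.2.1 hW.2.2) k)) :=
  ⟨fun _ _ hs _ hd hsum => ConnMultigraph.cm_hasBiasedConditionedLaw hs hd k hsum,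
    fun _ _ _ hs hW => ConnMultigraph.mg_hasBiasedConditionedLaw k hs hW⟩
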